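/- Let $n\ge 1$ and let $\Theta_{n-1}$ be Joyal's cell category ($\Theta_0$ is the terminal category and $\Theta_{k}=\Delta\wr\Theta_{k-1}$ for $k\ge 1$). Write $\mathcal V=\mathcal{S}et^{\Theta_{n-1}^{\mathrm{op}}\times\Delta^{\mathrm{op}}}$ for the category of $\Theta_{n-1}$-spaces, with its cartesian closed structure, and $\mathcal V^{\Delta^{\mathrm{op}}}$ for the category of simplicial objects in $\mathcal V$. Let $\mathrm{PCat}(\mathcal V)\subseteq\mathcal V^{\Delta^{\mathrm{op}}}$ be the full subcategory of those $W$ such that $W_0$ is discrete (isomorphic to a constant presheaf), and let $L$ be the left adjoint of the inclusion. Let $\mathfrak C\colon \mathrm{PCat}(\mathcal V)\to\mathcal V\text{-}\mathrm{Cat}$ be the homotopy coherent categorification: $\mathfrak C W$ has object set $W_0$ and $$\mathrm{Hom}_{\mathfrak C W}(a,b)_{\theta,k}=\big(\mathrm{Hom}_{c^h(W_{-,\theta,k})}(a,b)\big)_k ,$$ where $c^h$ from simplicial sets to simplicial categories is the left adjoint of the homotopy coherent nerve, i.e. the colimit-preserving functor whose value at $\Delta[m]$ is the simplicial category with objects $0,\dots,m$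 and with $\mathrm{Hom}(i,j)$ the nerve of the poset of subsets of $\{i,\dots,j\}$ containing $i$ and $j$ (empty if $j<i$), ordered by inclusion, with composition given by union. For $W\in\mathrm{PCat}(\mathcal V)$ and a map $\sigma\colon F[m,\theta,k]\to W$ from the representable object at $([m],\theta,[k])$, let $W_\sigma$ be the pushout in $\mathrm{PCat}(\mathcal V)$ of $LF[m+1,\theta,k]\xleftarrow{L[d^{m+1},\theta,k]}LF[m,\theta,k]\xrightarrow{\sigma}W$, with canonical map $\iota_\sigma\colon W\to W_\sigma$, and let $\top\in (W_\sigma)_0$ be the image of the vertex $m+1$. Put $\mathrm{St}_W(\sigma)=\mathrm{Hom}_{\mathfrak C W_\sigma}(\mathfrak C\iota_\sigma(-),\top)\colon\mathfrak C W^{\mathrm{op}}\to\mathcal V$. The straightening functor $$\mathrm{St}_W\colon \mathcal V^{\Delta^{\mathrm{op}}}_{/W}\to[\mathfrak C W^{\mathrm{op}},\mathcal V]$$ into the category of $\mathcal V$-enriched functors and $\mathcal V$-enriched natural transformations is the left Kan extension of $\sigma\mapsto \mathrm{St}_W(\sigma)$ from the category of elements of $W$ along the inclusion of the representable objects $\sigma$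 over $W$. **Proposition.** Let $f\colon W\to Z$ be a map in $\mathrm{PCat}(\mathcal V)$. Let $f_!\colon \mathcal V^{\Delta^{\mathrm{op}}}_{/W}\to \mathcal V^{\Delta^{\mathrm{op}}}_{/Z}$ be post-composition with $f$ and let $(\mathfrak C f)_!\colon[\mathfrak C W^{\mathrm{op}},\mathcal V]\to[\mathfrak C Z^{\mathrm{op}},\mathcal V]$ be the $\mathcal V$-enriched left Kan extension along $\mathfrak C f$ (the left adjoint of restriction along $\mathfrak C f$). Then there is a natural isomorphism of functors $$(\mathfrak C f)_!\circ \mathrm{St}_W\;\cong\;\mathrm{St}_Z\circ f_! .$$ -/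

import Mathlib

open CategoryTheory Opposite Limits

universe u

noncomputable section

namespace ThetaSpaces

/-! ### Joyal's cell categories -/

/-- Objects `[ℓ](c₁, …, c_ℓ)` of the wreath product `Δ ≀ C`. -/
structure Wreath (C : Type) : Type where
  /-- the length `ℓ` -/
  len : ℕ
  /-- the labels; `label i` sits on the edge from `i` to `i + 1` of `[ℓ]` -/
  label : Fin len → C

namespace Wreath

variable {C : Type} [Category.{0} C]

/-- A morphism `[ℓ](c₁, …, c_ℓ) ⟶ [m](d₁, …, d_m)` of `Δ ≀ C`: a monotone map `φ : [ℓ] → [m]`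
together with a morphism `c_i ⟶ d_j` for every edge `(j, j + 1)` of `[m]` that is contained in the
interval from `φ i` to `φ (i + 1)`. -/
@[ext]
structure Hom (X Y : Wreath C) : Type where
  /-- the underlying monotone map -/
  base : Fin (X.len + 1) →o Fin (Y.len + 1)
  /-- the morphisms between labels -/
  fiber : ∀ (i : Fin X.len) (j : Fin Y.len),
    base i.castSucc ≤ j.castSucc → j.succ ≤ base i.succ → (X.label i ⟶ Y.label j)

/-- Given a monotone `ψ` and an edge `(k, k + 1)` contained in the interval from `ψ a` to `ψ b`,
there is an edge `(j, j + 1)` between `a` and `b` such that `(k, k + 1)` is contained in the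
interval from `ψ j` to `ψ (j + 1)`. -/
lemma exists_edge {m n : ℕ} (ψ : Fin (m + 1) →o Fin (n + 1)) (a b : Fin (m + 1)) (k : Fin n)
    (h₁ : ψ a ≤ k.castSucc) (h₂ : k.succ ≤ ψ b) :
    ∃ j : Fin m, a ≤ j.castSucc ∧ j.succ ≤ b ∧ ψ j.castSucc ≤ k.castSucc ∧ k.succ ≤ ψ j.succ := by
  induction b using Fin.induction with
  | zero =>
    exfalso
    have h := ψ.monotone (Fin.zero_le a)
    have h' := (h₂.trans h).trans h₁
    simp [Fin.le_def] at h'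
  | succ b ih =>
    by_cases h : k.succ ≤ ψ b.castSucc
    · obtain ⟨j, h1, h2, h3, h4⟩ := ih h
      exact ⟨j, h1, h2.trans (Fin.castSucc_lt_succ).le, h3, h4⟩
    · have h3 : ψ b.castSucc ≤ k.castSucc := by
        simp only [Fin.le_def, Fin.val_succ, Fin.val_castSucc] at h ⊢
        omega
      refine ⟨b, ?_, le_rfl, h3, h₂⟩
      by_contra hab
      have hab' : b.succ ≤ a := by
        simp only [Fin.le_def, Fin.val_succ, Fin.val_castSucc] at hab ⊢
        omega
      have h' := (h₂.trans (ψ.monotone hab')).trans h₁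
      simp [Fin.le_def] at h'

/-- The edge in `exists_edge` is unique. -/
lemma edge_unique {m n : ℕ} (ψ : Fin (m + 1) →o Fin (n + 1)) (k : Fin n) (j j' : Fin m)
    (h₁ : ψ j.castSucc ≤ k.castSucc) (h₂ : k.succ ≤ ψ j.succ)
    (h₁' : ψ j'.castSucc ≤ k.castSucc) (h₂' : k.succ ≤ ψ j'.succ) : j = j' := by
  by_contra hne
  have key : ∀ a b : Fin m, ψ b.castSucc ≤ k.castSucc → k.succ ≤ ψ a.succ → ¬ a < b := by
    intro a b hb ha hab
    have : a.succ ≤ b.castSucc := by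
      simp only [Fin.le_def, Fin.val_succ, Fin.val_castSucc, Fin.lt_def] at hab ⊢
      omega
    have h' := (ha.trans (ψ.monotone this)).trans hb
    simp [Fin.le_def] at h'
  rcases lt_or_gt_of_ne hne with h | h
  · exact key _ _ h₁' h₂ h
  · exact key _ _ h₁ h₂' h

/-- The identity morphism of `Δ ≀ C`. -/
def Hom.id (X : Wreath C) : Hom X X where
  base := OrderHom.id
  fiber i j h₁ h₂ := eqToHom (congrArg X.label (edge_unique OrderHom.id j i j
    h₁ h₂ le_rfl le_rfl))

/-- The composition of `Δ ≀ C`: the label component over the edges `i` and `k` is the composite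
`c_i ⟶ d_j ⟶ e_k` for the unique intermediate edge `j`. -/
def Hom.comp {X Y Z : Wreath C} (f : Hom X Y) (g : Hom Y Z) : Hom X Z where
  base := g.base.comp f.base
  fiber i k h₁ h₂ :=
    have h := exists_edge g.base (f.base i.castSucc) (f.base i.succ) k h₁ h₂
    f.fiber i h.choose h.choose_spec.1 h.choose_spec.2.1 ≫
      g.fiber h.choose k h.choose_spec.2.2.1 h.choose_spec.2.2.2

lemma Hom.comp_fiber {X Y Z : Wreath C} (f : Hom X Y) (g : Hom Y Z) (i : Fin X.len) (j : Fin Y.len)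
    (k : Fin Z.len) (h₁ : f.base i.castSucc ≤ j.castSucc) (h₂ : j.succ ≤ f.base i.succ)
    (h₃ : g.base j.castSucc ≤ k.castSucc) (h₄ : k.succ ≤ g.base j.succ)
    (h₅ : (f.comp g).base i.castSucc ≤ k.castSucc) (h₆ : k.succ ≤ (f.comp g).base i.succ) :
    (f.comp g).fiber i k h₅ h₆ = f.fiber i j h₁ h₂ ≫ g.fiber j k h₃ h₄ := by
  have h := exists_edge g.base (f.base i.castSucc) (f.base i.succ) k h₅ h₆
  obtain rfl : j = h.choose := edge_unique g.base k _ _ h₃ h₄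
    h.choose_spec.2.2.1 h.choose_spec.2.2.2
  rfl

lemma Hom.ext_fiber {X Y : Wreath C} (f g : Hom X Y) (h : f.base = g.base)
    (h' : ∀ i j h₁ h₂ h₃ h₄, f.fiber i j h₁ h₂ = g.fiber i j h₃ h₄) : f = g := by
  obtain ⟨fb, ff⟩ := f
  obtain ⟨gb, gf⟩ := g
  obtain rfl : fb = gb := h
  congr 1
  funext i j h₁ h₂
  exact h' i j h₁ h₂ h₁ h₂

instance : Category.{0} (Wreath C) where
  Hom := Hom
  id := Hom.id
  comp f g := f.comp g
  id_comp {X Y} f := Hom.ext_fiber _ _ rfl fun i j h₁ h₂ h₃ h₄ => by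
    rw [Hom.comp_fiber (Hom.id X) f i i j le_rfl le_rfl h₃ h₄]
    simp [Hom.id]
  comp_id {X Y} f := Hom.ext_fiber _ _ rfl fun i j h₁ h₂ h₃ h₄ => by
    rw [Hom.comp_fiber f (Hom.id Y) i j j h₃ h₄ le_rfl le_rfl]
    simp [Hom.id]
  assoc {X Y Z T} f g h := Hom.ext_fiber _ _ rfl fun i l h₁ h₂ h₃ h₄ => by
    obtain ⟨k, a₁, a₂, a₃, a₄⟩ := exists_edge h.base _ _ l h₁ h₂
    obtain ⟨j, b₁, b₂, b₃, b₄⟩ := exists_edge g.base _ _ k a₁ a₂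
    rw [Hom.comp_fiber (f.comp g) h i k l a₁ a₂ a₃ a₄, Hom.comp_fiber f g i j k b₁ b₂ b₃ b₄,
      Hom.comp_fiber f (g.comp h) i j l b₁ b₂ (le_trans (h.base.monotone b₃) a₃)
        (le_trans a₄ (h.base.monotone b₄)), Hom.comp_fiber g h j k l b₃ b₄ a₃ a₄, Category.assoc]

end Wreath

/-- Joyal's cell category `Θ_d`, as a bundled category: `Θ_0` is the terminal category, and
`Θ_{d+1} = Δ ≀ Θ_d`. -/
def thetaCat : ℕ → Cat.{0, 0}
  | 0 => Cat.of (Discrete PUnit.{1})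
  | d + 1 => Cat.of (Wreath (thetaCat d))

/-- Joyal's cell category `Θ_d`. -/
abbrev Theta (d : ℕ) : Type := thetaCat d

namespace Theta

/-- The object `[0]` of `Θ_d`. -/
def pt : ∀ d : ℕ, Theta d
  | 0 => (⟨⟨⟩⟩ : Discrete PUnit.{1})
  | d + 1 => (⟨0, Fin.elim0⟩ : Wreath (thetaCat d))

/-- The object `[0]` of `Θ_d` is terminal. -/
def isTerminalPt : ∀ d : ℕ, IsTerminal (pt d)
  | 0 => show IsTerminal (⟨⟨⟩⟩ : Discrete PUnit.{1}) from
      IsTerminal.ofUniqueHom (fun _ => eqToHom (Subsingleton.elim _ _))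
        (fun _ _ => Subsingleton.elim _ _)
  | d + 1 => show IsTerminal (⟨0, Fin.elim0⟩ : Wreath (thetaCat d)) from
      IsTerminal.ofUniqueHom
        (fun _ => { base := ⟨fun _ => 0, fun _ _ _ => le_rfl⟩, fiber := fun _ j => j.elim0 })
        (fun _ _ => Wreath.Hom.ext_fiber _ _
          (OrderHom.ext _ _ (funext fun _ => Subsingleton.elim (α := Fin 1) _ _))
          (fun _ j => j.elim0))

/-- The map `[0] ⟶ θ` that picks the object `0` of the cell `θ`. -/
def point : ∀ {d : ℕ} (θ : Theta d), pt d ⟶ θ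
  | 0, θ => show (⟨⟨⟩⟩ : Discrete PUnit.{1}) ⟶ θ from eqToHom (Subsingleton.elim _ _)
  | d + 1, θ => show Wreath.Hom (⟨0, Fin.elim0⟩ : Wreath (thetaCat d)) θ from
      { base := ⟨fun _ => 0, fun _ _ _ => le_rfl⟩, fiber := fun i => i.elim0 }

end Theta

/-! ### `Θ_d`-spaces, simplicial `Θ_d`-spaces and precategories -/

/-- The indexing category `Θ_d × Δ` of `Θ_d`-spaces. -/
abbrev Cell (d : ℕ) : Type := Theta d × SimplexCategory

/-- `Θ_d`-spaces, i.e. simplicial presheaves on `Θ_d`, viewed as presheaves on `Θ_d × Δ`. -/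
abbrev ThetaSpace (d : ℕ) : Type (u + 1) := (Cell d)ᵒᵖ ⥤ Type u

/-- The indexing category `Δ × (Θ_d × Δ)` of simplicial objects in `Θ_d`-spaces. -/
abbrev Shape (d : ℕ) : Type := SimplexCategory × Cell d

/-- Simplicial objects in `Θ_d`-spaces, i.e. `(Δ × Θ_d)`-spaces, viewed as presheaves on
`Δ × (Θ_d × Δ)`. -/
abbrev SimplicialThetaSpace (d : ℕ) : Type (u + 1) := (Shape d)ᵒᵖ ⥤ Type u

namespace Cell

variable {d : ℕ}

/-- The terminal object `([0], [0])` of `Θ_d × Δ`. -/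
noncomputable def pt (d : ℕ) : Cell d := (Theta.pt d, ⟨0⟩)

/-- The map to the terminal object. -/
noncomputable def toPt (x : Cell d) : x ⟶ pt d :=
  Prod.mkHom ((Theta.isTerminalPt d).from x.1) (SimplexCategory.isTerminalZero.from x.2)

/-- The map `([0], [0]) ⟶ (θ, [k])` that picks the object `0` of `θ` and the vertex `0` of `[k]`. -/
noncomputable def point (x : Cell d) : pt d ⟶ x :=
  Prod.mkHom (Theta.point x.1) (SimplexCategory.const ⟨0⟩ x.2 0)

lemma toPt_unique {x : Cell d} (f g : x ⟶ pt d) : f = g :=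
  Prod.ext ((Theta.isTerminalPt d).hom_ext _ _) (SimplexCategory.isTerminalZero.hom_ext _ _)

end Cell

section Discrete

variable {d : ℕ}

/-- The `Θ_d`-space `W_m` of a simplicial `Θ_d`-space `W`. -/
abbrev level (W : SimplicialThetaSpace.{u} d) (m : SimplexCategory) : ThetaSpace.{u} d :=
  (Prod.sectR m (Cell d)).op ⋙ W

/-- A `Θ_d`-space is discrete if it is (isomorphic to) a constant presheaf, i.e. it is in the
essential image of the inclusion of sets. -/
def IsDiscrete (X : ThetaSpace.{u} d) : Prop :=
  (Functor.const (Cell d)ᵒᵖ : Type u ⥤ ThetaSpace.{u} d).essImage X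

/-- The property of a simplicial `Θ_d`-space `W` that `W_0` is discrete. -/
def isPrecat (d : ℕ) : ObjectProperty (SimplicialThetaSpace.{u} d) :=
  fun W => IsDiscrete (level W ⟨0⟩)

/-- The category of precategories in `Θ_d`-spaces: the full subcategory of simplicial
`Θ_d`-spaces `W` such that `W_0` is discrete. -/
abbrev Pcat (d : ℕ) : Type (u + 1) := (isPrecat.{u} d).FullSubcategory

lemma IsDiscrete.bijective {X : ThetaSpace.{u} d} (hX : IsDiscrete X) {x y : (Cell d)ᵒᵖ}
    (f : x ⟶ y) : Function.Bijective (X.map f) := by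
  obtain ⟨S, ⟨e⟩⟩ := hX
  have h : X.map f = e.inv.app x ≫ e.hom.app y := by
    have := e.hom.naturality f
    simp only [Functor.const_obj_map] at this
    have h2 : e.hom.app x ≫ X.map f = e.hom.app y := by rw [← this]; exact Category.id_comp _
    rw [← h2]; simp
  rw [h]
  exact (isIso_iff_bijective _).1 inferInstance

lemma IsDiscrete.eq_of_conn {X : ThetaSpace.{u} d} (hX : IsDiscrete X) {x : (Cell d)ᵒᵖ}
    (s t : X.obj x) (h : X.ιColimitType x s = X.ιColimitType x t) : s = t := by
  obtain ⟨S, ⟨e⟩⟩ := hX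
  let c : X.CoconeTypes :=
    { pt := S
      ι := fun y => e.inv.app y
      ι_naturality := fun {y z} f => by
        have := e.inv.naturality f
        funext w
        exact ConcreteCategory.congr_hom this w }
  have h' := congrArg (X.descColimitType c) h
  simp only [Functor.descColimitType_ιColimitType_apply] at h'
  exact ((isIso_iff_bijective (e.inv.app x)).1 inferInstance).1 h'

end Discrete

/-! ### The reflection of simplicial `Θ_d`-spaces onto precategories -/

namespace Reflection

variable {d : ℕ} (X : SimplicialThetaSpace.{u} d)

/-- The unique map `([m], x) ⟶ ([0], x)` over the identity of `x`. -/
def toZero (m : SimplexCategory) (x : Cell d) : ((m, x) : Shape d) ⟶ (⟨0⟩, x) :=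
  Prod.mkHom (SimplexCategory.isTerminalZero.from m) (𝟙 x)

lemma comp_toZero {m m' : SimplexCategory} {x x' : Cell d} (f : ((m', x') : Shape d) ⟶ (m, x)) :
    f ≫ toZero m x = toZero m' x' ≫ Prod.mkHom (𝟙 _) f.2 :=
  Prod.ext (SimplexCategory.isTerminalZero.hom_ext _ _) (by simp [toZero])

/-- Two elements of `X_{m,x}` are identified if they are equal to total degeneracies of elements
of `X_{0,x}` that lie in the same connected component of the `Θ_d`-space `X_0`. -/
def rel (c : (Shape d)ᵒᵖ) (s t : X.obj c) : Prop :=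
  ∃ s₀ t₀ : (level X ⟨0⟩).obj (op c.unop.2),
    X.map (toZero c.unop.1 c.unop.2).op s₀ = s ∧ X.map (toZero c.unop.1 c.unop.2).op t₀ = t ∧
      (level X ⟨0⟩).ιColimitType _ s₀ = (level X ⟨0⟩).ιColimitType _ t₀

lemma rel_map {c c' : (Shape d)ᵒᵖ} (f : c ⟶ c') (s t : X.obj c) (h : rel X c s t) :
    rel X c' (X.map f s) (X.map f t) := by
  obtain ⟨s₀, t₀, rfl, rfl, h⟩ := h
  have key : ∀ z : (level X ⟨0⟩).obj (op c.unop.2),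
      X.map (toZero c'.unop.1 c'.unop.2).op ((level X ⟨0⟩).map f.unop.2.op z) =
        X.map f (X.map (toZero c.unop.1 c.unop.2).op z) := by
    intro z
    have h1 := congrArg Quiver.Hom.op (comp_toZero f.unop)
    have h2 := congrArg (fun g => X.map g z) h1
    exact ((X.map_comp_apply _ _ z).symm.trans h2.symm).trans (X.map_comp_apply _ _ z)
  refine ⟨(level X ⟨0⟩).map f.unop.2.op s₀, (level X ⟨0⟩).map f.unop.2.op t₀, key _, key _, ?_⟩
  rw [Functor.ιColimitType_map, Functor.ιColimitType_map, h]

/-- The underlying simplicial `Θ_d`-space of the reflection: the quotient of `X` in which the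
`Θ_d`-space `X_0` is replaced by its set of connected components. -/
def obj : SimplicialThetaSpace.{u} d where
  obj c := Quot (rel X c)
  map f := ↾(Quot.map (X.map f) (rel_map X f))
  map_id _ := by
    ext s
    induction s using Quot.ind
    simp [Quot.map]
  map_comp f g := by
    ext s
    induction s using Quot.ind
    simp [Quot.map]

/-- The quotient map. -/
def unit : X ⟶ obj X where
  app _ := ↾(Quot.mk _)
  naturality _ _ _ := rfl

lemma obj_map_mk {c c' : (Shape d)ᵒᵖ} (f : c ⟶ c') (s : X.obj c) :
    (obj X).map f (Quot.mk _ s) = Quot.mk _ (X.map f s) := rfl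

lemma map_toZero (x : Cell d) (s : X.obj (op (⟨0⟩, x))) : X.map (toZero ⟨0⟩ x).op s = s := by
  have h : toZero ⟨0⟩ x = 𝟙 _ := Prod.ext (SimplexCategory.isTerminalZero.hom_ext _ _) rfl
  rw [h, op_id, X.map_id_apply]

/-- The identification of `(obj X)_0` with the constant presheaf on the set of connected components
of `X_0`. -/
def levelZeroIso : (Functor.const (Cell d)ᵒᵖ).obj ((level X ⟨0⟩).ColimitType) ≅ level (obj X) ⟨0⟩ :=
  Iso.symm <| NatIso.ofComponents
    (fun x => Equiv.toIso <| Equiv.ofBijective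
      (Quot.lift (fun s => (level X ⟨0⟩).ιColimitType x s) (by
        rintro s t ⟨s₀, t₀, rfl, rfl, h⟩
        have e₁ := map_toZero X x.unop s₀
        have e₂ := map_toZero X x.unop t₀
        exact (congrArg _ e₁).trans (h.trans (congrArg _ e₂).symm)))
      (by
        constructor
        · intro s t h
          induction s using Quot.ind with | mk s => ?_
          induction t using Quot.ind with | mk t => ?_
          exact Quot.sound ⟨s, t, map_toZero X x.unop s, map_toZero X x.unop t, h⟩
        · intro z
          obtain ⟨y, w, rfl⟩ := (level X ⟨0⟩).ιColimitType_jointly_surjective z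
          refine ⟨Quot.mk _ ((level X ⟨0⟩).map (x.unop.toPt ≫ y.unop.point).op w), ?_⟩
          exact (level X ⟨0⟩).ιColimitType_map _ w))
    (by
      intro x y f
      ext s
      induction s using Quot.ind with | mk s => ?_
      exact (level X ⟨0⟩).ιColimitType_map f s)

lemma isPrecat_obj : isPrecat d (obj X) := ⟨_, ⟨levelZeroIso X⟩⟩

variable {X} in
lemma rel_eq {Y : Pcat.{u} d} (f : X ⟶ Y.obj) {c : (Shape d)ᵒᵖ} {s t : X.obj c}
    (h : rel X c s t) : f.app c s = f.app c t := by
  obtain ⟨s₀, t₀, rfl, rfl, h⟩ := h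
  have e : f.app (op (⟨0⟩, c.unop.2)) s₀ = f.app (op (⟨0⟩, c.unop.2)) t₀ := by
    refine Y.property.eq_of_conn (x := op c.unop.2) _ _ ?_
    let c : (level X ⟨0⟩).CoconeTypes :=
      { pt := (level Y.obj ⟨0⟩).ColimitType
        ι := fun y s => (level Y.obj ⟨0⟩).ιColimitType y (f.app (op (⟨0⟩, y.unop)) s)
        ι_naturality := fun {y z} g => by
          funext w
          have e := NatTrans.naturality_apply f ((Prod.sectR ⟨0⟩ (Cell d)).op.map g) w
          exact (congrArg _ e).trans ((level Y.obj ⟨0⟩).ιColimitType_map g _) }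
    exact congrArg ((level X ⟨0⟩).descColimitType c) h
  have e₁ := NatTrans.naturality_apply f (toZero c.unop.1 c.unop.2).op s₀
  have e₂ := NatTrans.naturality_apply f (toZero c.unop.1 c.unop.2).op t₀
  exact e₁.trans ((congrArg _ e).trans e₂.symm)

/-- The universal property of the reflection. -/
def homEquiv (Y : Pcat.{u} d) :
    ((⟨obj X, isPrecat_obj X⟩ : Pcat.{u} d) ⟶ Y) ≃ (X ⟶ (isPrecat d).ι.obj Y) where
  toFun g := unit X ≫ g.hom
  invFun f := ObjectProperty.homMk
    { app := fun c => ↾(Quot.lift (f.app c) (fun _ _ h => rel_eq f h))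
      naturality := fun c c' g => by
        ext s
        induction s using Quot.ind with | mk s => ?_
        exact NatTrans.naturality_apply f g s }
  left_inv g := by
    apply ObjectProperty.hom_ext
    ext c s
    induction s using Quot.ind with | mk s => ?_
    rfl
  right_inv f := rfl

end Reflection

/-- The inclusion `I` of precategories into simplicial `Θ_d`-spaces has a left adjoint `L`. -/
instance (d : ℕ) : Reflective (isPrecat.{u} d).ι where
  L := Adjunction.leftAdjointOfEquiv (F_obj := fun X => ⟨Reflection.obj X, Reflection.isPrecat_obj X⟩)
    Reflection.homEquiv (fun _ _ _ _ _ => rfl)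
  adj := Adjunction.adjunctionOfEquivLeft Reflection.homEquiv (fun _ _ _ _ _ => rfl)

instance (d : ℕ) : HasColimitsOfSize.{0, 0} (Pcat.{u} d) :=
  ⟨fun _ => hasColimitsOfShape_of_reflective (isPrecat.{u} d).ι⟩

/-- The left adjoint `L` of the inclusion `I` of precategories into simplicial `Θ_d`-spaces. -/
abbrev L (d : ℕ) : SimplicialThetaSpace.{u} d ⥤ Pcat.{u} d := reflector (isPrecat.{u} d).ι

/-- The adjunction `L ⊣ I`. -/
abbrev adjL (d : ℕ) : L.{u} d ⊣ (isPrecat.{u} d).ι := reflectorAdjunction (isPrecat.{u} d).ι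

/-! ### The homotopy coherent categorification -/

/-- The set of `k`-simplices of the hom simplicial set from `i` to `j` of the simplicial category
`c^h Δ[m]`, which is Mathlib's simplicial thickening of the linear order `[m]`. -/
abbrev Thick (m : SimplexCategory) (i j : Fin (m.len + 1)) (k : SimplexCategory) : Type :=
  (EnrichedCategory.Hom (V := SSet.{0}) (SimplicialThickening.mk i) (SimplicialThickening.mk j)).obj
    (op k)

namespace Thick

variable {m m' : SimplexCategory} {i j l : Fin (m.len + 1)} {k k' : SimplexCategory}

/-- The simplicial restriction. -/
def restr (g : k' ⟶ k) (p : Thick m i j k) : Thick m i j k' :=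
  (EnrichedCategory.Hom (V := SSet.{0}) (SimplicialThickening.mk i)
    (SimplicialThickening.mk j)).map g.op p

/-- The identities of `c^h Δ[m]`. -/
def ident (m : SimplexCategory) (i : Fin (m.len + 1)) (k : SimplexCategory) : Thick m i i k :=
  (eId SSet.{0} (SimplicialThickening.mk i)).app (op k) PUnit.unit

/-- The composition of `c^h Δ[m]`. -/
def comp (p : Thick m i j k) (q : Thick m j l k) : Thick m i l k :=
  (eComp SSet.{0} (SimplicialThickening.mk i) (SimplicialThickening.mk j)
    (SimplicialThickening.mk l)).app (op k) (p, q)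

/-- The action of `c^h Δ[m'] ⟶ c^h Δ[m]` on homs. -/
def push (μ : m' ⟶ m) {i j : Fin (m'.len + 1)} (p : Thick m' i j k) :
    Thick m (μ.toOrderHom i) (μ.toOrderHom j) k :=
  ((SimplicialThickening.functor μ.toOrderHom).map (.mk i) (.mk j)).app (op k) p

lemma restr_id (p : Thick m i j k) : restr (𝟙 k) p = p := rfl

lemma restr_comp {k'' : SimplexCategory} (g : k'' ⟶ k') (h : k' ⟶ k) (p : Thick m i j k) :
    restr (g ≫ h) p = restr g (restr h p) := rfl

lemma restr_ident (g : k' ⟶ k) : restr g (ident m i k) = ident m i k' := rfl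

lemma restr_compos (g : k' ⟶ k) (p : Thick m i j k) (q : Thick m j l k) :
    restr g (comp p q) = comp (restr g p) (restr g q) := rfl

lemma restr_push (μ : m' ⟶ m) {i j : Fin (m'.len + 1)} (g : k' ⟶ k) (p : Thick m' i j k) :
    restr g (push μ p) = push μ (restr g p) := rfl

end Thick

section Categorification

variable {d : ℕ}

/-- The set of objects `W_{0,[0],[0]}` of a simplicial `Θ_d`-space. -/
abbrev Ob (W : SimplicialThetaSpace.{u} d) : Type u := W.obj (op (⟨0⟩, Cell.pt d))

/-- The degenerate element of `W_{0,x}` on an object. If `W_0` is discrete this is a bijection from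
the set of objects to `W_{0,x}`. -/
def degen (W : SimplicialThetaSpace.{u} d) (x : Cell d) (a : Ob W) : W.obj (op (⟨0⟩, x)) :=
  W.map (Prod.mkHom (𝟙 _) x.toPt).op a

/-- The `i`-th vertex in `W_{0,x}` of an element of `W_{m,x}`. -/
def vertex (W : SimplicialThetaSpace.{u} d) {x : Cell d} {m : SimplexCategory}
    (σ : W.obj (op (m, x))) (i : Fin (m.len + 1)) : W.obj (op (⟨0⟩, x)) :=
  W.map (Prod.mkHom (SimplexCategory.const ⟨0⟩ m i) (𝟙 x)).op σ

/-- The generating morphisms from `a` to `b`, in cellular level `x = (θ, [k])`, of the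
homotopy coherent categorification: an `m`-simplex `σ` of the simplicial set `W_{-,θ,k}`, together
with a `k`-simplex of a hom simplicial set of `c^h Δ[m]` between vertices that `σ` sends to `a` and
`b`. -/
structure Gen (W : SimplicialThetaSpace.{u} d) (x : Cell d) (a b : Ob W) : Type u where
  /-- the dimension -/
  dim : SimplexCategory
  /-- the simplex -/
  simplex : W.obj (op (dim, x))
  /-- the source vertex -/
  i : Fin (dim.len + 1)
  /-- the target vertex -/
  j : Fin (dim.len + 1)
  /-- the `k`-simplex of the hom simplicial set of `c^h Δ[m]` -/
  path : Thick dim i j x.2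
  src : vertex W simplex i = degen W x a
  tgt : vertex W simplex j = degen W x b

/-- Formal composites of generators. -/
inductive Word (W : SimplicialThetaSpace.{u} d) (x : Cell d) : Ob W → Ob W → Type u
  | gen {a b : Ob W} (g : Gen W x a b) : Word W x a b
  | ident (a : Ob W) : Word W x a a
  | comp {a b c : Ob W} (v : Word W x a b) (w : Word W x b c) : Word W x a c

/-- The relations in cellular level `x`: the axioms of a category, the functoriality of
`c^h Δ[m] ⟶ c^h W_{-,θ,k}` for every `m`-simplex of `W_{-,θ,k}`, and the compatibility of these
functors with the simplicial operators. -/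
inductive WordRel (W : SimplicialThetaSpace.{u} d) (x : Cell d) :
    ∀ {a b : Ob W}, Word W x a b → Word W x a b → Prop
  | id_comp {a b : Ob W} (v : Word W x a b) : WordRel W x (.comp (.ident a) v) v
  | comp_id {a b : Ob W} (v : Word W x a b) : WordRel W x (.comp v (.ident b)) v
  | assoc {a b c e : Ob W} (v : Word W x a b) (w : Word W x b c) (z : Word W x c e) :
      WordRel W x (.comp (.comp v w) z) (.comp v (.comp w z))
  | comp_left {a b c : Ob W} {v v' : Word W x a b} (w : Word W x b c) (h : WordRel W x v v') :
      WordRel W x (.comp v w) (.comp v' w)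
  | comp_right {a b c : Ob W} (v : Word W x a b) {w w' : Word W x b c} (h : WordRel W x w w') :
      WordRel W x (.comp v w) (.comp v w')
  | gen_ident {a : Ob W} {m : SimplexCategory} (σ : W.obj (op (m, x))) (i : Fin (m.len + 1))
      (h h' : vertex W σ i = degen W x a) :
      WordRel W x (.gen ⟨m, σ, i, i, Thick.ident m i x.2, h, h'⟩) (.ident a)
  | gen_comp {a b c : Ob W} {m : SimplexCategory} (σ : W.obj (op (m, x)))
      {i j l : Fin (m.len + 1)} (p : Thick m i j x.2) (q : Thick m j l x.2)
      (hi : vertex W σ i = degen W x a) (hj : vertex W σ j = degen W x b)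
      (hl : vertex W σ l = degen W x c) :
      WordRel W x (.gen ⟨m, σ, i, l, Thick.comp p q, hi, hl⟩)
        (.comp (.gen ⟨m, σ, i, j, p, hi, hj⟩) (.gen ⟨m, σ, j, l, q, hj, hl⟩))
  | gen_map {a b : Ob W} {m m' : SimplexCategory} (μ : m' ⟶ m) (σ : W.obj (op (m, x)))
      {i j : Fin (m'.len + 1)} (p : Thick m' i j x.2)
      (hi : vertex W (W.map (Prod.mkHom μ (𝟙 x)).op σ) i = degen W x a)
      (hj : vertex W (W.map (Prod.mkHom μ (𝟙 x)).op σ) j = degen W x b)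
      (hi' : vertex W σ (μ.toOrderHom i) = degen W x a)
      (hj' : vertex W σ (μ.toOrderHom j) = degen W x b) :
      WordRel W x (.gen ⟨m', W.map (Prod.mkHom μ (𝟙 x)).op σ, i, j, p, hi, hj⟩)
        (.gen ⟨m, σ, μ.toOrderHom i, μ.toOrderHom j, Thick.push μ p, hi', hj'⟩)

/-- The set of morphisms from `a` to `b` of the homotopy coherent categorification in cellular
level `x = (θ, [k])`. -/
def CohHom (W : SimplicialThetaSpace.{u} d) (x : Cell d) (a b : Ob W) : Type u :=
  Quot (WordRel W x (a := a) (b := b))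

end Categorification
section Categorification

variable {d : ℕ}

/-- The restriction `W_{m,x} → W_{m,y}` along a map `y ⟶ x`. -/
abbrev res (W : SimplicialThetaSpace.{u} d) {m : SimplexCategory} {x y : Cell d} (g : y ⟶ x)
    (σ : W.obj (op (m, x))) : W.obj (op (m, y)) :=
  W.map (Prod.mkHom (𝟙 m) g).op σ

lemma map_map (W : SimplicialThetaSpace.{u} d) {a b c : Shape d} (f : b ⟶ a) (g : c ⟶ b)
    (h : c ⟶ a) (e : g ≫ f = h) (s : W.obj (op a)) : W.map g.op (W.map f.op s) = W.map h.op s := by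
  subst e
  exact (W.map_comp_apply _ _ s).symm

lemma res_degen (W : SimplicialThetaSpace.{u} d) {x y : Cell d} (g : y ⟶ x) (a : Ob W) :
    res W g (degen W x a) = degen W y a :=
  map_map W _ _ _ (Prod.ext (Category.id_comp _) (Cell.toPt_unique _ _)) a

lemma res_vertex (W : SimplicialThetaSpace.{u} d) {x y : Cell d} (g : y ⟶ x) {m : SimplexCategory}
    (σ : W.obj (op (m, x))) (i : Fin (m.len + 1)) :
    vertex W (res W g σ) i = res W g (vertex W σ i) :=
  (map_map W _ _ (Prod.mkHom (SimplexCategory.const ⟨0⟩ m i) g)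
      (Prod.ext (Category.comp_id _) (Category.id_comp _)) σ).trans
    (map_map W _ _ _ (Prod.ext (Category.id_comp _) (Category.comp_id _)) σ).symm

lemma res_map (W : SimplicialThetaSpace.{u} d) {x y : Cell d} (g : y ⟶ x) {m m' : SimplexCategory}
    (μ : m' ⟶ m) (σ : W.obj (op (m, x))) :
    res W g (W.map (Prod.mkHom μ (𝟙 x)).op σ) = W.map (Prod.mkHom μ (𝟙 y)).op (res W g σ) :=
  (map_map W _ _ (Prod.mkHom μ g) (Prod.ext (Category.id_comp _) (Category.comp_id _)) σ).trans
    (map_map W _ _ _ (Prod.ext (Category.comp_id _) (Category.id_comp _)) σ).symm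

lemma res_id (W : SimplicialThetaSpace.{u} d) {x : Cell d} {m : SimplexCategory}
    (σ : W.obj (op (m, x))) : res W (𝟙 x) σ = σ :=
  W.map_id_apply (op (m, x)) σ

lemma res_comp (W : SimplicialThetaSpace.{u} d) {x y z : Cell d} (h : z ⟶ y) (g : y ⟶ x)
    {m : SimplexCategory} (σ : W.obj (op (m, x))) : res W (h ≫ g) σ = res W h (res W g σ) :=
  (map_map W (Prod.mkHom (𝟙 m) g) (Prod.mkHom (𝟙 m) h) _
    (Prod.ext (Category.id_comp _) rfl) σ).symm

lemma app_degen {W Z : SimplicialThetaSpace.{u} d} (f : W ⟶ Z) (x : Cell d) (a : Ob W) :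
    f.app _ (degen W x a) = degen Z x (f.app _ a) :=
  NatTrans.naturality_apply f _ a

lemma app_vertex {W Z : SimplicialThetaSpace.{u} d} (f : W ⟶ Z) {x : Cell d} {m : SimplexCategory}
    (σ : W.obj (op (m, x))) (i : Fin (m.len + 1)) :
    f.app _ (vertex W σ i) = vertex Z (f.app _ σ) i :=
  NatTrans.naturality_apply f _ σ

/-- The restriction of generators along a map of cells. -/
def Gen.restr {W : SimplicialThetaSpace.{u} d} {x y : Cell d} (g : y ⟶ x) {a b : Ob W}
    (s : Gen W x a b) : Gen W y a b where
  dim := s.dim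
  simplex := res W g s.simplex
  i := s.i
  j := s.j
  path := Thick.restr g.2 s.path
  src := (res_vertex W g _ _).trans ((congrArg _ s.src).trans (res_degen W g a))
  tgt := (res_vertex W g _ _).trans ((congrArg _ s.tgt).trans (res_degen W g b))

/-- The functoriality of generators. -/
def Gen.map {W Z : SimplicialThetaSpace.{u} d} (f : W ⟶ Z) {x : Cell d} {a b : Ob W}
    (s : Gen W x a b) : Gen Z x (f.app _ a) (f.app _ b) where
  dim := s.dim
  simplex := f.app _ s.simplex
  i := s.i
  j := s.j
  path := s.path
  src := (app_vertex f _ _).symm.trans ((congrArg _ s.src).trans (app_degen f x a))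
  tgt := (app_vertex f _ _).symm.trans ((congrArg _ s.tgt).trans (app_degen f x b))

lemma Gen.ext_simplex {W : SimplicialThetaSpace.{u} d} {x : Cell d} {a b : Ob W}
    {m : SimplexCategory} {σ τ : W.obj (op (m, x))} (h : σ = τ) (i j : Fin (m.len + 1))
    (p : Thick m i j x.2) (h₁ : vertex W σ i = degen W x a) (h₂ : vertex W σ j = degen W x b)
    (h₃ : vertex W τ i = degen W x a) (h₄ : vertex W τ j = degen W x b) :
    (⟨m, σ, i, j, p, h₁, h₂⟩ : Gen W x a b) = ⟨m, τ, i, j, p, h₃, h₄⟩ := by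
  subst h; rfl

/-- The restriction of words along a map of cells. -/
def Word.restr {W : SimplicialThetaSpace.{u} d} {x y : Cell d} (g : y ⟶ x) :
    ∀ {a b : Ob W}, Word W x a b → Word W y a b
  | _, _, .gen s => .gen (s.restr g)
  | _, _, .ident a => .ident a
  | _, _, .comp v w => .comp (v.restr g) (w.restr g)

/-- The functoriality of words. -/
def Word.map {W Z : SimplicialThetaSpace.{u} d} (f : W ⟶ Z) {x : Cell d} :
    ∀ {a b : Ob W}, Word W x a b → Word Z x (f.app _ a) (f.app _ b)
  | _, _, .gen s => .gen (s.map f)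
  | _, _, .ident _ => .ident _
  | _, _, .comp v w => .comp (v.map f) (w.map f)

lemma WordRel.restr {W : SimplicialThetaSpace.{u} d} {x y : Cell d} (g : y ⟶ x) {a b : Ob W}
    {v w : Word W x a b} (h : WordRel W x v w) : WordRel W y (v.restr g) (w.restr g) := by
  induction h with
  | id_comp v => exact .id_comp _
  | comp_id v => exact .comp_id _
  | assoc v w z => exact .assoc _ _ _
  | comp_left w _ ih => exact .comp_left _ ih
  | comp_right v _ ih => exact .comp_right _ ih
  | gen_ident σ i h h' => exact .gen_ident _ _ _ _
  | gen_comp σ p q hi hj hl =>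
    exact .gen_comp (res W g σ) (Thick.restr g.2 p) (Thick.restr g.2 q) _
      (Gen.restr g ⟨_, σ, _, _, p, hi, hj⟩).tgt _
  | @gen_map a b m m' μ σ i j p hi hj hi' hj' =>
    have e := res_map W g μ σ
    have h₁ := (Gen.restr g ⟨m', _, i, j, p, hi, hj⟩).src
    have h₂ := (Gen.restr g ⟨m', _, i, j, p, hi, hj⟩).tgt
    have h₃ := (Gen.restr g ⟨m, _, _, _, Thick.push μ p, hi', hj'⟩).src
    have h₄ := (Gen.restr g ⟨m, _, _, _, Thick.push μ p, hi', hj'⟩).tgt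
    have key := WordRel.gen_map (W := W) μ (res W g σ) (Thick.restr g.2 p)
      ((congrArg (fun τ => vertex W τ i) e).symm.trans h₁)
      ((congrArg (fun τ => vertex W τ j) e).symm.trans h₂) h₃ h₄
    have e' := Gen.ext_simplex e i j (Thick.restr g.2 p) h₁ h₂
      ((congrArg (fun τ => vertex W τ i) e).symm.trans h₁)
      ((congrArg (fun τ => vertex W τ j) e).symm.trans h₂)
    rw [← e'] at key
    exact key

lemma WordRel.map {W Z : SimplicialThetaSpace.{u} d} (f : W ⟶ Z) {x : Cell d} {a b : Ob W}
    {v w : Word W x a b} (h : WordRel W x v w) : WordRel Z x (v.map f) (w.map f) := by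
  induction h with
  | id_comp v => exact .id_comp _
  | comp_id v => exact .comp_id _
  | assoc v w z => exact .assoc _ _ _
  | comp_left w _ ih => exact .comp_left _ ih
  | comp_right v _ ih => exact .comp_right _ ih
  | gen_ident σ i h h' => exact .gen_ident _ _ _ _
  | gen_comp σ p q hi hj hl =>
    exact .gen_comp (f.app _ σ) p q _ (Gen.map f ⟨_, σ, _, _, p, hi, hj⟩).tgt _
  | @gen_map a b m m' μ σ i j p hi hj hi' hj' =>
    have e : f.app _ (W.map (Prod.mkHom μ (𝟙 x)).op σ) = Z.map (Prod.mkHom μ (𝟙 x)).op (f.app _ σ) :=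
      NatTrans.naturality_apply f _ σ
    have h₁ := (Gen.map f ⟨m', _, i, j, p, hi, hj⟩).src
    have h₂ := (Gen.map f ⟨m', _, i, j, p, hi, hj⟩).tgt
    have h₃ := (Gen.map f ⟨m, _, _, _, Thick.push μ p, hi', hj'⟩).src
    have h₄ := (Gen.map f ⟨m, _, _, _, Thick.push μ p, hi', hj'⟩).tgt
    have key := WordRel.gen_map (W := Z) μ (f.app _ σ) p
      ((congrArg (fun τ => vertex Z τ i) e).symm.trans h₁)
      ((congrArg (fun τ => vertex Z τ j) e).symm.trans h₂) h₃ h₄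
    have e' := Gen.ext_simplex e i j p h₁ h₂
      ((congrArg (fun τ => vertex Z τ i) e).symm.trans h₁)
      ((congrArg (fun τ => vertex Z τ j) e).symm.trans h₂)
    rw [← e'] at key
    exact key

lemma Word.restr_id {W : SimplicialThetaSpace.{u} d} {x : Cell d} {a b : Ob W} (v : Word W x a b) :
    v.restr (𝟙 x) = v := by
  induction v with
  | gen s =>
    exact congrArg Word.gen (Gen.ext_simplex (res_id W s.simplex) s.i s.j s.path _ _ s.src s.tgt)
  | ident a => rfl
  | comp v w h₁ h₂ => exact congrArg₂ Word.comp h₁ h₂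

lemma Word.restr_comp {W : SimplicialThetaSpace.{u} d} {x y z : Cell d} (h : z ⟶ y) (g : y ⟶ x)
    {a b : Ob W} (v : Word W x a b) : v.restr (h ≫ g) = (v.restr g).restr h := by
  induction v with
  | gen s =>
    exact congrArg Word.gen (Gen.ext_simplex (res_comp W h g s.simplex) s.i s.j
      (Thick.restr (h ≫ g).2 s.path) _ _ _ _)
  | ident a => rfl
  | comp v w h₁ h₂ => exact congrArg₂ Word.comp h₁ h₂

lemma Word.map_restr {W Z : SimplicialThetaSpace.{u} d} (f : W ⟶ Z) {x y : Cell d} (g : y ⟶ x)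
    {a b : Ob W} (v : Word W x a b) : (v.restr g).map f = (v.map f).restr g := by
  induction v with
  | gen s =>
    exact congrArg Word.gen (Gen.ext_simplex (NatTrans.naturality_apply f _ s.simplex) s.i s.j
      (Thick.restr g.2 s.path) _ _ _ _)
  | ident a => rfl
  | comp v w h₁ h₂ => exact congrArg₂ Word.comp h₁ h₂

lemma Word.map_id {W : SimplicialThetaSpace.{u} d} {x : Cell d} {a b : Ob W} (v : Word W x a b) :
    v.map (𝟙 W) = v := by
  induction v with
  | gen s => rfl
  | ident a => rfl
  | comp v w h₁ h₂ => exact congrArg₂ Word.comp h₁ h₂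

lemma Word.map_comp {W Z T : SimplicialThetaSpace.{u} d} (f : W ⟶ Z) (f' : Z ⟶ T) {x : Cell d}
    {a b : Ob W} (v : Word W x a b) : v.map (f ≫ f') = (v.map f).map f' := by
  induction v with
  | gen s => rfl
  | ident a => rfl
  | comp v w h₁ h₂ => exact congrArg₂ Word.comp h₁ h₂

namespace CohHom

variable {W Z : SimplicialThetaSpace.{u} d} {x y : Cell d} {a b c : Ob W}

/-- Identities. -/
def ident (W : SimplicialThetaSpace.{u} d) (x : Cell d) (a : Ob W) : CohHom W x a a :=
  Quot.mk _ (.ident a)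

/-- Composition. -/
def comp (v : CohHom W x a b) (w : CohHom W x b c) : CohHom W x a c :=
  Quot.map₂ Word.comp (fun _ _ _ h => .comp_right _ h) (fun _ _ _ h => .comp_left _ h) v w

/-- Restriction along a map of cells. -/
def restr (g : y ⟶ x) (v : CohHom W x a b) : CohHom W y a b :=
  Quot.map (Word.restr g) (fun _ _ h => h.restr g) v

/-- Functoriality. -/
def map (f : W ⟶ Z) (v : CohHom W x a b) : CohHom Z x (f.app _ a) (f.app _ b) :=
  Quot.map (Word.map f) (fun _ _ h => h.map f) v

end CohHom

/-- The objects of the homotopy coherent categorification `ℭ W` of a precategory `W`, i.e. the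
elements of the set `W_0`. -/
def Coh (W : Pcat.{u} d) : Type u := Ob W.obj

/-- The hom `Θ_d`-spaces of `ℭ W`. -/
def cohHom (W : SimplicialThetaSpace.{u} d) (a b : Ob W) : ThetaSpace.{u} d where
  obj x := CohHom W x.unop a b
  map g := ↾(CohHom.restr g.unop)
  map_id x := by
    ext v
    induction v using Quot.ind with | mk v => ?_
    exact congrArg (Quot.mk _) (Word.restr_id v)
  map_comp g h := by
    ext v
    induction v using Quot.ind with | mk v => ?_
    exact congrArg (Quot.mk _) (Word.restr_comp h.unop g.unop v)

open MonoidalCategory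

/-- The homotopy coherent categorification `ℭ W` as a category enriched in `Θ_d`-spaces. Its
category in level `(θ, [k])` is the level `k` of the simplicial category `c^h (W_{-,θ,k})`: the
left adjoint `c^h` sends a simplicial set to the colimit of the simplicial categories `c^h Δ[m]`
over its simplices, and this colimit, computed levelwise, is the category that is presented by the
above generators and relations. -/
instance (W : Pcat.{u} d) : EnrichedCategory (ThetaSpace.{u} d) (Coh W) where
  Hom a b := cohHom W.obj a b
  id a := { app := fun x => ↾(fun _ => CohHom.ident W.obj x.unop a) }
  comp a b c :=
    { app := fun x => ↾(fun p => CohHom.comp p.1 p.2)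
      naturality := fun x y g => by
        ext ⟨v, w⟩
        induction v using Quot.ind with | mk v => ?_
        induction w using Quot.ind with | mk w => ?_
        rfl }
  id_comp a b := by
    ext x v
    induction v using Quot.ind with | mk v => ?_
    exact Quot.sound (.id_comp v)
  comp_id a b := by
    ext x v
    induction v using Quot.ind with | mk v => ?_
    exact Quot.sound (.comp_id v)
  assoc a b c e := by
    ext x ⟨v, w, z⟩
    induction v using Quot.ind with | mk v => ?_
    induction w using Quot.ind with | mk w => ?_
    induction z using Quot.ind with | mk z => ?_
    exact Quot.sound (.assoc v w z)

/-- The enriched functor `ℭ f : ℭ W ⟶ ℭ Z` that is induced by a map `f : W ⟶ Z`. -/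
def cohMap {W Z : Pcat.{u} d} (f : W ⟶ Z) : EnrichedFunctor (ThetaSpace.{u} d) (Coh W) (Coh Z) where
  obj a := f.hom.app _ a
  map a b :=
    { app := fun x => ↾(CohHom.map f.hom)
      naturality := fun x y g => by
        ext v
        induction v using Quot.ind with | mk v => ?_
        exact congrArg (Quot.mk _) (Word.map_restr f.hom g.unop v) }
  map_id a := by
    ext x v
    rfl
  map_comp a b c := by
    ext x ⟨v, w⟩
    induction v using Quot.ind with | mk v => ?_
    induction w using Quot.ind with | mk w => ?_
    rfl

lemma cohMap_id (W : Pcat.{u} d) : cohMap (𝟙 W) = EnrichedFunctor.id _ _ := by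
  refine EnrichedFunctor.ext _ (fun _ => rfl) fun a b => ?_
  ext x v
  induction v using Quot.ind with | mk v => ?_
  exact congrArg (Quot.mk _) (Word.map_id v)

lemma cohMap_comp {W Z T : Pcat.{u} d} (f : W ⟶ Z) (g : Z ⟶ T) :
    cohMap (f ≫ g) = (cohMap f).comp _ (cohMap g) := by
  refine EnrichedFunctor.ext _ (fun _ => rfl) fun a b => ?_
  ext x v
  induction v using Quot.ind with | mk v => ?_
  exact congrArg (Quot.mk _) (Word.map_comp f.hom g.hom v)

end Categorification
/-! ### Presheaves enriched in `Θ_d`-spaces -/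

section Presheaves

variable {d : ℕ}

/-- The identity of `a` in level `x` of an enriched category. -/
def eid {C : Type u} [EnrichedCategory (ThetaSpace.{u} d) C] (a : C) (x : (Cell d)ᵒᵖ) :
    (a ⟶[ThetaSpace.{u} d] a).obj x :=
  (eId (ThetaSpace.{u} d) a).app x PUnit.unit

/-- The composition in level `x` of an enriched category. -/
def ecomp {C : Type u} [EnrichedCategory (ThetaSpace.{u} d) C] {a b c : C} {x : (Cell d)ᵒᵖ}
    (f : (a ⟶[ThetaSpace.{u} d] b).obj x) (g : (b ⟶[ThetaSpace.{u} d] c).obj x) :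
    (a ⟶[ThetaSpace.{u} d] c).obj x :=
  (eComp (ThetaSpace.{u} d) a b c).app x (f, g)

/-- The action in level `x` of an enriched functor on morphisms. -/
def emap {C D : Type u} [EnrichedCategory (ThetaSpace.{u} d) C]
    [EnrichedCategory (ThetaSpace.{u} d) D] (F : EnrichedFunctor (ThetaSpace.{u} d) C D) {a b : C}
    {x : (Cell d)ᵒᵖ} (f : (a ⟶[ThetaSpace.{u} d] b).obj x) :
    (F.obj a ⟶[ThetaSpace.{u} d] F.obj b).obj x :=
  (F.map a b).app x f

/-- An enriched functor `F : Cᵒᵖ ⟶ Θ_d`-spaces, given by its values and by the actions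
`Hom_C(a, b) × F b ⟶ F a` which correspond to the maps `Hom_C(a, b) ⟶ Hom(F b, F a)` under the
cartesian closed structure. The action is written in each level `x` of `Θ_d × Δ`.

Mathlib's category of enriched functors is not used here, because its morphisms are the natural
transformations between the underlying ordinary functors, which is weaker than enriched naturality
for categories that are enriched in presheaves. -/
structure EPresheaf (d : ℕ) (C : Type u) [EnrichedCategory (ThetaSpace.{u} d) C] :
    Type (u + 1) where
  /-- the values -/
  obj : C → ThetaSpace.{u} d
  /-- the action -/
  act : ∀ {a b : C} {x : (Cell d)ᵒᵖ}, (a ⟶[ThetaSpace.{u} d] b).obj x → (obj b).obj x →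
    (obj a).obj x
  map_act : ∀ {a b : C} {x y : (Cell d)ᵒᵖ} (g : x ⟶ y) (f : (a ⟶[ThetaSpace.{u} d] b).obj x)
    (s : (obj b).obj x),
    (obj a).map g (act f s) = act ((a ⟶[ThetaSpace.{u} d] b).map g f) ((obj b).map g s)
  id_act : ∀ {a : C} {x : (Cell d)ᵒᵖ} (s : (obj a).obj x),
    act (eid a x) s = s
  comp_act : ∀ {a b c : C} {x : (Cell d)ᵒᵖ} (f : (a ⟶[ThetaSpace.{u} d] b).obj x)
    (g : (b ⟶[ThetaSpace.{u} d] c).obj x) (s : (obj c).obj x),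
    act (ecomp f g) s = act f (act g s)

namespace EPresheaf

variable {C D E : Type u} [EnrichedCategory (ThetaSpace.{u} d) C]
  [EnrichedCategory (ThetaSpace.{u} d) D] [EnrichedCategory (ThetaSpace.{u} d) E]

/-- Enriched natural transformations: families of maps of `Θ_d`-spaces that commute with the
actions of the hom `Θ_d`-spaces. -/
@[ext]
structure Hom (F G : EPresheaf d C) : Type u where
  /-- the components -/
  app : ∀ a : C, F.obj a ⟶ G.obj a
  app_act : ∀ {a b : C} {x : (Cell d)ᵒᵖ} (f : (a ⟶[ThetaSpace.{u} d] b).obj x)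
    (s : (F.obj b).obj x), (app a).app x (F.act f s) = G.act f ((app b).app x s)

/-- The category `[Cᵒᵖ, Θ_d-spaces]` of enriched functors and enriched natural transformations. -/
instance : Category.{u} (EPresheaf d C) where
  Hom := Hom
  id F := { app := fun a => 𝟙 (F.obj a), app_act := fun _ _ => rfl }
  comp α β :=
    { app := fun a => α.app a ≫ β.app a
      app_act := fun f s => (congrArg _ (α.app_act f s)).trans (β.app_act f _) }

@[ext]
lemma hom_ext {F G : EPresheaf d C} {α β : F ⟶ G}
    (h : ∀ a x (s : (F.obj a).obj x), (α.app a).app x s = (β.app a).app x s) : α = β := by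
  apply Hom.ext
  funext a
  ext x s
  exact h a x s

lemma emap_eid (F : EnrichedFunctor (ThetaSpace.{u} d) C D) (a : C) (x : (Cell d)ᵒᵖ) :
    emap F (eid a x) = eid (F.obj a) x :=
  congrArg (fun α => α.app x PUnit.unit) (F.map_id a)

lemma emap_ecomp (F : EnrichedFunctor (ThetaSpace.{u} d) C D) {a b c : C} {x : (Cell d)ᵒᵖ}
    (f : (a ⟶[ThetaSpace.{u} d] b).obj x) (g : (b ⟶[ThetaSpace.{u} d] c).obj x) :
    emap F (ecomp f g) = ecomp (emap F f) (emap F g) :=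
  congrArg (fun α : _ ⟶ (F.obj a ⟶[ThetaSpace.{u} d] F.obj c) => α.app x
    ((f, g) : (a ⟶[ThetaSpace.{u} d] b).obj x × (b ⟶[ThetaSpace.{u} d] c).obj x))
    (F.map_comp a b c)

lemma map_emap (F : EnrichedFunctor (ThetaSpace.{u} d) C D) {a b : C} {x y : (Cell d)ᵒᵖ}
    (h : x ⟶ y) (f : (a ⟶[ThetaSpace.{u} d] b).obj x) :
    (F.obj a ⟶[ThetaSpace.{u} d] F.obj b).map h (emap F f) =
      emap F ((a ⟶[ThetaSpace.{u} d] b).map h f) :=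
  (NatTrans.naturality_apply (F.map a b) h f).symm

lemma map_eid (a : C) {x y : (Cell d)ᵒᵖ} (h : x ⟶ y) :
    (a ⟶[ThetaSpace.{u} d] a).map h (eid a x) = eid a y :=
  (NatTrans.naturality_apply (eId (ThetaSpace.{u} d) a) h PUnit.unit).symm

lemma map_ecomp {a b c : C} {x y : (Cell d)ᵒᵖ} (h : x ⟶ y)
    (f : (a ⟶[ThetaSpace.{u} d] b).obj x) (g : (b ⟶[ThetaSpace.{u} d] c).obj x) :
    (a ⟶[ThetaSpace.{u} d] c).map h (ecomp f g) =
      ecomp ((a ⟶[ThetaSpace.{u} d] b).map h f) ((b ⟶[ThetaSpace.{u} d] c).map h g) :=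
  (NatTrans.naturality_apply (eComp (ThetaSpace.{u} d) a b c) h
    ((f, g) : (a ⟶[ThetaSpace.{u} d] b).obj x × (b ⟶[ThetaSpace.{u} d] c).obj x)).symm

lemma eid_ecomp {a b : C} {x : (Cell d)ᵒᵖ} (f : (a ⟶[ThetaSpace.{u} d] b).obj x) :
    ecomp (eid a x) f = f :=
  congrArg (fun α => α.app x f) (EnrichedCategory.id_comp (V := ThetaSpace.{u} d) a b)

lemma ecomp_eid {a b : C} {x : (Cell d)ᵒᵖ} (f : (a ⟶[ThetaSpace.{u} d] b).obj x) :
    ecomp f (eid b x) = f :=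
  congrArg (fun α => α.app x f) (EnrichedCategory.comp_id (V := ThetaSpace.{u} d) a b)

lemma ecomp_assoc {a b c e : C} {x : (Cell d)ᵒᵖ} (f : (a ⟶[ThetaSpace.{u} d] b).obj x)
    (g : (b ⟶[ThetaSpace.{u} d] c).obj x) (h : (c ⟶[ThetaSpace.{u} d] e).obj x) :
    ecomp (ecomp f g) h = ecomp f (ecomp g h) :=
  congrArg (fun α => α.app x (f, (g, h)))
    (EnrichedCategory.assoc (V := ThetaSpace.{u} d) a b c e)

/-- The representable enriched functor `Hom_C(-, t)`. -/
def repr (t : C) : EPresheaf d C where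
  obj a := a ⟶[ThetaSpace.{u} d] t
  act f s := ecomp f s
  map_act g f s := map_ecomp g f s
  id_act s := eid_ecomp s
  comp_act f g s := ecomp_assoc f g s

/-- The functor `F^* : [Dᵒᵖ, Θ_d-spaces] ⥤ [Cᵒᵖ, Θ_d-spaces]` given by precomposition with the
enriched functor `F : C ⟶ D`. -/
def pull (F : EnrichedFunctor (ThetaSpace.{u} d) C D) : EPresheaf d D ⥤ EPresheaf d C where
  obj G :=
    { obj := fun a => G.obj (F.obj a)
      act := fun f s => G.act (emap F f) s
      map_act := fun g f s => (G.map_act g _ s).trans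
        (congrArg (fun z => G.act z _) (map_emap F g f))
      id_act := fun {a x} s => (congrArg (fun z => G.act z s) (emap_eid F a x)).trans (G.id_act s)
      comp_act := fun f g s => (congrArg (fun z => G.act z s) (emap_ecomp F f g)).trans
        (G.comp_act _ _ s) }
  map α := { app := fun a => α.app (F.obj a), app_act := fun f s => α.app_act _ s }

/-! ### Enriched left Kan extensions -/

section Lan

variable (F : EnrichedFunctor (ThetaSpace.{u} d) C D) (H : EPresheaf d C)

/-- The relation that defines the coend `∫^c Hom_D(e, F c) × H c` in level `x`. -/
inductive LanRel (e : D) (x : (Cell d)ᵒᵖ) :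
    (Σ c : C, (e ⟶[ThetaSpace.{u} d] F.obj c).obj x × (H.obj c).obj x) →
    (Σ c : C, (e ⟶[ThetaSpace.{u} d] F.obj c).obj x × (H.obj c).obj x) → Prop
  | mk {c c' : C} (φ : (e ⟶[ThetaSpace.{u} d] F.obj c).obj x)
      (g : (c ⟶[ThetaSpace.{u} d] c').obj x) (s : (H.obj c').obj x) :
      LanRel e x ⟨c, φ, H.act g s⟩
        ⟨c', ecomp φ (emap F g), s⟩

/-- The enriched left Kan extension of `H` along `F`, given by the coend formula
`e ↦ ∫^c Hom_D(e, F c) × H c`. -/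
def lanObj : EPresheaf d D where
  obj e :=
    { obj := fun x => Quot (LanRel F H e x)
      map := fun {x y} g => ↾(Quot.map
        (fun p => ⟨p.1, (e ⟶[ThetaSpace.{u} d] F.obj p.1).map g p.2.1, (H.obj p.1).map g p.2.2⟩) (by
          rintro _ _ ⟨φ, h, s⟩
          dsimp only
          rw [H.map_act, map_ecomp, map_emap]
          exact .mk _ _ _))
      map_id := fun x => by
        ext s
        induction s using Quot.ind
        simp [Quot.map]
      map_comp := fun f g => by
        ext s
        induction s using Quot.ind
        simp [Quot.map] }
  act {e e' x} f s := Quot.map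
    (fun p => ⟨p.1, ecomp f p.2.1, p.2.2⟩) (by
      rintro _ _ ⟨φ, h, s⟩
      dsimp only
      rw [← ecomp_assoc]
      exact .mk _ _ _) s
  map_act g f s := by
    induction s using Quot.ind with | mk s => ?_
    refine congrArg (Quot.mk _) ?_
    dsimp only
    rw [map_ecomp]
  id_act s := by
    induction s using Quot.ind with | mk s => ?_
    refine congrArg (Quot.mk _) ?_
    dsimp only
    rw [eid_ecomp]
  comp_act f g s := by
    induction s using Quot.ind with | mk s => ?_
    refine congrArg (Quot.mk _) ?_
    dsimp only
    rw [ecomp_assoc]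

/-- The universal property of the enriched left Kan extension. -/
def lanEquiv (G : EPresheaf d D) : (lanObj F H ⟶ G) ≃ (H ⟶ (pull F).obj G) where
  toFun α :=
    { app := fun c =>
        { app := fun x => ↾(fun s => (α.app (F.obj c)).app x
            (Quot.mk _ ⟨c, eid (F.obj c) x, s⟩))
          naturality := fun x y g => by
            ext s
            refine Eq.trans ?_ (NatTrans.naturality_apply (α.app (F.obj c)) g _)
            refine congrArg ((α.app (F.obj c)).app y) (congrArg (Quot.mk _) ?_)
            dsimp only
            rw [map_eid]
            rfl }
      app_act := fun {a b x} f s => by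
        refine Eq.trans ?_ (α.app_act (emap F f) _)
        refine congrArg ((α.app (F.obj a)).app x) ?_
        refine (Quot.sound (LanRel.mk (F := F) (H := H) _ f s)).trans ?_
        refine congrArg (Quot.mk _) ?_
        dsimp only
        rw [eid_ecomp, ecomp_eid] }
  invFun β :=
    { app := fun e =>
        { app := fun x => ↾(Quot.lift (fun p => G.act p.2.1 ((β.app p.1).app x p.2.2)) (by
            rintro _ _ ⟨φ, h, s⟩
            dsimp only
            exact (congrArg (G.act φ) (β.app_act h s)).trans (G.comp_act φ _ _).symm))
          naturality := fun x y g => by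
            ext s
            induction s using Quot.ind with | mk s => ?_
            refine Eq.trans ?_ (G.map_act g _ _).symm
            exact congrArg (G.act _) (NatTrans.naturality_apply (β.app s.1) g s.2.2) }
      app_act := fun f s => by
        induction s using Quot.ind with | mk s => ?_
        exact G.comp_act _ _ _ }
  left_inv α := by
    ext e x s
    induction s using Quot.ind with | mk s => ?_
    refine (α.app_act s.2.1 _).symm.trans ?_
    refine congrArg ((α.app e).app x) (congrArg (Quot.mk _) ?_)
    dsimp only
    rw [ecomp_eid]
  right_inv β := by
    ext c x s
    exact G.id_act _

/-- The functor `F_! : [Cᵒᵖ, Θ_d-spaces] ⥤ [Dᵒᵖ, Θ_d-spaces]` given by enriched left Kan extension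
along `F`. -/
def lan : EPresheaf d C ⥤ EPresheaf d D :=
  Adjunction.leftAdjointOfEquiv (G := pull F) (lanEquiv F) (fun _ _ _ _ _ => rfl)

/-- The adjunction `F_! ⊣ F^*`. -/
def lanAdj : lan F ⊣ pull F :=
  Adjunction.adjunctionOfEquivLeft (G := pull F) (lanEquiv F) (fun _ _ _ _ _ => rfl)

end Lan

/-! ### Colimits of enriched presheaves -/

section Colimits

universe w

variable {J : Type u} [Category.{w} J] (K : J ⥤ EPresheaf d C)

/-- The relation that defines the colimit of `K` at the object `a` in level `x`. -/
inductive ColimRel (a : C) (x : (Cell d)ᵒᵖ) :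
    (Σ j : J, ((K.obj j).obj a).obj x) → (Σ j : J, ((K.obj j).obj a).obj x) → Prop
  | mk {j j' : J} (g : j ⟶ j') (s : ((K.obj j).obj a).obj x) :
      ColimRel a x ⟨j, s⟩ ⟨j', ((K.map g).app a).app x s⟩

/-- The colimit of `K`, computed pointwise. -/
def colim : EPresheaf d C where
  obj a :=
    { obj := fun x => Quot (ColimRel K a x)
      map := fun {x y} g => ↾(Quot.map (fun p => ⟨p.1, ((K.obj p.1).obj a).map g p.2⟩) (by
          rintro _ _ ⟨h, s⟩
          dsimp only
          rw [← NatTrans.naturality_apply ((K.map h).app a) g s]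
          exact .mk _ _))
      map_id := fun x => by
        ext s
        induction s using Quot.ind
        simp [Quot.map]
      map_comp := fun f g => by
        ext s
        induction s using Quot.ind
        simp [Quot.map] }
  act {a b x} f s := Quot.map (fun p => ⟨p.1, (K.obj p.1).act f p.2⟩) (by
      rintro _ _ ⟨h, s⟩
      dsimp only
      rw [← (K.map h).app_act f s]
      exact .mk _ _) s
  map_act g f s := by
    induction s using Quot.ind with | mk s => ?_
    refine congrArg (Quot.mk _) ?_
    dsimp only
    rw [(K.obj s.1).map_act]
  id_act s := by
    induction s using Quot.ind with | mk s => ?_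
    refine congrArg (Quot.mk _) ?_
    dsimp only
    rw [(K.obj s.1).id_act]
  comp_act f g s := by
    induction s using Quot.ind with | mk s => ?_
    refine congrArg (Quot.mk _) ?_
    dsimp only
    rw [(K.obj s.1).comp_act]

/-- The colimit cocone. -/
def colimCocone : Cocone K where
  pt := colim K
  ι :=
    { app := fun j =>
        { app := fun a => { app := fun x => ↾(fun s => Quot.mk _ ⟨j, s⟩) }
          app_act := fun _ _ => rfl }
      naturality := fun j j' g => by
        ext a x s
        exact (Quot.sound (ColimRel.mk g s)).symm }

/-- The colimit cocone is a colimit. -/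
def isColimit : IsColimit (colimCocone K) where
  desc c :=
    { app := fun a =>
        { app := fun x => ↾(Quot.lift (fun p => ((c.ι.app p.1).app a).app x p.2) (by
            rintro _ _ ⟨g, s⟩
            exact (congrArg (fun α : _ ⟶ c.pt => (α.app a).app x s) (c.w g)).symm))
          naturality := fun x y g => by
            ext s
            induction s using Quot.ind with | mk s => ?_
            exact NatTrans.naturality_apply ((c.ι.app s.1).app a) g s.2 }
      app_act := fun f s => by
        induction s using Quot.ind with | mk s => ?_
        exact (c.ι.app s.1).app_act f s.2 }
  fac c j := rfl
  uniq c m h := by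
    ext a x s
    induction s using Quot.ind with | mk s => ?_
    exact congrArg (fun α : _ ⟶ c.pt => (α.app a).app x s.2) (h s.1)

instance : HasColimitsOfSize.{w, u} (EPresheaf d C) :=
  ⟨fun _ => ⟨fun K => ⟨⟨⟨colimCocone K, isColimit K⟩⟩⟩⟩⟩

end Colimits

/-! ### Comparison of restricted representables -/

/-- Given enriched functors `H : E ⟶ C`, `F : C ⟶ D` and `K : E ⟶ D` with `F H = K`, and an object
`t` of `C` with `F t = t'`, the enriched natural transformation `Hom_C(H -, t) ⟶ Hom_D(K -, t')`
that is induced by the action of `F` on hom `Θ_d`-spaces. -/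
def reprMap (H : EnrichedFunctor (ThetaSpace.{u} d) E C) (F : EnrichedFunctor (ThetaSpace.{u} d) C D)
    (K : EnrichedFunctor (ThetaSpace.{u} d) E D) (h : H.comp _ F = K) {t : C} {t' : D}
    (ht : F.obj t = t') : (pull H).obj (repr t) ⟶ (pull K).obj (repr t') where
  app a := F.map (H.obj a) t ≫
    eqToHom (by subst h ht; rfl : (F.obj (H.obj a) ⟶[ThetaSpace.{u} d] F.obj t) =
      (K.obj a ⟶[ThetaSpace.{u} d] t'))
  app_act {a b x} f s := by
    subst h ht
    exact emap_ecomp F _ _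

lemma reprMap_id (H : EnrichedFunctor (ThetaSpace.{u} d) E C)
    (F : EnrichedFunctor (ThetaSpace.{u} d) C C) (hF : F = EnrichedFunctor.id _ _)
    (h : H.comp _ F = H) {t : C} (ht : F.obj t = t) : reprMap H F H h ht = 𝟙 _ := by
  subst hF
  rfl

lemma reprMap_comp {D' : Type u} [EnrichedCategory (ThetaSpace.{u} d) D']
    (H : EnrichedFunctor (ThetaSpace.{u} d) E C) (F : EnrichedFunctor (ThetaSpace.{u} d) C D)
    (K : EnrichedFunctor (ThetaSpace.{u} d) E D) (h : H.comp _ F = K) {t : C} {t' : D}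
    (ht : F.obj t = t') (G : EnrichedFunctor (ThetaSpace.{u} d) D D')
    (M : EnrichedFunctor (ThetaSpace.{u} d) E D') (h' : K.comp _ G = M) {t'' : D'}
    (ht' : G.obj t' = t'') (FG : EnrichedFunctor (ThetaSpace.{u} d) C D') (hFG : FG = F.comp _ G)
    (h'' : H.comp _ FG = M) (ht'' : FG.obj t = t'') :
    reprMap H FG M h'' ht'' = reprMap H F K h ht ≫ reprMap K G M h' ht' := by
  subst hFG h ht h' ht'
  rfl

end EPresheaf

end Presheaves
/-! ### The straightening functor -/

section Straightening

variable {d : ℕ}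

/-- The map `[m' + 1] ⟶ [m + 1]` that extends `μ : [m'] ⟶ [m]` and sends the last element to the
last element. -/
def coneMap {m' m : SimplexCategory} (μ : m' ⟶ m) :
    SimplexCategory.mk (m'.len + 1) ⟶ SimplexCategory.mk (m.len + 1) :=
  SimplexCategory.Hom.mk
    { toFun := fun i => Fin.lastCases (motive := fun _ => Fin (m.len + 1 + 1)) (Fin.last _)
        (fun i => (μ.toOrderHom i).castSucc) i
      monotone' := fun i j h => by
        induction j using Fin.lastCases with
        | last => simpa using Fin.le_last _
        | cast j =>
          induction i using Fin.lastCases with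
          | last => exact absurd h (not_le.2 (Fin.castSucc_lt_last j))
          | cast i => simpa using μ.toOrderHom.monotone (Fin.castSucc_le_castSucc_iff.1 h) }

lemma coneMap_castSucc {m' m : SimplexCategory} (μ : m' ⟶ m) (i : Fin (m'.len + 1)) :
    (coneMap μ).toOrderHom i.castSucc = (μ.toOrderHom i).castSucc :=
  Fin.lastCases_castSucc (motive := fun _ => Fin (m.len + 1 + 1)) i

lemma coneMap_last {m' m : SimplexCategory} (μ : m' ⟶ m) :
    (coneMap μ).toOrderHom (Fin.last _) = Fin.last _ :=
  Fin.lastCases_last (motive := fun _ => Fin (m.len + 1 + 1))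

/-- The functor `([m], x) ↦ ([m + 1], x)`. -/
def cone (d : ℕ) : Shape d ⥤ Shape d where
  obj c := (⟨c.1.len + 1⟩, c.2)
  map f := Prod.mkHom (coneMap f.1) f.2
  map_id c := by
    refine Prod.ext (SimplexCategory.Hom.ext _ _ (OrderHom.ext _ _ (funext fun i => ?_))) rfl
    induction i using Fin.lastCases with
    | last => exact coneMap_last _
    | cast i => exact coneMap_castSucc _ i
  map_comp f g := by
    refine Prod.ext (SimplexCategory.Hom.ext _ _ (OrderHom.ext _ _ (funext fun i => ?_))) rfl
    induction i using Fin.lastCases with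
    | last =>
      exact (coneMap_last _).trans
        ((congrArg _ (coneMap_last f.1)).trans (coneMap_last g.1)).symm
    | cast i =>
      exact (coneMap_castSucc _ i).trans
        ((congrArg _ (coneMap_castSucc f.1 i)).trans (coneMap_castSucc g.1 _)).symm

/-- The natural map `[d^{m+1}, x] : ([m], x) ⟶ ([m + 1], x)`. -/
def lastFace (d : ℕ) : 𝟭 (Shape d) ⟶ cone d where
  app c := Prod.mkHom (SimplexCategory.δ (Fin.last (c.1.len + 1))) (𝟙 c.2)
  naturality c c' f := by
    refine Prod.ext (SimplexCategory.Hom.ext _ _ (OrderHom.ext _ _ (funext fun i => ?_)))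
      ((Category.comp_id _).trans (Category.id_comp _).symm)
    have h : ∀ (m : SimplexCategory) (i : Fin (m.len + 1)),
        (SimplexCategory.δ (Fin.last (m.len + 1))).toOrderHom i = i.castSucc :=
      fun m i => Fin.succAbove_last_apply i
    exact (h _ _).trans ((congrArg _ (h _ i)).trans (coneMap_castSucc f.1 i)).symm

/-- The representable simplicial `Θ_d`-space `F[m, θ, k]` at `c = ([m], θ, [k])`, functorially in
`c`. -/
abbrev rep (d : ℕ) : Shape d ⥤ SimplicialThetaSpace.{u} d := uliftYoneda.{u}

variable (W : Pcat.{u} d)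

/-- The category of elements `∫ W`: its objects are the maps `σ : F[m, θ, k] ⟶ W`. -/
abbrev Elts : Type u := CostructuredArrow (rep.{u} d) W.obj

variable {W}

/-- The map `L F[m, θ, k] ⟶ W` in precategories that corresponds to `σ : F[m, θ, k] ⟶ W`. -/
def adjunct (σ : Elts W) : (L.{u} d).obj ((rep d).obj σ.left) ⟶ W :=
  ((adjL d).homEquiv _ _).symm σ.hom

lemma map_adjunct {τ σ : Elts W} (g : τ ⟶ σ) :
    (L d).map ((rep d).map g.left) ≫ adjunct σ = adjunct τ := by
  rw [adjunct, adjunct, ← Adjunction.homEquiv_naturality_left_symm]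
  exact congrArg _ (CostructuredArrow.w g)

/-- The map `L [d^{m+1}, θ, k] : L F[m, θ, k] ⟶ L F[m + 1, θ, k]`. -/
def incl (c : Shape d) : (L.{u} d).obj ((rep d).obj c) ⟶ (L.{u} d).obj ((rep d).obj ((cone d).obj c)) :=
  (L d).map ((rep d).map ((lastFace d).app c))

lemma incl_naturality {c c' : Shape d} (f : c ⟶ c') :
    incl.{u} c ≫ (L d).map ((rep d).map ((cone d).map f)) = (L d).map ((rep d).map f) ≫ incl c' := by
  rw [incl, incl, ← Functor.map_comp, ← Functor.map_comp, ← Functor.map_comp, ← Functor.map_comp]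
  exact congrArg _ (congrArg _ ((lastFace d).naturality f).symm)

/-- The pushout `W_σ` in precategories of `L F[m + 1, θ, k] ← L F[m, θ, k] → W`. -/
def coneOf (σ : Elts W) : Pcat.{u} d := pushout (adjunct σ) (incl σ.left)

/-- The map `ι_σ : W ⟶ W_σ`. -/
def coneInl (σ : Elts W) : W ⟶ coneOf σ := pushout.inl _ _

/-- The map `σ' : L F[m + 1, θ, k] ⟶ W_σ`. -/
def coneInr (σ : Elts W) : (L.{u} d).obj ((rep d).obj ((cone d).obj σ.left)) ⟶ coneOf σ :=
  pushout.inr _ _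

/-- The map `W_τ ⟶ W_σ` that is induced by a morphism `τ ⟶ σ` of the category of elements. -/
def coneOfMap {τ σ : Elts W} (g : τ ⟶ σ) : coneOf τ ⟶ coneOf σ :=
  pushout.map _ _ _ _ (𝟙 W) ((L d).map ((rep d).map ((cone d).map g.left)))
    ((L d).map ((rep d).map g.left)) ((Category.comp_id _).trans (map_adjunct g).symm)
    (incl_naturality g.left)

lemma coneInl_map {τ σ : Elts W} (g : τ ⟶ σ) : coneInl τ ≫ coneOfMap g = coneInl σ :=
  (pushout.inl_desc _ _ _).trans (Category.id_comp _)

lemma coneInr_map {τ σ : Elts W} (g : τ ⟶ σ) : coneInr τ ≫ coneOfMap g =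
    (L d).map ((rep d).map ((cone d).map g.left)) ≫ coneInr σ :=
  pushout.inr_desc _ _ _

lemma coneOfMap_id (σ : Elts W) : coneOfMap (𝟙 σ) = 𝟙 _ := by
  apply pushout.hom_ext
  · exact (coneInl_map (𝟙 σ)).trans (Category.comp_id _).symm
  · refine (coneInr_map (𝟙 σ)).trans (Eq.trans ?_ (Category.comp_id _).symm)
    have : (𝟙 σ : σ ⟶ σ).left = 𝟙 σ.left := rfl
    rw [this, (cone d).map_id, (rep d).map_id, (L d).map_id]
    exact Category.id_comp _

lemma coneOfMap_comp {ρ τ σ : Elts W} (f : ρ ⟶ τ) (g : τ ⟶ σ) :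
    coneOfMap (f ≫ g) = coneOfMap f ≫ coneOfMap g := by
  apply pushout.hom_ext
  · refine (coneInl_map (f ≫ g)).trans (Eq.trans ?_ (Category.assoc _ _ _))
    exact ((congrArg (· ≫ coneOfMap g) (coneInl_map f)).trans (coneInl_map g)).symm
  · refine (coneInr_map (f ≫ g)).trans (Eq.trans ?_ (Category.assoc _ _ _))
    refine Eq.trans ?_ (congrArg (· ≫ coneOfMap g) (coneInr_map f)).symm
    refine Eq.trans ?_ (Category.assoc _ _ _).symm
    refine Eq.trans ?_ (congrArg _ (coneInr_map g)).symm
    have : (f ≫ g).left = f.left ≫ g.left := rfl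
    rw [this, (cone d).map_comp, (rep d).map_comp, (L d).map_comp]
    exact Category.assoc _ _ _

/-- The object of a precategory `Y` that underlies an element of `Y_{0,x}`: its restriction to the
terminal cell. -/
def obOf (Y : Pcat.{u} d) {x : Cell d} (z : Y.obj.obj (op (⟨0⟩, x))) : Coh Y :=
  res Y.obj x.point z

/-- As `Y_0` is discrete, `obOf z` is the unique object whose degenerate element is `z`. -/
lemma degen_obOf (Y : Pcat.{u} d) {x : Cell d} (z : Y.obj.obj (op (⟨0⟩, x))) :
    degen Y.obj x (obOf Y z) = z := by
  have h : Function.Bijective ((level Y.obj ⟨0⟩).map x.toPt.op) := Y.property.bijective _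
  obtain ⟨a, rfl⟩ := h.2 z
  refine congrArg (degen Y.obj x) ?_
  refine ((res_comp Y.obj x.point x.toPt a).symm).trans ?_
  rw [Cell.toPt_unique (x.point ≫ x.toPt) (𝟙 _)]
  exact res_id Y.obj a

lemma degen_injective (Y : Pcat.{u} d) (x : Cell d) : Function.Injective (degen Y.obj x) :=
  (Y.property.bijective x.toPt.op).1

lemma obOf_res (Y : Pcat.{u} d) {x y : Cell d} (g : y ⟶ x) (z : Y.obj.obj (op (⟨0⟩, x))) :
    obOf Y (res Y.obj g z) = obOf Y z := by
  apply degen_injective Y y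
  exact (degen_obOf Y _).trans
    ((congrArg (res Y.obj g) (degen_obOf Y z)).symm.trans (res_degen Y.obj g _))

lemma app_obOf {Y Y' : Pcat.{u} d} (f : Y ⟶ Y') {x : Cell d} (z : Y.obj.obj (op (⟨0⟩, x))) :
    f.hom.app _ (obOf Y z) = obOf Y' (f.hom.app _ z) :=
  NatTrans.naturality_apply f.hom _ z

/-- The vertex `m + 1` of `F[m + 1, θ, k]`, as an element of the set `F[m + 1, θ, k]_{0,θ,k}`. -/
def lastVertex (c : Shape d) :
    ((rep.{u} d).obj ((cone d).obj c)).obj (op (⟨0⟩, c.2)) :=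
  ⟨Prod.mkHom (SimplexCategory.const ⟨0⟩ ⟨c.1.len + 1⟩ (Fin.last _)) (𝟙 c.2)⟩

lemma lastVertex_map {c c' : Shape d} (f : c ⟶ c') :
    ((rep.{u} d).map ((cone d).map f)).app _ (lastVertex c) =
      res ((rep.{u} d).obj ((cone d).obj c')) f.2 (lastVertex c') := by
  refine congrArg ULift.up (Prod.ext (SimplexCategory.Hom.ext _ _
    (OrderHom.ext _ _ (funext fun i => ?_))) ((Category.id_comp _).trans (Category.comp_id _).symm))
  exact coneMap_last f.1

/-- The object `⊤` of `W_σ`: the image under `σ'` of the object `m + 1`. -/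
def top (σ : Elts W) : Coh (coneOf σ) :=
  obOf (coneOf σ) (x := σ.left.2)
    ((coneInr σ).hom.app _ (((adjL d).unit.app _).app _ (lastVertex σ.left)))

lemma cohMap_top {τ σ : Elts W} (g : τ ⟶ σ) : (cohMap (coneOfMap g)).obj (top τ) = top σ := by
  refine (app_obOf (coneOfMap g) _).trans ?_
  rw [top, ← obOf_res (coneOf σ) g.left.2]
  refine congrArg (obOf (coneOf σ)) ?_
  have e₁ := congrArg (fun α => α.hom.app (op (⟨0⟩, τ.left.2))
    (((adjL d).unit.app _).app _ (lastVertex τ.left))) (coneInr_map g)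
  have e₂ := congrArg (fun α => α.app (op (⟨0⟩, τ.left.2)) (lastVertex τ.left))
    ((adjL d).unit.naturality ((rep.{u} d).map ((cone d).map g.left)))
  have e₃ := NatTrans.naturality_apply
    ((adjL d).unit.app ((rep.{u} d).obj ((cone d).obj σ.left)) ≫ (coneInr σ).hom)
    (Prod.mkHom (𝟙 ⟨0⟩) g.left.2).op (lastVertex σ.left)
  refine Eq.trans e₁ (Eq.trans ?_ e₃)
  refine congrArg ((coneInr σ).hom.app _) ?_
  exact e₂.symm.trans (congrArg (((adjL d).unit.app _).app _) (lastVertex_map g.left))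

/-- The enriched functor `St_W(σ)`, i.e. `a ↦ Hom_{ℭ W_σ}(ι_σ a, ⊤)`. -/
def stObj (σ : Elts W) : EPresheaf d (Coh W) :=
  (EPresheaf.pull (cohMap (coneInl σ))).obj (EPresheaf.repr (top σ))

/-- The functoriality of `St_W(σ)` in `σ`. -/
def stMap {τ σ : Elts W} (g : τ ⟶ σ) : stObj τ ⟶ stObj σ :=
  EPresheaf.reprMap (cohMap (coneInl τ)) (cohMap (coneOfMap g)) (cohMap (coneInl σ))
    (by rw [← cohMap_comp, coneInl_map]) (cohMap_top g)

variable (W)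

/-- The functor `St_W` on the category of elements of `W`. -/
def stElts : Elts W ⥤ EPresheaf d (Coh W) where
  obj σ := stObj σ
  map g := stMap g
  map_id σ := EPresheaf.reprMap_id _ _ ((congrArg cohMap (coneOfMap_id σ)).trans (cohMap_id _)) _ _
  map_comp f g := EPresheaf.reprMap_comp _ _ _ _ _ _ _ _ _ _
    ((congrArg cohMap (coneOfMap_comp f g)).trans (cohMap_comp _ _)) _ _

/-- The straightening functor `St_W`: the left Kan extension of `St_W` on the category of elements
of `W` along the Yoneda embedding, where presheaves on the category of elements of `W` are viewed as
objects over `W`. Thus it is the left Kan extension along the functor that sends an element `σ` to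
the object `σ : F[m, θ, k] ⟶ W` over `W`. -/
def St : Over W.obj ⥤ EPresheaf d (Coh W) :=
  (CostructuredArrow.toOver (rep d) W.obj).leftKanExtension (stElts W)

end Straightening

end ThetaSpaces
end

/-!
The presheaf `St_W(σ) = Hom_{ℭ W_σ}(ι_σ -, ⊤)` has a universal property. A map from it to an
enriched presheaf `G` on `ℭ W` is the same as a `ConeDatum σ G`: elements of the values of `G` at
the vertices of `σ`, one for each path of `[m + 1]` from such a vertex to `m + 1`, compatibly with
restriction and with the action of the paths of `[m]`.

* Existence (`stDesc`): `G` has a collage, the enriched category that is obtained from `ℭ W` by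
  adding an object whose incoming hom objects are the values of `G`. Functors from `ℭ X` to the
  collage come from maps from `X` to its homotopy coherent nerve. The nerve is a precategory, so the
  universal property of the pushout gives a map `W_σ ⟶ N(Collage G)` that extends the inclusion of
  `W` by the datum, and the resulting functor from `ℭ W_σ` to the collage maps morphisms to `⊤` to
  elements of `G`.
* Uniqueness (`stObj_hom_ext`): the elements of `W_σ` are those of `W` and the restrictions of the
  new simplex, so every morphism of `ℭ W_σ` from an object of `ℭ W` to `⊤` is a morphism of `ℭ W`
  followed by a path to `⊤` (`isConeHom`). Here the functors to collages show that `⊤` is not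
  an object of `W`, and that `W_σ` does not identify objects of `W`.

The vertices of `f σ` are the images of the vertices of `σ`, so a datum for `σ` in the restriction
of `G` along `ℭ f` is a datum for `f σ` in `G` (`ConeDatum.base`). Hence `(ℭ f)_! St_W(σ)` and
`St_Z(f σ)` have the same universal property, and they are isomorphic, naturally in `σ`
(`lanStEltsIso`).

The functor `(ℭ f)_!` is a left adjoint, so `(ℭ f)_! ∘ St_W` is the left Kan extension of
`σ ↦ (ℭ f)_! St_W(σ)`. The square that relates the categories of elements of `W` and `Z` with the
slice categories is Guitart exact, so `St_Z ∘ f_!` is the left Kan extension of `σ ↦ St_Z(f σ)`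
(`nonempty_iso_of_elts`).
-/

noncomputable section

namespace ThetaSpaces

/-! ### Paths in the simplicial thickening of a simplex -/

namespace Thick

variable {m m' m'' k : SimplexCategory}

lemma push_ident (μ : m' ⟶ m) (i : Fin (m'.len + 1)) :
    push μ (ident m' i k) = ident m (μ.toOrderHom i) k :=
  congrArg (fun α => α.app (op k) PUnit.unit)
    ((SimplicialThickening.functor μ.toOrderHom).map_id (.mk i))

lemma push_comp (μ : m' ⟶ m) {i j l : Fin (m'.len + 1)} (p : Thick m' i j k)
    (q : Thick m' j l k) : push μ (comp p q) = comp (push μ p) (push μ q) :=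
  congrArg (fun α : _ ⟶ EnrichedCategory.Hom (V := SSet.{0})
      ((SimplicialThickening.functor μ.toOrderHom).obj (.mk i))
      ((SimplicialThickening.functor μ.toOrderHom).obj (.mk l)) => α.app (op k) (p, q))
    ((SimplicialThickening.functor μ.toOrderHom).map_comp (.mk i) (.mk j) (.mk l))

/-- The path at the vertex `t` of a `k`-simplex `p` of the nerve of the poset of paths. -/
def path {i j : Fin (m.len + 1)} (p : Thick m i j k) (t : Fin (k.len + 1)) :
    SimplicialThickening.Path i j :=
  (show ComposableArrows (SimplicialThickening.mk i ⟶ SimplicialThickening.mk j) k.len from p).obj t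

lemma le {i j : Fin (m.len + 1)} (p : Thick m i j k) : i ≤ j := (p.path 0).le

/-- The paths form a poset, so a simplex of its nerve is determined by its vertices. -/
lemma ext {i j : Fin (m.len + 1)} {p q : Thick m i j k}
    (h : ∀ t, (p.path t).I = (q.path t).I) : p = q := by
  refine CategoryTheory.Functor.ext (fun t => SimplicialThickening.Path.ext (h t)) fun _ _ _ => ?_
  exact InducedCategory.hom_ext (Subsingleton.elim _ _)

lemma push_path (μ : m' ⟶ m) {i j : Fin (m'.len + 1)} (p : Thick m' i j k) (t) :
    ((push μ p).path t).I = μ.toOrderHom '' (p.path t).I := rfl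

lemma push_id {i j : Fin (m.len + 1)} (p : Thick m i j k) : push (𝟙 m) p = p :=
  ext fun _ => Set.image_id _

lemma push_push (μ : m'' ⟶ m') (ν : m' ⟶ m) {i j : Fin (m''.len + 1)} (p : Thick m'' i j k) :
    push (μ ≫ ν) p = push ν (push μ p) :=
  ext fun t => Set.image_comp ν.toOrderHom μ.toOrderHom (p.path t).I

lemma push_congr {μ ν : m' ⟶ m} (h : μ = ν) {i j : Fin (m'.len + 1)} (p : Thick m' i j k) :
    HEq (push μ p) (push ν p) := by
  subst h; rfl

lemma eq_ident {i : Fin (m.len + 1)} (p : Thick m i i k) : p = ident m i k := by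
  refine ext fun t => Set.ext fun l => ⟨fun h => ?_, fun h => ?_⟩
  · exact le_antisymm ((p.path t).le_right l h) ((p.path t).left_le l h)
  · exact (show l = i from h) ▸ (p.path t).left

lemma comp_ident {i j : Fin (m.len + 1)} (p : Thick m i j k) : comp p (ident m j k) = p := by
  refine ext fun t => Set.union_eq_left.2 fun l h => ?_
  exact (show l = j from h) ▸ (p.path t).right

/-- A path up to `j` is not changed by a map that fixes all elements up to `j`. -/
lemma push_heq (μ : m ⟶ m) {i j : Fin (m.len + 1)} (h : ∀ l ≤ j, μ.toOrderHom l = l)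
    (p : Thick m i j k) : HEq (push μ p) p := by
  have key : ∀ i' j' (_ : i' = i) (_ : j' = j) (q : Thick m i' j' k),
      (∀ t, (q.path t).I = (p.path t).I) → HEq q p := by
    rintro _ _ rfl rfl q hq
    exact heq_of_eq (ext hq)
  refine key _ _ (h _ p.le) (h _ le_rfl) _ fun t => ?_
  rw [push_path]
  ext l
  constructor
  · rintro ⟨x, hx, rfl⟩
    rwa [h _ ((p.path t).le_right x hx)]
  · intro hl
    exact ⟨l, hl, h _ ((p.path t).le_right l hl)⟩

end Thick

variable {d : ℕ}

/-! ### The homotopy coherent nerve -/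

section Nerve

variable {E : Type u} [EnrichedCategory (ThetaSpace.{u} d) E]

/-- Transport of elements of hom `Θ_d`-spaces along equalities of objects. -/
def homCast {x : (Cell d)ᵒᵖ} {a a' b b' : E} (ha : a = a') (hb : b = b')
    (f : (a ⟶[ThetaSpace.{u} d] b).obj x) : (a' ⟶[ThetaSpace.{u} d] b').obj x :=
  ha ▸ hb ▸ f

lemma homCast_eid {x : (Cell d)ᵒᵖ} {a a' : E} (h h' : a = a') :
    homCast h h' (eid a x) = eid a' x := by
  subst h; rfl

lemma homCast_ecomp {x : (Cell d)ᵒᵖ} {a a' b b' c c' : E} (ha : a = a') (hb : b = b') (hc : c = c')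
    (f : (a ⟶[ThetaSpace.{u} d] b).obj x) (g : (b ⟶[ThetaSpace.{u} d] c).obj x) :
    homCast ha hc (ecomp f g) = ecomp (homCast ha hb f) (homCast hb hc g) := by
  subst ha hb hc; rfl

lemma map_homCast {x y : (Cell d)ᵒᵖ} {a a' b b' : E} (ha : a = a') (hb : b = b')
    (f : (a ⟶[ThetaSpace.{u} d] b).obj x) (g : x ⟶ y) :
    (a' ⟶[ThetaSpace.{u} d] b').map g (homCast ha hb f) =
      homCast ha hb ((a ⟶[ThetaSpace.{u} d] b).map g f) := by
  subst ha hb; rfl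

variable (E) in
/-- An element at `([m], x)` of the homotopy coherent nerve of `E`: an enriched functor to `E` from
the product of `c^h Δ[m]` with the representable presheaf at `x` on all hom objects. The source and
the target of the value on a path are variables that come with a proof that they are the right
objects, so that no transport along equalities of objects is needed. -/
structure NerveElt (c : Shape d) : Type u where
  /-- the objects -/
  obj : Fin (c.1.len + 1) → E
  /-- the action on paths -/
  map : ∀ {y : Cell d} (_ : y ⟶ c.2) {i j : Fin (c.1.len + 1)} (_ : Thick c.1 i j y.2) {a b : E}
    (_ : obj i = a) (_ : obj j = b), (a ⟶[ThetaSpace.{u} d] b).obj (op y)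
  map_restr : ∀ {y z : Cell d} (h : z ⟶ y) (g : y ⟶ c.2) {i j : Fin (c.1.len + 1)}
    (p : Thick c.1 i j y.2) {a b : E} (ha : obj i = a) (hb : obj j = b),
    (a ⟶[ThetaSpace.{u} d] b).map h.op (map g p ha hb) = map (h ≫ g) (Thick.restr h.2 p) ha hb
  map_ident : ∀ {y : Cell d} (g : y ⟶ c.2) {i : Fin (c.1.len + 1)} {a : E} (ha hb : obj i = a),
    map g (Thick.ident c.1 i y.2) ha hb = eid a (op y)
  map_comp : ∀ {y : Cell d} (g : y ⟶ c.2) {i j l : Fin (c.1.len + 1)} (p : Thick c.1 i j y.2)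
    (q : Thick c.1 j l y.2) {a b e : E} (ha : obj i = a) (hb : obj j = b) (he : obj l = e),
    map g (Thick.comp p q) ha he = ecomp (map g p ha hb) (map g q hb he)

namespace NerveElt

lemma ext {c : Shape d} {s t : NerveElt E c} (h : ∀ i, s.obj i = t.obj i)
    (h' : ∀ {y : Cell d} (g : y ⟶ c.2) {i j : Fin (c.1.len + 1)} (p : Thick c.1 i j y.2) {a b : E}
      (ha : s.obj i = a) (hb : s.obj j = b) (ha' : t.obj i = a) (hb' : t.obj j = b),
      s.map g p ha hb = t.map g p ha' hb') : s = t := by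
  obtain ⟨so, sm, _, _, _⟩ := s
  obtain ⟨to', tm, _, _, _⟩ := t
  obtain rfl : so = to' := funext h
  congr 1
  funext y g i j p a b ha hb
  exact h' g p ha hb ha hb

lemma homCast_map {c : Shape d} (s : NerveElt E c) {y : Cell d} (g : y ⟶ c.2)
    {i j : Fin (c.1.len + 1)} (p : Thick c.1 i j y.2) {a b a' b' : E} (ha : s.obj i = a)
    (hb : s.obj j = b) (ha' : a = a') (hb' : b = b') :
    homCast ha' hb' (s.map g p ha hb) = s.map g p (ha.trans ha') (hb.trans hb') := by
  subst ha' hb'; rfl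

lemma map_congr {c : Shape d} {s t : NerveElt E c} (h : s = t) {y : Cell d} {g g' : y ⟶ c.2}
    (hg : g = g') {i j : Fin (c.1.len + 1)} (p : Thick c.1 i j y.2) {a b : E} (ha : s.obj i = a)
    (hb : s.obj j = b) (ha' : t.obj i = a) (hb' : t.obj j = b) :
    s.map g p ha hb = t.map g' p ha' hb' := by
  subst h hg; rfl

lemma map_path_congr {c : Shape d} (s : NerveElt E c) {y : Cell d} {g g' : y ⟶ c.2}
    (hg : g = g') {i j : Fin (c.1.len + 1)} {p p' : Thick c.1 i j y.2} (hp : p = p') {a b : E}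
    (ha : s.obj i = a) (hb : s.obj j = b) : s.map g p ha hb = s.map g' p' ha hb := by
  subst hg hp; rfl

/-- The action of the maps of shapes. -/
def pullback {c c' : Shape d} (f : c' ⟶ c) (s : NerveElt E c) : NerveElt E c' where
  obj i := s.obj (f.1.toOrderHom i)
  map g _ _ p _ _ ha hb := s.map (g ≫ f.2) (Thick.push f.1 p) ha hb
  map_restr h g _ _ p _ _ ha hb := (s.map_restr h (g ≫ f.2) (Thick.push f.1 p) ha hb).trans
    (map_congr rfl (Category.assoc _ _ _).symm _ _ _ _ _)
  map_ident g i a ha hb := by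
    rw [Thick.push_ident]
    exact s.map_ident _ _ _
  map_comp g _ _ _ p q _ _ _ ha hb he := by
    rw [Thick.push_comp]
    exact s.map_comp _ _ _ _ _ _

end NerveElt

variable (E) in
/-- The homotopy coherent nerve of a category enriched in `Θ_d`-spaces. -/
def cohNerveObj : SimplicialThetaSpace.{u} d where
  obj c := NerveElt E c.unop
  map f := ↾(NerveElt.pullback f.unop)
  map_id c := by
    ext s
    refine NerveElt.ext (fun _ => rfl) fun g i j p a b ha hb ha' hb' => ?_
    change s.map (g ≫ 𝟙 _) (Thick.push (𝟙 _) p) ha hb = s.map g p ha' hb'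
    rw [Thick.push_id]
    exact NerveElt.map_congr rfl (Category.comp_id g) _ _ _ _ _
  map_comp f f' := by
    ext s
    refine NerveElt.ext (fun _ => rfl) fun g i j p a b ha hb ha' hb' => ?_
    change s.map (g ≫ f'.unop.2 ≫ f.unop.2) (Thick.push (f'.unop.1 ≫ f.unop.1) p) ha hb =
      s.map ((g ≫ f'.unop.2) ≫ f.unop.2) (Thick.push f.unop.1 (Thick.push f'.unop.1 p)) ha' hb'
    rw [Thick.push_push]
    exact NerveElt.map_congr rfl (Category.assoc _ _ _).symm _ _ _ _ _

/-- The degenerate element of the homotopy coherent nerve on an object. -/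
def NerveElt.const (a : E) (x : Cell d) : NerveElt E (⟨0⟩, x) where
  obj _ := a
  map {y} _ _ _ _ _ _ ha hb := homCast ha hb (eid a (op y))
  map_restr {y z} h g i j p a b ha hb := by
    rw [map_homCast]
    exact congrArg _ (EPresheaf.map_eid _ _)
  map_ident g i a ha hb := homCast_eid _ _
  map_comp g i j l p q a b e ha hb he := by
    rw [← homCast_ecomp, EPresheaf.eid_ecomp]

lemma NerveElt.eq_const {x : Cell d} (s : NerveElt E (⟨0⟩, x)) : s = const (s.obj 0) x := by
  have h : ∀ i : Fin 1, 0 = i := fun i => (Subsingleton.elim _ _)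
  refine ext (fun i => congrArg s.obj (h i).symm) fun {y} g i j p a b ha hb ha' hb' => ?_
  obtain rfl : (0 : Fin 1) = i := h i
  obtain rfl : (0 : Fin 1) = j := h j
  rw [Thick.eq_ident p]
  change s.obj 0 = a at ha'
  change s.obj 0 = b at hb'
  subst ha' hb'
  exact s.map_ident g _ _

variable (E) in
/-- The objects in level `0` of the homotopy coherent nerve of `E` are the objects of `E`. -/
lemma isPrecat_cohNerveObj : isPrecat d (cohNerveObj E) :=
  ⟨E, ⟨NatIso.ofComponents (fun x => Equiv.toIso
    { toFun a := NerveElt.const (E := E) a x.unop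
      invFun s := s.obj (0 : Fin 1)
      left_inv _ := rfl
      right_inv s := s.eq_const.symm }) (by
      intro x y f
      ext a
      exact (NerveElt.eq_const (E := E) (NerveElt.pullback
        ((Prod.sectR (⟨0⟩ : SimplexCategory) (Cell d)).op.map f).unop
        (NerveElt.const (E := E) a x.unop))).symm)⟩⟩

variable (E) in
/-- The homotopy coherent nerve as a precategory. -/
def cohNerve : Pcat.{u} d := ⟨cohNerveObj E, isPrecat_cohNerveObj E⟩

/-! ### The functor that corresponds to a map to the homotopy coherent nerve -/

variable {X : SimplicialThetaSpace.{u} d} (m : X ⟶ cohNerveObj E)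

/-- The object of `E` that corresponds to an object of `X`. -/
def nerveOb (a : Ob X) : E := NerveElt.obj (m.app _ a) (0 : Fin 1)

lemma obj_app_map {c c' : Shape d} (f : c' ⟶ c) (s : X.obj (op c)) (i : Fin (c'.1.len + 1)) :
    NerveElt.obj (m.app _ (X.map f.op s)) i = NerveElt.obj (m.app _ s) (f.1.toOrderHom i) :=
  congrArg (fun t : NerveElt E c' => t.obj i) (NatTrans.naturality_apply m f.op s)

lemma obj_eq_nerveOb {x : Cell d} {n : SimplexCategory} {s : X.obj (op (n, x))}
    {i : Fin (n.len + 1)} {a : Ob X} (h : vertex X s i = degen X x a) :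
    NerveElt.obj (m.app _ s) i = nerveOb m a :=
  (obj_app_map m (Prod.mkHom (SimplexCategory.const ⟨0⟩ n i) (𝟙 x)) s (0 : Fin 1)).symm.trans
    ((congrArg (fun t => NerveElt.obj (m.app (op (⟨0⟩, x)) t) (0 : Fin 1)) h).trans
      (obj_app_map m (Prod.mkHom (𝟙 ⟨0⟩) x.toPt) a (0 : Fin 1)))

lemma map_app_map {c c' : Shape d} (f : c' ⟶ c) (s : X.obj (op c)) {y : Cell d} (g : y ⟶ c'.2)
    {i j : Fin (c'.1.len + 1)} (p : Thick c'.1 i j y.2) {a b : E}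
    (ha : NerveElt.obj (m.app _ (X.map f.op s)) i = a)
    (hb : NerveElt.obj (m.app _ (X.map f.op s)) j = b) :
    NerveElt.map (m.app _ (X.map f.op s)) g p ha hb =
      NerveElt.map (m.app _ s) (g ≫ f.2) (Thick.push f.1 p) ((obj_app_map m f s i).symm.trans ha)
        ((obj_app_map m f s j).symm.trans hb) :=
  NerveElt.map_congr (c := c') (NatTrans.naturality_apply m f.op s) rfl _ _ _ _ _

/-- The value of a generator. -/
def Gen.eval {x : Cell d} {a b : Ob X} (s : Gen X x a b) :
    (nerveOb m a ⟶[ThetaSpace.{u} d] nerveOb m b).obj (op x) :=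
  NerveElt.map (m.app _ s.simplex) (𝟙 x) s.path (obj_eq_nerveOb m s.src) (obj_eq_nerveOb m s.tgt)

/-- The value of a word. -/
def Word.eval {x : Cell d} : ∀ {a b : Ob X}, Word X x a b →
    (nerveOb m a ⟶[ThetaSpace.{u} d] nerveOb m b).obj (op x)
  | _, _, .gen s => s.eval m
  | _, _, .ident _ => eid _ _
  | _, _, .comp v w => ecomp v.eval w.eval

lemma WordRel.eval_eq {x : Cell d} {a b : Ob X} {v w : Word X x a b} (h : WordRel X x v w) :
    v.eval m = w.eval m := by
  induction h with
  | id_comp v => exact EPresheaf.eid_ecomp _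
  | comp_id v => exact EPresheaf.ecomp_eid _
  | assoc v w z => exact EPresheaf.ecomp_assoc _ _ _
  | comp_left w _ ih => exact congrArg (fun z => ecomp z (w.eval m)) ih
  | comp_right v _ ih => exact congrArg (fun z => ecomp (v.eval m) z) ih
  | gen_ident σ i h h' => exact NerveElt.map_ident _ _ _ _
  | gen_comp σ p q hi hj hl => exact NerveElt.map_comp _ _ _ _ _ _ _
  | gen_map μ σ p hi hj hi' hj' =>
    refine (map_app_map m (Prod.mkHom μ (𝟙 _)) σ (𝟙 _) p _ _).trans ?_
    exact NerveElt.map_congr rfl (Category.comp_id _) _ _ _ _ _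

lemma Word.eval_restr {x y : Cell d} (g : y ⟶ x) {a b : Ob X} (v : Word X x a b) :
    (v.restr g).eval m = (nerveOb m a ⟶[ThetaSpace.{u} d] nerveOb m b).map g.op (v.eval m) := by
  induction v with
  | gen s =>
    refine (map_app_map m (Prod.mkHom (𝟙 _) g) s.simplex (𝟙 _) (Thick.restr g.2 s.path) _ _).trans
      (Eq.trans ?_ (NerveElt.map_restr (c := (s.dim, x)) _ g (𝟙 x) s.path _ _).symm)
    exact NerveElt.map_path_congr (c := (s.dim, x)) _
      ((Category.id_comp _).trans (Category.comp_id _).symm) (Thick.push_id _) _ _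
  | ident a => exact (EPresheaf.map_eid _ _).symm
  | comp v w h₁ h₂ =>
    exact (congrArg₂ ecomp h₁ h₂).trans (EPresheaf.map_ecomp _ _ _).symm

/-- The action on homs of the enriched functor `ℭ X ⟶ E` that corresponds to `m`. -/
def CohHom.eval {x : Cell d} {a b : Ob X} (v : CohHom X x a b) :
    (nerveOb m a ⟶[ThetaSpace.{u} d] nerveOb m b).obj (op x) :=
  Quot.lift (Word.eval m) (fun _ _ h => h.eval_eq m) v

lemma CohHom.eval_comp {x : Cell d} {a b c : Ob X} (v : CohHom X x a b) (w : CohHom X x b c) :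
    (v.comp w).eval m = ecomp (v.eval m) (w.eval m) := by
  induction v using Quot.ind with | mk v => ?_
  induction w using Quot.ind with | mk w => ?_
  rfl

lemma CohHom.eval_restr {x y : Cell d} (g : y ⟶ x) {a b : Ob X} (v : CohHom X x a b) :
    (v.restr g).eval m = (nerveOb m a ⟶[ThetaSpace.{u} d] nerveOb m b).map g.op (v.eval m) := by
  induction v using Quot.ind with | mk v => ?_
  exact Word.eval_restr m g v

end Nerve

/-! ### The collage of an enriched presheaf -/

section Collage

variable {C : Type u} [EnrichedCategory (ThetaSpace.{u} d) C]

/-- The objects of the collage of `G`: those of `C`, and a new object `none`. -/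
def Collage (_ : EPresheaf d C) : Type u := Option C

/-- The morphisms of the collage of `G` in level `x`: those of `C`, the elements of `G a` as
morphisms from `a` to the new object, and the identity of the new object. -/
inductive CollageHom (G : EPresheaf d C) (x : (Cell d)ᵒᵖ) : Option C → Option C → Type u
  | base {a b : C} (f : (a ⟶[ThetaSpace.{u} d] b).obj x) : CollageHom G x (some a) (some b)
  | elt {a : C} (s : (G.obj a).obj x) : CollageHom G x (some a) none
  | top : CollageHom G x none none

namespace CollageHom

variable {G : EPresheaf d C} {x y z : (Cell d)ᵒᵖ}

/-- Restriction along a map of cells. -/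
def map (g : x ⟶ y) : ∀ {a b : Option C}, CollageHom G x a b → CollageHom G y a b
  | _, _, base (a := a) (b := b) f => base ((a ⟶[ThetaSpace.{u} d] b).map g f)
  | _, _, elt s => elt ((G.obj _).map g s)
  | _, _, top => top

/-- Identities. -/
def ident (G : EPresheaf d C) (x : (Cell d)ᵒᵖ) : ∀ a : Option C, CollageHom G x a a
  | some a => base (eid a x)
  | none => top

/-- Composition, given by the composition of `C` and by the action of `C` on `G`. -/
def comp : ∀ {a b c : Option C}, CollageHom G x a b → CollageHom G x b c → CollageHom G x a c
  | _, _, _, base f, base g => base (ecomp f g)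
  | _, _, _, base f, elt s => elt (G.act f s)
  | _, _, _, elt s, top => elt s
  | _, _, _, top, top => top

lemma map_id {a b : Option C} (v : CollageHom G x a b) : v.map (𝟙 x) = v := by
  cases v with
  | @base a b f => exact congrArg base (Functor.map_id_apply (a ⟶[ThetaSpace.{u} d] b) x f)
  | @elt a s => exact congrArg elt (Functor.map_id_apply (G.obj a) x s)
  | top => rfl

lemma map_comp (g : x ⟶ y) (h : y ⟶ z) {a b : Option C} (v : CollageHom G x a b) :
    v.map (g ≫ h) = (v.map g).map h := by
  cases v with
  | @base a b f => exact congrArg base (Functor.map_comp_apply (a ⟶[ThetaSpace.{u} d] b) g h f)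
  | @elt a s => exact congrArg elt (Functor.map_comp_apply (G.obj a) g h s)
  | top => rfl

lemma map_ident (g : x ⟶ y) (a : Option C) : (ident G x a).map g = ident G y a := by
  cases a with
  | some a => exact congrArg base (EPresheaf.map_eid a g)
  | none => rfl

lemma comp_map (g : x ⟶ y) {a b c : Option C} (v : CollageHom G x a b)
    (w : CollageHom G x b c) : (v.comp w).map g = (v.map g).comp (w.map g) := by
  cases v with
  | base f =>
    cases w with
    | base f' => exact congrArg base (EPresheaf.map_ecomp g f f')
    | elt s => exact congrArg elt (G.map_act g f s)
  | elt s => cases w; rfl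
  | top => cases w; rfl

lemma ident_comp {a b : Option C} (v : CollageHom G x a b) : (ident G x a).comp v = v := by
  cases v with
  | base f => exact congrArg base (EPresheaf.eid_ecomp f)
  | elt s => exact congrArg elt (G.id_act s)
  | top => rfl

lemma comp_ident {a b : Option C} (v : CollageHom G x a b) : v.comp (ident G x b) = v := by
  cases v with
  | base f => exact congrArg base (EPresheaf.ecomp_eid f)
  | elt s => rfl
  | top => rfl

lemma assoc {a b c e : Option C} (v : CollageHom G x a b) (w : CollageHom G x b c)
    (z : CollageHom G x c e) : (v.comp w).comp z = v.comp (w.comp z) := by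
  cases v with
  | base f =>
    cases w with
    | base f' =>
      cases z with
      | base f'' => exact congrArg base (EPresheaf.ecomp_assoc f f' f'')
      | elt s => exact congrArg elt (G.comp_act f f' s)
    | elt s => cases z; rfl
  | elt s => cases w; cases z; rfl
  | top => cases w; cases z; rfl

/-- The element of `G a` that is given by a morphism to the new object. -/
def toElt {a : C} : CollageHom G x (some a) none → (G.obj a).obj x
  | elt s => s

end CollageHom

/-- The hom `Θ_d`-spaces of the collage. -/
def collageHom (G : EPresheaf d C) (a b : Option C) : ThetaSpace.{u} d where
  obj x := CollageHom G x a b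
  map g := ↾(CollageHom.map g)
  map_id _ := by
    ext v
    exact v.map_id
  map_comp g h := by
    ext v
    exact v.map_comp g h

instance (G : EPresheaf d C) : EnrichedCategory (ThetaSpace.{u} d) (Collage G) where
  Hom a b := collageHom G a b
  id a :=
    { app x := ↾(fun _ => CollageHom.ident G x a)
      naturality x y g := by
        ext
        exact (CollageHom.map_ident g a).symm }
  comp a b c :=
    { app x := ↾(fun p => CollageHom.comp p.1 p.2)
      naturality x y g := by
        ext ⟨v, w⟩
        exact (CollageHom.comp_map g v w).symm }
  id_comp a b := by
    ext x v
    exact CollageHom.ident_comp v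
  comp_id a b := by
    ext x v
    exact CollageHom.comp_ident v
  assoc a b c e := by
    ext x ⟨v, w, z⟩
    exact CollageHom.assoc v w z

end Collage

/-! ### Generators of the homotopy coherent categorification -/

section Generators

variable {W Z : Pcat.{u} d} {x y : Cell d} {a b e : Coh W}

/-- The morphism of `ℭ W` that is given by a generator. -/
def cohGen (s : Gen W.obj x a b) : (a ⟶[ThetaSpace.{u} d] b).obj (op x) :=
  show CohHom W.obj x a b from Quot.mk _ (.gen s)

lemma cohGen_ident {m : SimplexCategory} (σ : W.obj.obj (op (m, x))) (i : Fin (m.len + 1))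
    (h h' : vertex W.obj σ i = degen W.obj x a) :
    cohGen ⟨m, σ, i, i, Thick.ident m i x.2, h, h'⟩ = eid a (op x) :=
  Quot.sound (.gen_ident σ i h h')

lemma cohGen_comp {m : SimplexCategory} (σ : W.obj.obj (op (m, x)))
    {i j l : Fin (m.len + 1)} (p : Thick m i j x.2) (q : Thick m j l x.2)
    (hi : vertex W.obj σ i = degen W.obj x a) (hj : vertex W.obj σ j = degen W.obj x b)
    (hl : vertex W.obj σ l = degen W.obj x e) :
    cohGen ⟨m, σ, i, l, Thick.comp p q, hi, hl⟩ =
      ecomp (cohGen ⟨m, σ, i, j, p, hi, hj⟩) (cohGen ⟨m, σ, j, l, q, hj, hl⟩) :=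
  Quot.sound (.gen_comp σ p q hi hj hl)

lemma vertex_map (X : SimplicialThetaSpace.{u} d) {c c' : Shape d} (f : c' ⟶ c) (s : X.obj (op c))
    (i : Fin (c'.1.len + 1)) :
    vertex X (X.map f.op s) i = res X f.2 (vertex X s (f.1.toOrderHom i)) :=
  (map_map X f (Prod.mkHom (SimplexCategory.const ⟨0⟩ c'.1 i) (𝟙 c'.2))
      (Prod.mkHom (SimplexCategory.const ⟨0⟩ c.1 (f.1.toOrderHom i)) f.2)
      (Prod.ext rfl (Category.id_comp _)) s).trans
    (map_map X (Prod.mkHom (SimplexCategory.const ⟨0⟩ c.1 (f.1.toOrderHom i)) (𝟙 c.2))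
      (Prod.mkHom (𝟙 (⟨0⟩ : SimplexCategory)) f.2)
      (Prod.mkHom (SimplexCategory.const ⟨0⟩ c.1 (f.1.toOrderHom i)) f.2)
      (Prod.ext (Category.id_comp _) (Category.comp_id _)) s).symm

/-- The relation between the generators on a simplex `σ` and on `μ^* σ`, where the simplex, the
vertices and the path are only required to be equal to the given ones. -/
lemma cohGen_map {m m' : SimplexCategory} (μ : m' ⟶ m) (σ : W.obj.obj (op (m, x)))
    {τ : W.obj.obj (op (m', x))} (hτ : τ = W.obj.map (Prod.mkHom μ (𝟙 x)).op σ)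
    {i j : Fin (m'.len + 1)} (p : Thick m' i j x.2) {i' j' : Fin (m.len + 1)}
    (p' : Thick m i' j' x.2) (hi : μ.toOrderHom i = i') (hj : μ.toOrderHom j = j')
    (hp : HEq (Thick.push μ p) p')
    (ha : vertex W.obj τ i = degen W.obj x a) (hb : vertex W.obj τ j = degen W.obj x b)
    (ha' : vertex W.obj σ i' = degen W.obj x a) (hb' : vertex W.obj σ j' = degen W.obj x b) :
    cohGen ⟨m', τ, i, j, p, ha, hb⟩ = cohGen ⟨m, σ, i', j', p', ha', hb'⟩ := by
  subst hτ hi hj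
  obtain rfl := eq_of_heq hp
  exact Quot.sound (.gen_map μ σ p ha hb ha' hb')

lemma map_cohGen (g : y ⟶ x) (s : Gen W.obj x a b) :
    (a ⟶[ThetaSpace.{u} d] b).map g.op (cohGen s) = cohGen (s.restr g) := rfl

lemma emap_cohGen (f : W ⟶ Z) (s : Gen W.obj x a b) :
    emap (cohMap f) (cohGen s) = cohGen (W := Z) (s.map f.hom) := rfl

lemma cohGen_congr {m : SimplexCategory} {σ τ : W.obj.obj (op (m, x))} (h : σ = τ)
    {i j : Fin (m.len + 1)} {p q : Thick m i j x.2} (hp : p = q)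
    (h₁ : vertex W.obj σ i = degen W.obj x a) (h₂ : vertex W.obj σ j = degen W.obj x b)
    (h₃ : vertex W.obj τ i = degen W.obj x a) (h₄ : vertex W.obj τ j = degen W.obj x b) :
    cohGen ⟨m, σ, i, j, p, h₁, h₂⟩ = cohGen ⟨m, τ, i, j, q, h₃, h₄⟩ := by
  subst h hp; rfl

lemma vertex_res_of_obOf {m : SimplexCategory} {σ : W.obj.obj (op (m, x))} {i : Fin (m.len + 1)}
    (h : obOf W (vertex W.obj σ i) = a) (g : y ⟶ x) :
    vertex W.obj (res W.obj g σ) i = degen W.obj y a := by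
  subst h
  exact (res_vertex W.obj g σ i).trans ((congrArg (res W.obj g) (degen_obOf W _)).symm.trans
    (res_degen W.obj g _))

lemma obOf_of_eq_degen {z : W.obj.obj (op (⟨0⟩, x))} (h : z = degen W.obj x a) :
    obOf W z = a :=
  degen_injective W x ((degen_obOf W z).trans h)

lemma obOf_of_vertex_res {m : SimplexCategory} {σ : W.obj.obj (op (m, x))} {i : Fin (m.len + 1)}
    (g : y ⟶ x) (h : vertex W.obj (res W.obj g σ) i = degen W.obj y a) :
    obOf W (vertex W.obj σ i) = a :=
  (obOf_res W g _).symm.trans ((congrArg (obOf W) (res_vertex W.obj g σ i)).symm.trans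
    (obOf_of_eq_degen h))

end Generators

/-! ### The inclusion of a precategory into the nerve of a collage -/

section CollageUnit

variable {W : Pcat.{u} d} (G : EPresheaf d (Coh W))

/-- The action on paths of `collageUnitElt`. -/
def collageUnitMap {c : Shape d} (τ : W.obj.obj (op c)) {y : Cell d} (g : y ⟶ c.2)
    {i j : Fin (c.1.len + 1)} (p : Thick c.1 i j y.2) : ∀ {a b : Option (Coh W)}
    (_ : some (obOf W (vertex W.obj (m := c.1) τ i)) = a)
    (_ : some (obOf W (vertex W.obj (m := c.1) τ j)) = b), CollageHom G (op y) a b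
  | some _, some _, ha, hb => .base (cohGen ⟨c.1, res W.obj g τ, i, j, p,
      vertex_res_of_obOf (Option.some.inj ha) g, vertex_res_of_obOf (Option.some.inj hb) g⟩)

/-- The element of the homotopy coherent nerve of the collage that corresponds to an element of
`W`. -/
def collageUnitElt {c : Shape d} (τ : W.obj.obj (op c)) : NerveElt (Collage G) c where
  obj i := some (obOf W (vertex W.obj (m := c.1) τ i))
  map g _ _ p _ _ ha hb := collageUnitMap G τ g p ha hb
  map_restr h g i j p a b ha hb := by
    cases ha
    cases hb
    refine congrArg CollageHom.base ((map_cohGen h _).trans ?_)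
    exact cohGen_congr (res_comp W.obj h g τ).symm rfl _ _ _ _
  map_ident g i a ha hb := by
    cases ha
    exact congrArg CollageHom.base (cohGen_ident _ _ _ _)
  map_comp g i j l p q a b e ha hb he := by
    cases ha
    cases hb
    cases he
    exact congrArg CollageHom.base (cohGen_comp _ _ _ _ _ _)

/-- The map from `W` to the homotopy coherent nerve of the collage that corresponds to the inclusion
of `ℭ W` into the collage. -/
def collageUnit : W ⟶ cohNerve (Collage G) :=
  ObjectProperty.homMk
    { app c := ↾(collageUnitElt G)
      naturality c c' f := by
        ext τ
        have hob : ∀ i, obOf W (vertex W.obj (m := c'.unop.1) (x := c'.unop.2)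
            (W.obj.map f τ) i) =
            obOf W (vertex W.obj (m := c.unop.1) (x := c.unop.2) τ (f.unop.1.toOrderHom i)) :=
          fun i => (congrArg (obOf W) (vertex_map W.obj f.unop τ i)).trans (obOf_res W _ _)
        refine NerveElt.ext (c := c'.unop) (fun i => congrArg some (hob i)) ?_
        intro y g i j p a b ha hb ha' hb'
        match a, b, ha, hb, ha', hb' with
        | some a, some b, ha, hb, ha', hb' =>
        refine congrArg CollageHom.base ?_
        refine cohGen_map f.unop.1 (res W.obj (m := c.unop.1) (g ≫ f.unop.2) τ) ?_ p _ rfl rfl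
          HEq.rfl _ _ _ _
        exact (map_map W.obj f.unop (Prod.mkHom (𝟙 c'.unop.1) g) (Prod.mkHom f.unop.1
            (g ≫ f.unop.2)) (Prod.ext (Category.id_comp _) rfl) τ).trans
          (map_map W.obj (Prod.mkHom (𝟙 c.unop.1) (g ≫ f.unop.2)) (Prod.mkHom f.unop.1 (𝟙 y)) _
            (Prod.ext (Category.comp_id _) (Category.id_comp _)) τ).symm }

lemma obOf_vertex_ob (a : Coh W) : obOf W (vertex W.obj (x := Cell.pt d) (m := ⟨0⟩) a 0) = a := by
  refine obOf_of_eq_degen ?_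
  refine congrArg (fun f : ((⟨0⟩, Cell.pt d) : Shape d) ⟶ (⟨0⟩, Cell.pt d) => W.obj.map f.op a) ?_
  exact Prod.ext (SimplexCategory.isTerminalZero.hom_ext _ _) (Cell.toPt_unique _ _)

lemma nerveOb_collageUnit (a : Coh W) : nerveOb (collageUnit G).hom a = some a :=
  congrArg some (obOf_vertex_ob a)

/-- `collageUnit` corresponds to the inclusion of `ℭ W`, in the sense that it does so after
composition with an identification of objects. -/
lemma homCast_eval_collageUnit {x : Cell d} {a b : Coh W} (v : CohHom W.obj x a b)
    (ha : nerveOb (collageUnit G).hom a = (some a : Option _))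
    (hb : nerveOb (collageUnit G).hom b = (some b : Option _)) :
    homCast (E := Collage G) ha hb (v.eval (collageUnit G).hom) =
      CollageHom.base (G := G) (a := a) (b := b) v := by
  induction v using Quot.ind with | mk v => ?_
  induction v with
  | gen s =>
    refine (NerveElt.homCast_map _ _ _ _ _ _ _).trans ?_
    refine congrArg CollageHom.base ?_
    exact cohGen_congr (res_id W.obj s.simplex) rfl _ _ s.src s.tgt
  | ident a => exact homCast_eid _ _
  | @comp a b c v w h₁ h₂ =>
    refine (homCast_ecomp ha (nerveOb_collageUnit G b) hb _ _).trans ?_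
    exact congrArg₂ (ecomp (C := Collage G)) (h₁ ha (nerveOb_collageUnit G b))
      (h₂ (nerveOb_collageUnit G b) hb)

end CollageUnit

/-! ### The last face and the last degeneracy -/

/-- The dimension `m + 1` of the cone on `Δ[m]`. -/
abbrev coneDim (m : SimplexCategory) : SimplexCategory := ⟨m.len + 1⟩

/-- The face `[m] ⟶ [m + 1]` that omits the last vertex. -/
def lastδ (m : SimplexCategory) : m ⟶ coneDim m := SimplexCategory.δ (Fin.last (m.len + 1))

/-- The degeneracy `[m + 1] ⟶ [m]` that repeats the last vertex. It is used to regard the vertices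
of `[m + 1]` other than the last one as vertices of `[m]`. -/
def lastσ (m : SimplexCategory) : coneDim m ⟶ m := SimplexCategory.σ (Fin.last m.len)

lemma lastδ_apply (m : SimplexCategory) (i : Fin (m.len + 1)) :
    (lastδ m).toOrderHom i = i.castSucc := Fin.succAbove_last_apply i

lemma lastδ_ne (m : SimplexCategory) (i : Fin (m.len + 1)) :
    (lastδ m).toOrderHom i ≠ Fin.last (m.len + 1) := by
  rw [lastδ_apply]
  exact (Fin.castSucc_lt_last i).ne

lemma lastδ_comp_lastσ (m : SimplexCategory) : lastδ m ≫ lastσ m = 𝟙 m :=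
  SimplexCategory.δ_comp_σ_succ

lemma lastσ_lastδ (m : SimplexCategory) (i : Fin (m.len + 1)) :
    (lastσ m).toOrderHom ((lastδ m).toOrderHom i) = i :=
  congrArg (fun f : m ⟶ m => f.toOrderHom i) (lastδ_comp_lastσ m)

lemma lastδ_lastσ (m : SimplexCategory) {i : Fin (m.len + 1 + 1)} (hi : i ≠ Fin.last _) :
    (lastδ m).toOrderHom ((lastσ m).toOrderHom i) = i := by
  obtain ⟨j, rfl⟩ := Fin.eq_castSucc_of_ne_last hi
  rw [← lastδ_apply, lastσ_lastδ]

/-! ### Maps from the cone on an element to the nerve of a collage -/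

section ConeDatum

variable {W : Pcat.{u} d} {c : Shape d}

/-- The generator that a path of `[m + 1]`, as a path of `[m]`, defines on a restriction of an
element `σ`. It is meaningful if the target of the path is not the last vertex. -/
abbrev baseGen (σ : W.obj.obj (op c)) {y : Cell d} (g : y ⟶ c.2) {i j : Fin (c.1.len + 1 + 1)}
    (p : Thick (coneDim c.1) i j y.2) {a b : Coh W}
    (ha : vertex W.obj (res W.obj g σ) ((lastσ c.1).toOrderHom i) = degen W.obj y a)
    (hb : vertex W.obj (res W.obj g σ) ((lastσ c.1).toOrderHom j) = degen W.obj y b) :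
    Gen W.obj y a b :=
  ⟨c.1, res W.obj g σ, (lastσ c.1).toOrderHom i, (lastσ c.1).toOrderHom j,
    Thick.push (lastσ c.1) p, ha, hb⟩

/-- The data that define a map to `G` from the enriched presheaf `Hom_{ℭ W_σ}(ι_σ -, ⊤)`: elements
of the values of `G` at the vertices of `σ`, which are indexed by the paths of `[m + 1]` that end in
the last vertex, and are compatible with restriction and with the action of the paths of `[m]`. The
source of a path is regarded as a vertex of `σ` by means of `lastσ`, and the object that it gives is
a variable that comes with a proof. -/
structure ConeDatum (σ : W.obj.obj (op c)) (G : EPresheaf d (Coh W)) where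
  /-- the elements -/
  val : ∀ {y : Cell d} (g : y ⟶ c.2) {i j : Fin (c.1.len + 1 + 1)}
    (_ : Thick (coneDim c.1) i j y.2) {a : Coh W}
    (_ : vertex W.obj (res W.obj g σ) ((lastσ c.1).toOrderHom i) = degen W.obj y a)
    (_ : i ≠ Fin.last _) (_ : j = Fin.last _), (G.obj a).obj (op y)
  map_val : ∀ {y z : Cell d} (h : z ⟶ y) (g : y ⟶ c.2) {i j : Fin (c.1.len + 1 + 1)}
    (q : Thick (coneDim c.1) i j y.2) {a : Coh W}
    (ha : vertex W.obj (res W.obj g σ) ((lastσ c.1).toOrderHom i) = degen W.obj y a)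
    (ha' : vertex W.obj (res W.obj (h ≫ g) σ) ((lastσ c.1).toOrderHom i) = degen W.obj z a)
    (hi : i ≠ Fin.last _) (hj : j = Fin.last _),
    (G.obj a).map h.op (val g q ha hi hj) = val (h ≫ g) (Thick.restr h.2 q) ha' hi hj
  act_val : ∀ {y : Cell d} (g : y ⟶ c.2) {i j l : Fin (c.1.len + 1 + 1)}
    (p : Thick (coneDim c.1) i j y.2) (q : Thick (coneDim c.1) j l y.2) {a b : Coh W}
    (ha : vertex W.obj (res W.obj g σ) ((lastσ c.1).toOrderHom i) = degen W.obj y a)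
    (hb : vertex W.obj (res W.obj g σ) ((lastσ c.1).toOrderHom j) = degen W.obj y b)
    (hi : i ≠ Fin.last _) (hj : j ≠ Fin.last _) (hl : l = Fin.last _),
    val g (Thick.comp p q) ha hi hl = G.act (cohGen (baseGen σ g p ha hb)) (val g q hb hj hl)

variable (σ : W.obj.obj (op c))

/-- The objects of `coneElt`. -/
def coneOb (i : Fin (c.1.len + 1 + 1)) : Option (Coh W) :=
  if i = Fin.last _ then none
  else some (obOf W (vertex W.obj (m := c.1) σ ((lastσ c.1).toOrderHom i)))

variable {σ}

lemma coneOb_of_ne {i : Fin (c.1.len + 1 + 1)} (hi : i ≠ Fin.last _) :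
    coneOb σ i = some (obOf W (vertex W.obj (m := c.1) σ ((lastσ c.1).toOrderHom i))) :=
  if_neg hi

lemma coneOb_eq_none {i : Fin (c.1.len + 1 + 1)} (h : coneOb σ i = none) : i = Fin.last _ := by
  by_contra hi
  rw [coneOb_of_ne hi] at h
  cases h

lemma coneOb_ne_last {i : Fin (c.1.len + 1 + 1)} {a : Coh W} (h : coneOb σ i = some a) :
    i ≠ Fin.last _ := by
  rintro rfl
  rw [coneOb, if_pos rfl] at h
  cases h

lemma vertex_of_coneOb {i : Fin (c.1.len + 1 + 1)} {a : Coh W} (h : coneOb σ i = some a)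
    {y : Cell d} (g : y ⟶ c.2) :
    vertex W.obj (res W.obj g σ) ((lastσ c.1).toOrderHom i) = degen W.obj y a := by
  rw [coneOb_of_ne (coneOb_ne_last h)] at h
  exact vertex_res_of_obOf (Option.some.inj h) g

variable {G : EPresheaf d (Coh W)} (t : ConeDatum σ G)

/-- The action on paths of `coneElt`. -/
def coneMapPath {y : Cell d} (g : y ⟶ c.2) {i j : Fin (c.1.len + 1 + 1)}
    (p : Thick (coneDim c.1) i j y.2) : ∀ {a b : Option (Coh W)}
    (_ : coneOb σ i = a) (_ : coneOb σ j = b), CollageHom G (op y) a b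
  | some _, some _, ha, hb =>
    .base (cohGen (baseGen σ g p (vertex_of_coneOb ha g) (vertex_of_coneOb hb g)))
  | some _, none, ha, hb =>
    .elt (t.val g p (vertex_of_coneOb ha g) (coneOb_ne_last ha) (coneOb_eq_none hb))
  | none, none, _, _ => .top
  | none, some _, ha, hb => (coneOb_ne_last hb
      (Fin.last_le_iff.1 ((coneOb_eq_none ha).symm.trans_le p.le))).elim

/-- The element of the homotopy coherent nerve of the collage of `G`, on the cone on the shape of
`σ`, that extends `σ` by the given datum. -/
def coneElt : NerveElt (Collage G) ((cone d).obj c) where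
  obj := coneOb σ
  map g _ _ p _ _ ha hb := coneMapPath t g p ha hb
  map_restr h g i j p a b ha hb := by
    match a, b, ha, hb with
    | some a, some b, ha, hb =>
      refine congrArg CollageHom.base ((map_cohGen h _).trans ?_)
      exact cohGen_congr (res_comp W.obj h g σ).symm rfl _ _ _ _
    | some a, none, ha, hb =>
      exact congrArg CollageHom.elt (t.map_val h g p _ _ _ _)
    | none, none, ha, hb => rfl
    | none, some b, ha, hb =>
      exact (coneOb_ne_last hb
        (Fin.last_le_iff.1 ((coneOb_eq_none ha).symm.trans_le p.le))).elim
  map_ident g i a ha hb := by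
    match a, ha, hb with
    | some a, ha, hb =>
      exact congrArg CollageHom.base ((cohGen_congr rfl (Thick.push_ident _ _) _ _
        (vertex_of_coneOb ha g) (vertex_of_coneOb hb g)).trans (cohGen_ident _ _ _ _))
    | none, ha, hb => rfl
  map_comp g i j l p q a b e ha hb he := by
    match a, b, e, ha, hb, he with
    | some a, some b, some e, ha, hb, he =>
      refine congrArg CollageHom.base ?_
      refine Eq.trans ?_ (cohGen_comp _ _ _ _ _ _)
      exact cohGen_congr rfl (Thick.push_comp _ _ _) _ _ _ _
    | some a, some b, none, ha, hb, he =>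
      exact congrArg CollageHom.elt (t.act_val g p q _ _ _ _ _)
    | some a, none, none, ha, hb, he =>
      have hj := coneOb_eq_none hb
      have hl := coneOb_eq_none he
      subst hj
      subst hl
      refine congrArg CollageHom.elt ?_
      have : Thick.comp p q = p := by
        rw [Thick.eq_ident q]
        exact Thick.comp_ident p
      exact congrArg (fun r => t.val g r _ _ _) this
    | none, none, none, ha, hb, he => rfl
    | none, some b, _, ha, hb, he =>
      exact (coneOb_ne_last hb
        (Fin.last_le_iff.1 ((coneOb_eq_none ha).symm.trans_le p.le))).elim
    | _, none, some e, ha, hb, he =>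
      exact (coneOb_ne_last he
        (Fin.last_le_iff.1 ((coneOb_eq_none hb).symm.trans_le q.le))).elim

/-- The last face of `coneElt t` is the image of `σ`. -/
lemma pullback_lastFace_coneElt :
    NerveElt.pullback ((lastFace d).app c) (coneElt t) = collageUnitElt G σ := by
  have hob : ∀ i, coneOb σ ((lastδ c.1).toOrderHom i) =
      some (obOf W (vertex W.obj (m := c.1) σ i)) := by
    intro i
    rw [coneOb_of_ne (lastδ_ne _ _), lastσ_lastδ]
  refine NerveElt.ext hob ?_
  intro y g i j p a b ha hb ha' hb'
  match a, b, ha, hb, ha', hb' with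
  | some a, some b, ha, hb, ha', hb' =>
    refine congrArg CollageHom.base ?_
    refine (cohGen_map (𝟙 _) _ ?_ p _ (lastσ_lastδ _ _).symm (lastσ_lastδ _ _).symm ?_ _ _ _ _).symm
    · change res W.obj g σ = W.obj.map (𝟙 _) (res W.obj (g ≫ 𝟙 _) σ)
      rw [Functor.map_id_apply, Category.comp_id]
    · exact (Thick.push_congr (lastδ_comp_lastσ c.1).symm p).trans
        (heq_of_eq (Thick.push_push _ _ _))

end ConeDatum

/-! ### The cone on an element -/

section Cone

variable {W : Pcat.{u} d} (σ : Elts W)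

/-- The element of `W` that corresponds to `σ`. -/
def eltOf : W.obj.obj (op σ.left) := uliftYonedaEquiv σ.hom

/-- The map `F[m + 1, θ, k] ⟶ W_σ`. -/
def coneFromRep : (rep.{u} d).obj ((cone d).obj σ.left) ⟶ (coneOf σ).obj :=
  (adjL d).unit.app _ ≫ (coneInr σ).hom

/-- The element of `W_σ`, of shape `([m + 1], θ, [k])`, that extends `σ` by the vertex `⊤`. -/
def apexElt : (coneOf σ).obj.obj (op ((cone d).obj σ.left)) := uliftYonedaEquiv (coneFromRep σ)

lemma coneFromRep_app {c : Shape d} (f : c ⟶ (cone d).obj σ.left) :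
    (coneFromRep σ).app (op c) ⟨f⟩ = (coneOf σ).obj.map f.op (apexElt σ) := by
  refine Eq.trans ?_ (NatTrans.naturality_apply (coneFromRep σ) f.op ⟨𝟙 _⟩)
  exact congrArg (fun g => (coneFromRep σ).app (op c) (ULift.up g)) (Category.comp_id f).symm

lemma unit_adjunct : (adjL d).unit.app _ ≫ (adjunct σ).hom = σ.hom :=
  ((adjL d).homEquiv_unit (f := adjunct σ)).symm.trans (Equiv.apply_symm_apply _ _)

lemma hom_comp_coneInl :
    σ.hom ≫ (coneInl σ).hom = (rep d).map ((lastFace d).app σ.left) ≫ coneFromRep σ := by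
  have h : adjunct σ ≫ coneInl σ = incl σ.left ≫ coneInr σ := pushout.condition
  have h' := congrArg (fun α => (adjL d).unit.app _ ≫ α.hom) h
  refine Eq.trans ?_ (h'.trans ?_)
  · exact (congrArg (· ≫ (coneInl σ).hom) (unit_adjunct σ).symm).trans (Category.assoc _ _ _)
  · refine Eq.trans ?_ (Category.assoc _ _ _)
    refine (Category.assoc _ _ _).symm.trans (congrArg (· ≫ (coneInr σ).hom) ?_)
    exact ((adjL d).unit.naturality ((rep d).map ((lastFace d).app σ.left))).symm

/-- The last face of `apexElt σ` is the image of `σ`. -/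
lemma map_lastFace_apexElt :
    (coneOf σ).obj.map ((lastFace d).app σ.left).op (apexElt σ) =
      (coneInl σ).hom.app _ (eltOf σ) := by
  refine (coneFromRep_app σ _).symm.trans ?_
  have := congrArg (fun α => α.app (op σ.left) ⟨𝟙 _⟩) (hom_comp_coneInl σ)
  refine Eq.trans ?_ this.symm
  exact congrArg (fun g => (coneFromRep σ).app (op σ.left) (ULift.up g)) (Category.id_comp _).symm

lemma top_eq : top σ = obOf (coneOf σ) (vertex (coneOf σ).obj (m := coneDim σ.left.1)
    (x := σ.left.2) (apexElt σ) (Fin.last _)) :=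
  congrArg (obOf (coneOf σ)) (coneFromRep_app σ (c := (⟨0⟩, σ.left.2)) _)

variable {σ} {y : Cell d}

lemma vertex_apexElt_last (g : y ⟶ σ.left.2) {j : Fin (σ.left.1.len + 1 + 1)}
    (hj : j = Fin.last _) :
    vertex (coneOf σ).obj (m := coneDim σ.left.1) (res _ g (apexElt σ)) j =
      degen (coneOf σ).obj y (top σ) := by
  subst hj
  exact vertex_res_of_obOf (top_eq σ).symm g

lemma map_lastδ_res_apexElt (g : y ⟶ σ.left.2) :
    (coneOf σ).obj.map (Prod.mkHom (lastδ σ.left.1) (𝟙 y)).op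
        (res _ (m := coneDim σ.left.1) g (apexElt σ)) =
      (coneInl σ).hom.app _ (res W.obj (m := σ.left.1) g (eltOf σ)) := by
  refine (res_map (coneOf σ).obj g (lastδ σ.left.1) (apexElt σ)).symm.trans ?_
  exact (congrArg (res _ g) (map_lastFace_apexElt σ)).trans
    (NatTrans.naturality_apply (coneInl σ).hom (Prod.mkHom (𝟙 σ.left.1) g).op (eltOf σ)).symm

lemma vertex_apexElt_of_ne (g : y ⟶ σ.left.2) {i : Fin (σ.left.1.len + 1 + 1)}
    (hi : i ≠ Fin.last _) :
    vertex (coneOf σ).obj (m := coneDim σ.left.1) (res _ g (apexElt σ)) i =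
      (coneInl σ).hom.app _ (vertex W.obj (res W.obj (m := σ.left.1) g (eltOf σ))
        ((lastσ σ.left.1).toOrderHom i)) := by
  rw [app_vertex, ← map_lastδ_res_apexElt]
  refine Eq.trans ?_ (vertex_map (coneOf σ).obj (c' := (σ.left.1, y))
    (Prod.mkHom (lastδ σ.left.1) (𝟙 y)) _ _).symm
  refine Eq.trans ?_ (res_id _ _).symm
  exact congrArg _ (lastδ_lastσ _ hi).symm

lemma vertex_apexElt_degen (g : y ⟶ σ.left.2) {i : Fin (σ.left.1.len + 1 + 1)} {a : Coh W}
    (hi : i ≠ Fin.last _)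
    (ha : vertex W.obj (res W.obj (m := σ.left.1) g (eltOf σ)) ((lastσ σ.left.1).toOrderHom i) =
      degen W.obj y a) :
    vertex (coneOf σ).obj (m := coneDim σ.left.1) (res _ g (apexElt σ)) i =
      degen (coneOf σ).obj y ((cohMap (coneInl σ)).obj a) :=
  (vertex_apexElt_of_ne g hi).trans ((congrArg _ ha).trans (app_degen _ _ _))

/-- A path of `[m + 1]` between vertices other than the last one defines the same morphism of
`ℭ W_σ` as the corresponding path of `[m]`. -/
lemma cohGen_apexElt (g : y ⟶ σ.left.2) {i j : Fin (σ.left.1.len + 1 + 1)}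
    (p : Thick (coneDim σ.left.1) i j y.2) {a b : Coh W} (hi : i ≠ Fin.last _)
    (hj : j ≠ Fin.last _)
    (ha : vertex W.obj (res W.obj (m := σ.left.1) g (eltOf σ)) ((lastσ σ.left.1).toOrderHom i) =
      degen W.obj y a)
    (hb : vertex W.obj (res W.obj (m := σ.left.1) g (eltOf σ)) ((lastσ σ.left.1).toOrderHom j) =
      degen W.obj y b) :
    emap (cohMap (coneInl σ)) (cohGen (baseGen (eltOf σ) g p ha hb)) =
      cohGen (W := coneOf σ) (a := (cohMap (coneInl σ)).obj a) (b := (cohMap (coneInl σ)).obj b)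
        ⟨coneDim σ.left.1, res _ g (apexElt σ), i, j, p, vertex_apexElt_degen g hi ha,
        vertex_apexElt_degen g hj hb⟩ := by
  refine (emap_cohGen _ _).trans ?_
  refine cohGen_map (lastδ σ.left.1) _ (map_lastδ_res_apexElt g).symm _ _ (lastδ_lastσ _ hi)
    (lastδ_lastσ _ hj) ?_ _ _ _ _
  refine (heq_of_eq (Thick.push_push _ _ _).symm).trans (Thick.push_heq _ ?_ p)
  intro l hl
  refine lastδ_lastσ _ ?_
  rintro rfl
  exact hj (Fin.last_le_iff.1 hl)

variable (σ)

/-- The universal datum: the morphisms of `ℭ W_σ` to `⊤` that are given by the paths of `[m + 1]` to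
the last vertex. -/
def univDatum : ConeDatum (eltOf σ) (stObj σ) where
  val g i j q a ha hi hj := cohGen (W := coneOf σ) (a := (cohMap (coneInl σ)).obj a) (b := top σ)
    ⟨coneDim σ.left.1, res _ g (apexElt σ), i, j, q, vertex_apexElt_degen g hi ha,
      vertex_apexElt_last g hj⟩
  map_val h g i j q a ha ha' hi hj := by
    refine (map_cohGen (W := coneOf σ) h _).trans ?_
    exact cohGen_congr (res_comp (coneOf σ).obj h g (apexElt σ)).symm rfl _ _ _ _
  act_val g i j l p q a b ha hb hi hj hl := by
    refine (cohGen_comp (W := coneOf σ) _ p q _ (vertex_apexElt_degen g hj hb) _).trans ?_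
    exact congrArg (fun z => ecomp z _) (cohGen_apexElt g p hi hj ha hb).symm

end Cone

/-! ### Morphisms out of `St_W(σ)` -/

section Desc

variable {W : Pcat.{u} d} {σ : Elts W} {G : EPresheaf d (Coh W)} (t : ConeDatum (eltOf σ) G)

/-- The map `F[m + 1, θ, k] ⟶ N(Collage G)` that is given by a datum. -/
def coneEltHom : (rep.{u} d).obj ((cone d).obj σ.left) ⟶ cohNerveObj (Collage G) :=
  uliftYonedaEquiv.symm (coneElt t)

lemma hom_comp_collageUnit :
    σ.hom ≫ (collageUnit G).hom = (rep d).map ((lastFace d).app σ.left) ≫ coneEltHom t := by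
  apply uliftYonedaEquiv.injective
  refine (pullback_lastFace_coneElt t).symm.trans ?_
  exact congrArg (fun f => NerveElt.pullback f (coneElt t)) (Category.id_comp _).symm

/-- The map from `W_σ` to the homotopy coherent nerve of the collage of `G` that extends the
inclusion of `W` by the given datum. -/
def collageDesc : coneOf σ ⟶ cohNerve (Collage G) :=
  pushout.desc (collageUnit G)
    (((adjL d).homEquiv _ (cohNerve (Collage G))).symm (coneEltHom t)) (by
    apply ((adjL d).homEquiv _ _).injective
    refine ((adjL d).homEquiv_naturality_right _ _).trans (Eq.trans ?_
      ((adjL d).homEquiv_naturality_left _ _).symm)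
    refine (congrArg (· ≫ (collageUnit G).hom) (Equiv.apply_symm_apply _ _)).trans ?_
    refine (hom_comp_collageUnit t).trans ?_
    exact congrArg ((rep d).map ((lastFace d).app σ.left) ≫ ·) (Equiv.apply_symm_apply _ _).symm)

lemma coneInl_collageDesc : coneInl σ ≫ collageDesc t = collageUnit G := pushout.inl_desc _ _ _

lemma coneFromRep_collageDesc : coneFromRep σ ≫ (collageDesc t).hom = coneEltHom t := by
  have h : coneInr σ ≫ collageDesc t = ((adjL d).homEquiv _ (cohNerve (Collage G))).symm
    (coneEltHom t) := pushout.inr_desc _ _ _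
  refine (Category.assoc _ _ _).trans ?_
  refine (congrArg (fun α => (adjL d).unit.app _ ≫ α.hom) h).trans ?_
  exact ((adjL d).homEquiv_unit _ (cohNerve (Collage G)) _).symm.trans (Equiv.apply_symm_apply _ _)

lemma collageDesc_apexElt : (collageDesc t).hom.app _ (apexElt σ) = coneElt t := by
  refine (congrArg (fun α => α.app _ ⟨𝟙 _⟩) (coneFromRep_collageDesc t)).trans ?_
  exact (uliftYonedaEquiv (F := cohNerveObj (Collage G))).apply_symm_apply (coneElt t)

lemma nerveOb_collageDesc_coneInl (a : Coh W) :
    nerveOb (collageDesc t).hom ((coneInl σ).hom.app _ a) = (some a : Option (Coh W)) :=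
  (congrArg (fun α : W ⟶ cohNerve (Collage G) => nerveOb α.hom a) (coneInl_collageDesc t)).trans
    (nerveOb_collageUnit G a)

lemma nerveOb_collageDesc_top :
    nerveOb (collageDesc t).hom (top σ) = (none : Option (Coh W)) := by
  refine (obj_eq_nerveOb (collageDesc t).hom
    (vertex_apexElt_last (𝟙 σ.left.2) rfl)).symm.trans ?_
  refine (obj_app_map (collageDesc t).hom (Prod.mkHom (𝟙 (coneDim σ.left.1)) (𝟙 σ.left.2))
    (apexElt σ) (Fin.last _)).trans ?_
  refine (congrArg (fun s : NerveElt (Collage G) ((cone d).obj σ.left) => s.obj (Fin.last _))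
    (collageDesc_apexElt t)).trans ?_
  exact if_pos rfl

lemma eval_map {X Y : SimplicialThetaSpace.{u} d} {E : Type u}
    [EnrichedCategory (ThetaSpace.{u} d) E] (f : X ⟶ Y) (m : Y ⟶ cohNerveObj E) {x : Cell d}
    {a b : Ob X} (v : CohHom X x a b) :
    (v.map f).eval m = v.eval (f ≫ m) := by
  induction v using Quot.ind with | mk v => ?_
  induction v with
  | gen s => rfl
  | ident a => rfl
  | comp v w h₁ h₂ => exact congrArg₂ ecomp h₁ h₂

/-- The functor from `ℭ W_σ` to the collage restricts to the inclusion of `ℭ W`. -/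
lemma homCast_eval_collageDesc {x : Cell d} {a b : Coh W} (v : CohHom W.obj x a b) :
    homCast (E := Collage G) (nerveOb_collageDesc_coneInl t a) (nerveOb_collageDesc_coneInl t b)
      ((v.map (coneInl σ).hom).eval (collageDesc t).hom) =
      CollageHom.base (G := G) (a := a) (b := b) v := by
  refine (congrArg (homCast (E := Collage G) _ _)
    (eval_map (coneInl σ).hom (collageDesc t).hom v)).trans ?_
  have key : ∀ k : W ⟶ cohNerve (Collage G), k = collageUnit G →
      ∀ (ha : nerveOb k.hom a = (some a : Option _)) (hb : nerveOb k.hom b = (some b : Option _)),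
      homCast (E := Collage G) ha hb (v.eval k.hom) =
        CollageHom.base (G := G) (a := a) (b := b) v := by
    rintro _ rfl ha hb
    exact homCast_eval_collageUnit G v ha hb
  exact key _ (coneInl_collageDesc t) _ _

/-- The morphism to the new object of the collage that corresponds to a morphism of `ℭ W_σ` to
`⊤`. -/
def descApp {x : Cell d} {a : Coh W}
    (v : CohHom (coneOf σ).obj x ((coneInl σ).hom.app _ a) (top σ)) :
    CollageHom G (op x) (some a) none :=
  homCast (E := Collage G) (nerveOb_collageDesc_coneInl t a) (nerveOb_collageDesc_top t)
    (v.eval (collageDesc t).hom)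

lemma toElt_map {x y : (Cell d)ᵒᵖ} (g : x ⟶ y) {a : Coh W} (v : CollageHom G x (some a) none) :
    (v.map g).toElt = (G.obj a).map g v.toElt := by
  cases v; rfl

lemma toElt_base_comp {x : (Cell d)ᵒᵖ} {a b : Coh W}
    (f : (a ⟶[ThetaSpace.{u} d] b).obj x) (v : CollageHom G x (some b) none) :
    ((CollageHom.base f).comp v).toElt = G.act f v.toElt := by
  cases v; rfl

/-- The map from `St_W(σ)` to `G` that is given by a datum. -/
def stDesc : stObj σ ⟶ G where
  app a :=
    { app x := ↾(fun v : CohHom (coneOf σ).obj x.unop ((coneInl σ).hom.app _ a) (top σ) =>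
        (descApp t v).toElt)
      naturality x y g := by
        ext v
        refine Eq.trans ?_ (toElt_map g _)
        refine congrArg CollageHom.toElt ?_
        refine Eq.trans ?_ (map_homCast (E := Collage G) _ _ _ g).symm
        exact congrArg (homCast (E := Collage G) _ _)
          (CohHom.eval_restr (collageDesc t).hom g.unop v) }
  app_act {a b x} f s := by
    refine Eq.trans ?_ (toElt_base_comp f _)
    refine congrArg CollageHom.toElt ?_
    refine Eq.trans (congrArg (homCast (E := Collage G) _ _)
      (CohHom.eval_comp (collageDesc t).hom (CohHom.map (coneInl σ).hom f) s)) ?_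
    refine (homCast_ecomp (E := Collage G) _ (nerveOb_collageDesc_coneInl t b) _ _ _).trans ?_
    exact congrArg (fun z => ecomp (C := Collage G) z _) (homCast_eval_collageDesc t f)

lemma stDesc_univDatum {y : Cell d} (g : y ⟶ σ.left.2) {i j : Fin (σ.left.1.len + 1 + 1)}
    (q : Thick (coneDim σ.left.1) i j y.2) {a : Coh W}
    (ha : vertex W.obj (res W.obj (m := σ.left.1) g (eltOf σ)) ((lastσ σ.left.1).toOrderHom i) =
      degen W.obj y a)
    (hi : i ≠ Fin.last _) (hj : j = Fin.last _) :
    ((stDesc t).app a).app (op y) ((univDatum σ).val g q ha hi hj) = t.val g q ha hi hj := by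
  refine (congrArg CollageHom.toElt ((NerveElt.homCast_map (E := Collage G) _ _ _ _ _ _ _).trans
    (map_app_map (collageDesc t).hom (Prod.mkHom (𝟙 (coneDim σ.left.1)) g) (apexElt σ)
      (𝟙 y) q _ _))).trans ?_
  have key : ∀ (s : NerveElt (Collage G) ((cone d).obj σ.left)) (_ : s = coneElt t)
      (h : y ⟶ σ.left.2) (_ : h = g) (q' : Thick (coneDim σ.left.1) i j y.2) (_ : q' = q)
      (h₁ : s.obj i = (some a : Option (Coh W))) (h₂ : s.obj j = (none : Option (Coh W))),
      (show CollageHom G (op y) (some a) none from s.map h q' h₁ h₂).toElt =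
        t.val g q ha hi hj := by
    rintro _ rfl _ rfl _ rfl h₁ h₂
    rfl
  exact key _ (collageDesc_apexElt t) _ (Category.id_comp g) _ (Thick.push_id q) _ _

end Desc

/-! ### The morphisms of the categorification of a cone -/

section Generation

lemma isDiscrete_of_bijective {X : ThetaSpace.{u} d}
    (h : ∀ x : Cell d, Function.Bijective (X.map x.toPt.op)) : IsDiscrete X :=
  ⟨X.obj (op (Cell.pt d)), ⟨NatIso.ofComponents
    (fun x => (Equiv.ofBijective _ (h x.unop)).toIso) (by
      intro x y f
      ext s
      change X.map y.unop.toPt.op s = X.map f (X.map x.unop.toPt.op s)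
      rw [← Functor.map_comp_apply]
      exact congrArg (fun g : y.unop ⟶ Cell.pt d => X.map g.op s) (Cell.toPt_unique _ _))⟩⟩

lemma isPrecat_subfunctor (Y : Pcat.{u} d) (S : Subfunctor Y.obj) : isPrecat d S.toFunctor := by
  refine isDiscrete_of_bijective fun x => ⟨fun s t h => ?_, fun s => ?_⟩
  · exact Subtype.ext (degen_injective Y x (congrArg Subtype.val h))
  · exact ⟨⟨obOf Y s.1, S.map _ s.2⟩, Subtype.ext (degen_obOf Y s.1)⟩

variable {W : Pcat.{u} d} (σ : Elts W)

/-- Every element of `W_σ` comes from `W` or is a restriction of the new simplex. -/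
lemma coneOf_exists {c : Shape d} (z : (coneOf σ).obj.obj (op c)) :
    (∃ w, z = (coneInl σ).hom.app _ w) ∨
      ∃ f : c ⟶ (cone d).obj σ.left, z = (coneOf σ).obj.map f.op (apexElt σ) := by
  let S : Subfunctor (coneOf σ).obj :=
    Subfunctor.range (coneInl σ).hom ⊔ Subfunctor.range (coneFromRep σ)
  -- a subobject of a precategory is again one, so the two maps to `S` factor through the pushout
  let S' : Pcat.{u} d := ⟨S.toFunctor, isPrecat_subfunctor _ S⟩
  let p : W ⟶ S' := ObjectProperty.homMk (Subfunctor.lift (coneInl σ).hom le_sup_left)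
  let q : (rep d).obj ((cone d).obj σ.left) ⟶ S'.obj :=
    Subfunctor.lift (coneFromRep σ) le_sup_right
  let q' : (L d).obj ((rep d).obj ((cone d).obj σ.left)) ⟶ S' := ((adjL d).homEquiv _ S').symm q
  let r : S' ⟶ coneOf σ := ObjectProperty.homMk S.ι
  have hq : q' ≫ r = coneInr σ := by
    apply ((adjL d).homEquiv _ _).injective
    refine ((adjL d).homEquiv_naturality_right _ _).trans ?_
    refine (congrArg (· ≫ r.hom) (Equiv.apply_symm_apply _ _)).trans ?_
    exact ((adjL d).homEquiv_unit _ _ _).symm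
  have hr : Mono r := ⟨fun {T} α β h => by
    apply ObjectProperty.hom_ext
    ext c s
    exact Subtype.ext (congrArg (fun γ => γ.hom.app c s) h)⟩
  have hpq : adjunct σ ≫ p = incl σ.left ≫ q' := by
    rw [← cancel_mono r]
    refine (Category.assoc _ _ _).trans ?_
    refine Eq.trans ?_ (Category.assoc _ _ _).symm
    rw [hq]
    exact pushout.condition
  have h : pushout.desc p q' hpq ≫ r = 𝟙 (coneOf σ) := by
    apply pushout.hom_ext
    · refine (Category.assoc _ _ _).symm.trans ?_
      rw [pushout.inl_desc]
      exact (Category.comp_id _).symm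
    · refine (Category.assoc _ _ _).symm.trans ?_
      rw [pushout.inr_desc]
      exact hq.trans (Category.comp_id _).symm
  have hz : z ∈ S.obj (op c) := by
    have e : z = S.ι.app _ ((pushout.desc p q' hpq).hom.app _ z) :=
      congrArg (fun γ => γ.hom.app (op c) z) h.symm
    rw [e]
    exact Subtype.property _
  rcases hz with ⟨w, hw⟩ | ⟨⟨f⟩, hf⟩
  · exact Or.inl ⟨w, hw.symm⟩
  · exact Or.inr ⟨f, hf.symm.trans (coneFromRep_app σ f)⟩

variable {σ}

lemma coneInl_injective : Function.Injective (cohMap (coneInl σ)).obj := fun a b h =>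
  Option.some.inj ((nerveOb_collageDesc_coneInl (univDatum σ) a).symm.trans
    ((congrArg (nerveOb (collageDesc (univDatum σ)).hom) h).trans
      (nerveOb_collageDesc_coneInl (univDatum σ) b)))

lemma coneInl_ne_top (a : Coh W) : (cohMap (coneInl σ)).obj a ≠ top σ := fun h =>
  Option.some_ne_none a ((nerveOb_collageDesc_coneInl (univDatum σ) a).symm.trans
    ((congrArg (nerveOb (collageDesc (univDatum σ)).hom) h).trans
      (nerveOb_collageDesc_top (univDatum σ))))

variable (σ) in
/-- The morphisms of `ℭ W_σ` that are morphisms of `ℭ W`, composites of a morphism of `ℭ W` and a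
path to `⊤`, or the identity of `⊤`. -/
inductive IsConeHom {y : Cell d} : ∀ {a b : Coh (coneOf σ)},
    (a ⟶[ThetaSpace.{u} d] b).obj (op y) → Prop
  | base {a b : Coh W} (f : (a ⟶[ThetaSpace.{u} d] b).obj (op y)) :
      IsConeHom (emap (cohMap (coneInl σ)) f)
  | univ {a b : Coh W} (f : (a ⟶[ThetaSpace.{u} d] b).obj (op y)) (g : y ⟶ σ.left.2)
      {i j : Fin (σ.left.1.len + 1 + 1)} (q : Thick (coneDim σ.left.1) i j y.2)
      (hb : vertex W.obj (res W.obj (m := σ.left.1) g (eltOf σ)) ((lastσ σ.left.1).toOrderHom i) =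
        degen W.obj y b) (hi : i ≠ Fin.last _) (hj : j = Fin.last _) :
      IsConeHom (ecomp (C := Coh (coneOf σ)) (c := top σ) (emap (cohMap (coneInl σ)) f)
        ((univDatum σ).val g q hb hi hj))
  | ident : IsConeHom (eid (top σ) (op y))

namespace IsConeHom

variable {y : Cell d}

lemma of_eq {a b : Coh (coneOf σ)} {v w : (a ⟶[ThetaSpace.{u} d] b).obj (op y)}
    (hv : IsConeHom σ v) (h : v = w) : IsConeHom σ w := h ▸ hv

/-- The source of `w` is a variable `b'`, so that case analysis on `hw` is possible. -/
lemma base_comp {a b : Coh W} (f : (a ⟶[ThetaSpace.{u} d] b).obj (op y)) {b' c : Coh (coneOf σ)}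
    {w : (b' ⟶[ThetaSpace.{u} d] c).obj (op y)} (hw : IsConeHom σ w)
    (h : b' = (cohMap (coneInl σ)).obj b) :
    IsConeHom σ (ecomp (emap (cohMap (coneInl σ)) f) (homCast h rfl w)) := by
  cases hw with
  | base f' =>
    obtain rfl := coneInl_injective h
    exact (IsConeHom.base (ecomp f f')).of_eq (EPresheaf.emap_ecomp _ f f')
  | univ f' g q hb hi hj =>
    obtain rfl := coneInl_injective h
    exact (IsConeHom.univ (ecomp f f') g q hb hi hj).of_eq
      ((congrArg (fun z => ecomp z _) (EPresheaf.emap_ecomp _ f f')).trans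
        (EPresheaf.ecomp_assoc _ _ _))
  | ident => exact (coneInl_ne_top b h.symm).elim

lemma comp_of_top {a : Coh (coneOf σ)} {v : (a ⟶[ThetaSpace.{u} d] top σ).obj (op y)}
    (hv : IsConeHom σ v) {b' c : Coh (coneOf σ)} {w : (b' ⟶[ThetaSpace.{u} d] c).obj (op y)}
    (hw : IsConeHom σ w) (h : b' = top σ) : IsConeHom σ (ecomp v (homCast h rfl w)) := by
  cases hw with
  | base f' => exact (coneInl_ne_top _ h).elim
  | univ f' g q hb hi hj => exact (coneInl_ne_top _ h).elim
  | ident =>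
    change IsConeHom σ (ecomp v (eid (top σ) (op y)))
    rwa [EPresheaf.ecomp_eid]

lemma comp {a b c : Coh (coneOf σ)} {v : (a ⟶[ThetaSpace.{u} d] b).obj (op y)}
    {w : (b ⟶[ThetaSpace.{u} d] c).obj (op y)} (hv : IsConeHom σ v) (hw : IsConeHom σ w) :
    IsConeHom σ (ecomp v w) := by
  cases hv with
  | base f => exact base_comp f hw rfl
  | univ f g q hb hi hj => exact comp_of_top (.univ f g q hb hi hj) hw rfl
  | ident => exact comp_of_top .ident hw rfl

lemma cohGen_res_apexElt (g : y ⟶ σ.left.2) {i j : Fin (σ.left.1.len + 1 + 1)}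
    (p : Thick (coneDim σ.left.1) i j y.2) {a b : Coh (coneOf σ)}
    (ha : vertex (coneOf σ).obj (res _ g (apexElt σ)) i = degen (coneOf σ).obj y a)
    (hb : vertex (coneOf σ).obj (res _ g (apexElt σ)) j = degen (coneOf σ).obj y b) :
    IsConeHom σ (cohGen ⟨coneDim σ.left.1, res _ g (apexElt σ), i, j, p, ha, hb⟩) := by
  have hne : ∀ {i : Fin (σ.left.1.len + 1 + 1)} {a : Coh (coneOf σ)} (_ : i ≠ Fin.last _)
      (_ : vertex (coneOf σ).obj (m := coneDim σ.left.1) (res _ g (apexElt σ)) i =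
        degen (coneOf σ).obj y a),
      ∃ a', a = (cohMap (coneInl σ)).obj a' ∧ vertex W.obj (res W.obj (m := σ.left.1) g (eltOf σ))
        ((lastσ σ.left.1).toOrderHom i) = degen W.obj y a' := by
    intro i a hi h
    refine ⟨obOf W _, degen_injective _ _ (h.symm.trans ?_), (degen_obOf W _).symm⟩
    exact vertex_apexElt_degen g hi (degen_obOf W _).symm
  by_cases hj : j = Fin.last _
  · obtain rfl : b = top σ :=
      degen_injective _ _ (hb.symm.trans (vertex_apexElt_last g hj))
    by_cases hi : i = Fin.last _
    · obtain rfl : a = top σ :=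
        degen_injective _ _ (ha.symm.trans (vertex_apexElt_last g hi))
      subst hi hj
      rw [Thick.eq_ident p, cohGen_ident]
      exact .ident
    · obtain ⟨a', rfl, ha'⟩ := hne hi ha
      exact (IsConeHom.univ (eid a' (op y)) g p ha' hi hj).of_eq
        ((congrArg (fun z => ecomp z _) (EPresheaf.emap_eid _ a' (op y))).trans
          (EPresheaf.eid_ecomp _))
  · have hi : i ≠ Fin.last _ := by
      rintro rfl
      exact hj (Fin.last_le_iff.1 p.le)
    obtain ⟨a', rfl, ha'⟩ := hne hi ha
    obtain ⟨b', rfl, hb'⟩ := hne hj hb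
    rw [← cohGen_apexElt g p hi hj ha' hb']
    exact .base _

lemma cohGen {a b : Coh (coneOf σ)} (s : Gen (coneOf σ).obj y a b) : IsConeHom σ (cohGen s) := by
  obtain ⟨n, τ, i, j, p, ha, hb⟩ := s
  obtain ⟨w, rfl⟩ | ⟨f, rfl⟩ := coneOf_exists σ τ
  · have h : ∀ {i : Fin (n.len + 1)} {a : Coh (coneOf σ)}
        (_ : vertex (coneOf σ).obj ((coneInl σ).hom.app _ w) i = degen (coneOf σ).obj y a),
        a = (cohMap (coneInl σ)).obj (obOf W (vertex W.obj w i)) := by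
      intro i a h
      refine degen_injective (coneOf σ) y (h.symm.trans ?_)
      exact (app_vertex _ _ _).symm.trans
        ((congrArg _ (degen_obOf W (vertex W.obj w i)).symm).trans (app_degen _ _ _))
    obtain rfl := h ha
    obtain rfl := h hb
    exact .base (ThetaSpaces.cohGen ⟨n, w, i, j, p, (degen_obOf W _).symm, (degen_obOf W _).symm⟩)
  · have e : (coneOf σ).obj.map f.op (apexElt σ) = (coneOf σ).obj.map
        (Prod.mkHom f.1 (𝟙 y)).op (res _ (m := coneDim σ.left.1) f.2 (apexElt σ)) :=
      (map_map (coneOf σ).obj (Prod.mkHom (𝟙 (coneDim σ.left.1)) f.2) (Prod.mkHom f.1 (𝟙 y)) f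
        (Prod.ext (Category.comp_id _) (Category.id_comp _)) (apexElt σ)).symm
    have h : ∀ i, vertex (coneOf σ).obj (m := n) ((coneOf σ).obj.map f.op (apexElt σ)) i =
        vertex (coneOf σ).obj (res _ (m := coneDim σ.left.1) f.2 (apexElt σ))
          (f.1.toOrderHom i) := fun i =>
      (vertex_map (coneOf σ).obj f (apexElt σ) i).trans (res_vertex _ _ _ _).symm
    rw [cohGen_map f.1 (res _ (m := coneDim σ.left.1) f.2 (apexElt σ)) e p (Thick.push f.1 p) rfl
      rfl HEq.rfl ha hb ((h i).symm.trans ha) ((h j).symm.trans hb)]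
    exact cohGen_res_apexElt _ _ _ _

end IsConeHom

/-- No morphism of `ℭ W_σ` leads from `⊤` to an object of `ℭ W`, and every morphism from an object
of `ℭ W` to `⊤` is a composite of a morphism of `ℭ W` and a single path to `⊤`. This holds because
the generators are of this form, and the form is stable under composition. -/
lemma isConeHom {y : Cell d} {a b : Coh (coneOf σ)}
    (v : (a ⟶[ThetaSpace.{u} d] b).obj (op y)) : IsConeHom σ v := by
  obtain ⟨v, rfl⟩ : ∃ v' : Word (coneOf σ).obj y a b, (show CohHom _ y a b from Quot.mk _ v') = v :=
    Quot.exists_rep v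
  induction v with
  | gen s => exact IsConeHom.cohGen s
  | ident a =>
    have h : vertex (coneOf σ).obj (m := ⟨0⟩) (degen (coneOf σ).obj y a) 0 =
        degen (coneOf σ).obj y a := by
      refine Eq.trans ?_ ((coneOf σ).obj.map_id_apply _ _)
      exact congrArg (fun f : ((⟨0⟩, y) : Shape d) ⟶ (⟨0⟩, y) => (coneOf σ).obj.map f.op _)
        (Prod.ext (SimplexCategory.isTerminalZero.hom_ext _ _) rfl)
    exact (IsConeHom.cohGen (σ := σ) (a := a) (b := a)
      ⟨⟨0⟩, degen (coneOf σ).obj y a, 0, 0, Thick.ident ⟨0⟩ 0 y.2, h, h⟩).of_eq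
        (cohGen_ident (W := coneOf σ) (a := a) _ _ _ _)
  | comp v w h₁ h₂ => exact IsConeHom.comp h₁ h₂

/-- Morphisms out of `St_W(σ)` are determined by the images of the paths to `⊤`. -/
lemma stObj_hom_ext {G : EPresheaf d (Coh W)} {α β : stObj σ ⟶ G}
    (h : ∀ {y : Cell d} (g : y ⟶ σ.left.2) {i j : Fin (σ.left.1.len + 1 + 1)}
      (q : Thick (coneDim σ.left.1) i j y.2) {a : Coh W}
      (ha : vertex W.obj (res W.obj (m := σ.left.1) g (eltOf σ))
        ((lastσ σ.left.1).toOrderHom i) = degen W.obj y a) (hi : i ≠ Fin.last _)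
      (hj : j = Fin.last _), (α.app a).app (op y) ((univDatum σ).val g q ha hi hj) =
        (β.app a).app (op y) ((univDatum σ).val g q ha hi hj)) : α = β := by
  -- the source and the target are generalized, so that case analysis on `IsConeHom` is possible
  have key : ∀ {y : Cell d} {a' b' : Coh (coneOf σ)} (v : (a' ⟶[ThetaSpace.{u} d] b').obj (op y))
      (_ : IsConeHom σ v) {a : Coh W} (ha : a' = (cohMap (coneInl σ)).obj a) (hb : b' = top σ),
      (α.app a).app (op y) (homCast ha hb v) = (β.app a).app (op y) (homCast ha hb v) := by
    intro y a' b' v hv a ha hb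
    cases hv with
    | base f => exact (coneInl_ne_top _ hb).elim
    | univ f g q hb' hi hj =>
      obtain rfl := coneInl_injective ha
      refine (α.app_act f _).trans (Eq.trans ?_ (β.app_act f _).symm)
      exact congrArg (G.act f) (h g q hb' hi hj)
    | ident => exact (coneInl_ne_top _ ha.symm).elim
  ext a x s
  exact key (y := x.unop) (a' := (cohMap (coneInl σ)).obj a) s (isConeHom _) rfl rfl

end Generation

/-! ### Change of the base precategory -/

section BaseChange

variable {W Z : Pcat.{u} d} (f : W ⟶ Z)

namespace ConeDatum

/-- The image of a datum under a map of enriched presheaves. -/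
def postcomp {c : Shape d} {σ : W.obj.obj (op c)} {G H : EPresheaf d (Coh W)}
    (t : ConeDatum σ G) (α : G ⟶ H) : ConeDatum σ H where
  val g _ _ q a ha hi hj := (α.app a).app _ (t.val g q ha hi hj)
  map_val h g _ _ q a ha ha' hi hj := (NatTrans.naturality_apply (α.app a) h.op _).symm.trans
    (congrArg ((α.app a).app _) (t.map_val h g q ha ha' hi hj))
  act_val g _ _ _ p q a _ ha hb hi hj hl :=
    (congrArg ((α.app a).app _) (t.act_val g p q ha hb hi hj hl)).trans (α.app_act _ _)

variable {c : Shape d} {σ : W.obj.obj (op c)} {G : EPresheaf d (Coh Z)}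

lemma res_app {y : Cell d} (g : y ⟶ c.2) :
    res Z.obj (m := c.1) g (f.hom.app _ σ) = f.hom.app _ (res W.obj (m := c.1) g σ) :=
  (NatTrans.naturality_apply f.hom (Prod.mkHom (𝟙 c.1) g).op σ).symm

lemma vertex_res_app {y : Cell d} (g : y ⟶ c.2) {i : Fin (c.1.len + 1)} :
    vertex Z.obj (res Z.obj (m := c.1) g (f.hom.app _ σ)) i =
      f.hom.app _ (vertex W.obj (res W.obj (m := c.1) g σ) i) :=
  (congrArg (fun τ => vertex Z.obj τ i) (res_app f g)).trans (app_vertex f.hom _ _).symm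

lemma vertex_res_app_of {y : Cell d} (g : y ⟶ c.2) {i : Fin (c.1.len + 1)} {a : Coh W}
    (ha : vertex W.obj (res W.obj (m := c.1) g σ) i = degen W.obj y a) :
    vertex Z.obj (res Z.obj (m := c.1) g (f.hom.app _ σ)) i =
      degen Z.obj y ((cohMap f).obj a) :=
  (vertex_res_app f g).trans ((congrArg _ ha).trans (app_degen f.hom _ _))

lemma app_obOf_vertex {y : Cell d} (g : y ⟶ c.2) {i : Fin (c.1.len + 1)} {b : Coh Z}
    (hb : vertex Z.obj (res Z.obj (m := c.1) g (f.hom.app _ σ)) i = degen Z.obj y b) :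
    (cohMap f).obj (obOf W (vertex W.obj (res W.obj (m := c.1) g σ) i)) = b :=
  (app_obOf f _).trans ((congrArg (obOf Z) (vertex_res_app f g)).symm.trans (obOf_of_eq_degen hb))

lemma exists_of_vertex {y : Cell d} (g : y ⟶ c.2) {i : Fin (c.1.len + 1)} {b : Coh Z}
    (hb : vertex Z.obj (res Z.obj (m := c.1) g (f.hom.app _ σ)) i = degen Z.obj y b) :
    ∃ a : Coh W, b = (cohMap f).obj a ∧
      vertex W.obj (res W.obj (m := c.1) g σ) i = degen W.obj y a :=
  ⟨_, (app_obOf_vertex f g hb).symm, (degen_obOf W _).symm⟩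

/-- The values of `ConeDatum.base`. -/
def baseVal (t : ConeDatum σ ((EPresheaf.pull (cohMap f)).obj G)) {y : Cell d} (g : y ⟶ c.2)
    {i j : Fin (c.1.len + 1 + 1)} (q : Thick (coneDim c.1) i j y.2) {b : Coh Z}
    (hb : vertex Z.obj (res Z.obj (m := c.1) g (f.hom.app _ σ)) ((lastσ c.1).toOrderHom i) =
      degen Z.obj y b) (hi : i ≠ Fin.last _) (hj : j = Fin.last _) : (G.obj b).obj (op y) :=
  app_obOf_vertex f g hb ▸ t.val g q (degen_obOf W _).symm hi hj

lemma baseVal_eq (t : ConeDatum σ ((EPresheaf.pull (cohMap f)).obj G)) {y : Cell d}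
    (g : y ⟶ c.2) {i j : Fin (c.1.len + 1 + 1)} (q : Thick (coneDim c.1) i j y.2) {a : Coh W}
    (ha : vertex W.obj (res W.obj (m := c.1) g σ) ((lastσ c.1).toOrderHom i) = degen W.obj y a)
    (hb : vertex Z.obj (res Z.obj (m := c.1) g (f.hom.app _ σ)) ((lastσ c.1).toOrderHom i) =
      degen Z.obj y ((cohMap f).obj a)) (hi : i ≠ Fin.last _) (hj : j = Fin.last _) :
    t.baseVal f g q hb hi hj = t.val g q ha hi hj := by
  obtain rfl := obOf_of_eq_degen ha
  rfl

/-- A datum for `σ` with values in the restriction of `G` along `f` is a datum for `f σ` with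
values in `G`, because the vertices of `f σ` are the images of those of `σ`. -/
def base (t : ConeDatum σ ((EPresheaf.pull (cohMap f)).obj G)) :
    ConeDatum (c := c) (f.hom.app _ σ) G where
  val g _ _ q _ hb hi hj := t.baseVal f g q hb hi hj
  map_val h g i j q b hb hb' hi hj := by
    obtain ⟨a, rfl, ha⟩ := exists_of_vertex f g hb
    have ha' := vertex_res_of_obOf (obOf_of_vertex_res (σ := σ) (m := c.1) g ha) (h ≫ g)
    rw [t.baseVal_eq f g q ha, t.baseVal_eq f (h ≫ g) _ ha']
    exact t.map_val h g q ha ha' hi hj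
  act_val g i j l p q b b' hb hb' hi hj hl := by
    obtain ⟨a, rfl, ha⟩ := exists_of_vertex f g hb
    obtain ⟨a', rfl, ha'⟩ := exists_of_vertex f g hb'
    rw [t.baseVal_eq f g _ ha, t.baseVal_eq f g q ha']
    refine (t.act_val g p q ha ha' hi hj hl).trans ?_
    refine congrArg (fun z => G.act z _) ((emap_cohGen f _).trans ?_)
    exact cohGen_congr (res_app f g).symm rfl _ _ _ _

end ConeDatum

variable (σ : Elts W)

/-- The element `f σ` of `Z`. -/
abbrev mapElt : Elts Z := (CostructuredArrow.map f.hom).obj σ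

lemma adjunct_comp : adjunct σ ≫ f = adjunct (mapElt f σ) :=
  ((adjL d).homEquiv_naturality_right_symm _ f).symm

/-- The map `W_σ ⟶ Z_{f σ}`. -/
def coneTrans : coneOf σ ⟶ coneOf (mapElt f σ) :=
  pushout.desc (f ≫ coneInl (mapElt f σ)) (coneInr (mapElt f σ)) (by
    refine (Category.assoc _ _ _).symm.trans ?_
    rw [adjunct_comp]
    exact pushout.condition)

lemma coneInl_coneTrans : coneInl σ ≫ coneTrans f σ = f ≫ coneInl (mapElt f σ) :=
  pushout.inl_desc _ _ _

lemma coneInr_coneTrans : coneInr σ ≫ coneTrans f σ = coneInr (mapElt f σ) :=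
  pushout.inr_desc _ _ _

lemma coneTrans_apexElt : (coneTrans f σ).hom.app _ (apexElt σ) = apexElt (mapElt f σ) :=
  congrArg (fun α : _ ⟶ coneOf (mapElt f σ) => α.hom.app _
    (((adjL d).unit.app ((rep.{u} d).obj ((cone d).obj σ.left))).app
      (op ((cone d).obj σ.left)) ⟨𝟙 _⟩)) (coneInr_coneTrans f σ)

lemma cohMap_coneTrans_top : (cohMap (coneTrans f σ)).obj (top σ) = top (mapElt f σ) :=
  (app_obOf (coneTrans f σ) _).trans (congrArg (fun α : _ ⟶ coneOf (mapElt f σ) =>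
    obOf (coneOf (mapElt f σ)) (α.hom.app _
      (((adjL d).unit.app _).app _ (lastVertex σ.left)))) (coneInr_coneTrans f σ))

lemma coneOfMap_coneTrans {τ σ : Elts W} (g : τ ⟶ σ) :
    coneOfMap g ≫ coneTrans f σ =
      coneTrans f τ ≫ coneOfMap ((CostructuredArrow.map f.hom).map g) := by
  apply pushout.hom_ext
  · refine (Category.assoc _ _ _).symm.trans (Eq.trans ?_ (Category.assoc _ _ _))
    refine (congrArg (· ≫ coneTrans f σ) (coneInl_map g)).trans ((coneInl_coneTrans f σ).trans ?_)
    refine Eq.trans ?_ (congrArg (· ≫ coneOfMap _) (coneInl_coneTrans f τ)).symm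
    refine Eq.trans ?_ (Category.assoc _ _ _).symm
    exact congrArg (f ≫ ·) (coneInl_map ((CostructuredArrow.map f.hom).map g)).symm
  · refine (Category.assoc _ _ _).symm.trans (Eq.trans ?_ (Category.assoc _ _ _))
    refine (congrArg (· ≫ coneTrans f σ) (coneInr_map g)).trans ?_
    refine (Category.assoc _ _ _).trans ?_
    refine (congrArg (_ ≫ ·) (coneInr_coneTrans f σ)).trans ?_
    refine Eq.trans ?_ (congrArg (· ≫ coneOfMap _) (coneInr_coneTrans f τ)).symm
    exact (coneInr_map ((CostructuredArrow.map f.hom).map g)).symm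

lemma reprMap_cohGen {C : Type u} [EnrichedCategory (ThetaSpace.{u} d) C] {Y Y' : Pcat.{u} d}
    (H : EnrichedFunctor (ThetaSpace.{u} d) C (Coh Y)) (F : Y ⟶ Y')
    (K : EnrichedFunctor (ThetaSpace.{u} d) C (Coh Y')) (h : H.comp _ (cohMap F) = K) {t : Coh Y}
    {t' : Coh Y'} (ht : (cohMap F).obj t = t') {a : C} {y : Cell d} {m : SimplexCategory}
    (τ : Y.obj.obj (op (m, y))) {i j : Fin (m.len + 1)} (p : Thick m i j y.2)
    (h₁ : vertex Y.obj τ i = degen Y.obj y (H.obj a)) (h₂ : vertex Y.obj τ j = degen Y.obj y t)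
    (h₃ : vertex Y'.obj (F.hom.app _ τ) i = degen Y'.obj y (K.obj a))
    (h₄ : vertex Y'.obj (F.hom.app _ τ) j = degen Y'.obj y t') :
    ((EPresheaf.reprMap H (cohMap F) K h ht).app a).app (op y) (cohGen ⟨m, τ, i, j, p, h₁, h₂⟩) =
      cohGen ⟨m, F.hom.app _ τ, i, j, p, h₃, h₄⟩ := by
  subst h ht
  rfl

/-- The map from `St_W(σ)` to the restriction of `St_Z(f σ)` along `ℭ f`. -/
def stTrans : stObj σ ⟶ (EPresheaf.pull (cohMap f)).obj (stObj (mapElt f σ)) :=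
  EPresheaf.reprMap (cohMap (coneInl σ)) (cohMap (coneTrans f σ))
    ((cohMap f).comp _ (cohMap (coneInl (mapElt f σ))))
    (by rw [← cohMap_comp, ← cohMap_comp, coneInl_coneTrans]) (cohMap_coneTrans_top f σ)

lemma stTrans_univDatum {y : Cell d} (g : y ⟶ σ.left.2) {i j : Fin (σ.left.1.len + 1 + 1)}
    (q : Thick (coneDim σ.left.1) i j y.2) {a : Coh W}
    (ha : vertex W.obj (res W.obj (m := σ.left.1) g (eltOf σ)) ((lastσ σ.left.1).toOrderHom i) =
      degen W.obj y a)
    (hb : vertex Z.obj (res Z.obj (m := σ.left.1) g (eltOf (mapElt f σ)))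
      ((lastσ σ.left.1).toOrderHom i) = degen Z.obj y ((cohMap f).obj a))
    (hi : i ≠ Fin.last _) (hj : j = Fin.last _) :
    ((stTrans f σ).app a).app (op y) ((univDatum σ).val g q ha hi hj) =
      (univDatum (mapElt f σ)).val g q hb hi hj := by
  have e : (coneTrans f σ).hom.app _ (res _ (m := coneDim σ.left.1) g (apexElt σ)) =
      res _ (m := coneDim σ.left.1) g (apexElt (mapElt f σ)) :=
    (NatTrans.naturality_apply (coneTrans f σ).hom (Prod.mkHom (𝟙 (coneDim σ.left.1)) g).op
      (apexElt σ)).trans (congrArg (res _ (m := coneDim σ.left.1) g) (coneTrans_apexElt f σ))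
  have h₁ := vertex_apexElt_degen (σ := mapElt f σ) g hi hb
  have h₂ := vertex_apexElt_last (σ := mapElt f σ) g hj
  refine (reprMap_cohGen (cohMap (coneInl σ)) (coneTrans f σ)
    ((cohMap f).comp _ (cohMap (coneInl (mapElt f σ)))) _ (cohMap_coneTrans_top f σ) _ q
    (vertex_apexElt_degen g hi ha)
    (vertex_apexElt_last g hj) ((congrArg (fun τ => vertex _ τ i) e).trans h₁)
    ((congrArg (fun τ => vertex _ τ j) e).trans h₂)).trans ?_
  exact cohGen_congr e rfl _ _ h₁ h₂

lemma reprMap_congr {C D E : Type u} [EnrichedCategory (ThetaSpace.{u} d) C]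
    [EnrichedCategory (ThetaSpace.{u} d) D] [EnrichedCategory (ThetaSpace.{u} d) E]
    {H : EnrichedFunctor (ThetaSpace.{u} d) E C} {F F' : EnrichedFunctor (ThetaSpace.{u} d) C D}
    {K : EnrichedFunctor (ThetaSpace.{u} d) E D} (e : F = F') (h : H.comp _ F = K)
    (h' : H.comp _ F' = K) {t : C} {t' : D} (ht : F.obj t = t') (ht' : F'.obj t = t') :
    EPresheaf.reprMap H F K h ht = EPresheaf.reprMap H F' K h' ht' := by
  subst e
  rfl

lemma pull_map_reprMap {B C D E : Type u} [EnrichedCategory (ThetaSpace.{u} d) B]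
    [EnrichedCategory (ThetaSpace.{u} d) C]
    [EnrichedCategory (ThetaSpace.{u} d) D] [EnrichedCategory (ThetaSpace.{u} d) E]
    (P : EnrichedFunctor (ThetaSpace.{u} d) B E)
    (H : EnrichedFunctor (ThetaSpace.{u} d) E C) (F : EnrichedFunctor (ThetaSpace.{u} d) C D)
    (K : EnrichedFunctor (ThetaSpace.{u} d) E D) (h : H.comp _ F = K)
    (h' : (P.comp _ H).comp _ F = P.comp _ K) {t : C} {t' : D} (ht : F.obj t = t') :
    (EPresheaf.pull P).map (EPresheaf.reprMap H F K h ht) =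
      EPresheaf.reprMap (P.comp _ H) F (P.comp _ K) h' ht := by
  subst h ht
  rfl

lemma stMap_stTrans {τ σ : Elts W} (g : τ ⟶ σ) :
    stMap g ≫ stTrans f σ = stTrans f τ ≫
      (EPresheaf.pull (cohMap f)).map (stMap ((CostructuredArrow.map f.hom).map g)) := by
  have hσ : (cohMap (coneInl σ)).comp _ (cohMap (coneTrans f σ)) =
      (cohMap f).comp _ (cohMap (coneInl (mapElt f σ))) := by
    rw [← cohMap_comp, ← cohMap_comp, coneInl_coneTrans]
  have h : (cohMap (coneInl τ)).comp _ (cohMap (coneOfMap g ≫ coneTrans f σ)) =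
      (cohMap f).comp _ (cohMap (coneInl (mapElt f σ))) := by
    rw [← hσ, ← cohMap_comp, ← cohMap_comp, ← coneInl_map g, Category.assoc]
  have ht : (cohMap (coneOfMap g ≫ coneTrans f σ)).obj (top τ) = top (mapElt f σ) :=
    (congrArg (cohMap (coneTrans f σ)).obj (cohMap_top g)).trans (cohMap_coneTrans_top f σ)
  have e := coneOfMap_coneTrans f g
  refine (EPresheaf.reprMap_comp _ _ _ _ _ _ _ _ _ _ (cohMap_comp _ _) h ht).symm.trans ?_
  refine (reprMap_congr (congrArg cohMap e) h (e ▸ h) ht (e ▸ ht)).trans ?_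
  refine (EPresheaf.reprMap_comp (cohMap (coneInl τ)) (cohMap (coneTrans f τ))
    ((cohMap f).comp _ (cohMap (coneInl (mapElt f τ)))) ?_ (cohMap_coneTrans_top f τ)
    (cohMap (coneOfMap ((CostructuredArrow.map f.hom).map g))) _ ?_
    (cohMap_top ((CostructuredArrow.map f.hom).map g)) _ (cohMap_comp _ _) _ _).trans ?_
  · rw [← cohMap_comp, ← cohMap_comp, coneInl_coneTrans]
  · exact congrArg ((cohMap f).comp _) ((cohMap_comp _ _).symm.trans
      (congrArg cohMap (coneInl_map ((CostructuredArrow.map f.hom).map g))))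
  · exact congrArg (stTrans f τ ≫ ·) (pull_map_reprMap _ _ _ _ _ _ _).symm

/-- The map `(ℭ f)_! St_W(σ) ⟶ St_Z(f σ)`. -/
def lanStHom : (EPresheaf.lan (cohMap f)).obj (stObj σ) ⟶ stObj (mapElt f σ) :=
  ((EPresheaf.lanAdj (cohMap f)).homEquiv _ _).symm (stTrans f σ)

lemma unit_lanStHom : (EPresheaf.lanAdj (cohMap f)).unit.app _ ≫
    (EPresheaf.pull (cohMap f)).map (lanStHom f σ) = stTrans f σ :=
  ((EPresheaf.lanAdj (cohMap f)).homEquiv_unit _ _ _).symm.trans (Equiv.apply_symm_apply _ _)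

/-- The inverse of `lanStHom`: the map that corresponds to the image of the universal datum of `σ`
under the unit of the adjunction. -/
def lanStInv : stObj (mapElt f σ) ⟶ (EPresheaf.lan (cohMap f)).obj (stObj σ) :=
  stDesc (((univDatum σ).postcomp ((EPresheaf.lanAdj (cohMap f)).unit.app (stObj σ))).base f)

lemma lanStInv_univDatum {y : Cell d} (g : y ⟶ σ.left.2) {i j : Fin (σ.left.1.len + 1 + 1)}
    (q : Thick (coneDim σ.left.1) i j y.2) {a : Coh W}
    (ha : vertex W.obj (res W.obj (m := σ.left.1) g (eltOf σ)) ((lastσ σ.left.1).toOrderHom i) =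
      degen W.obj y a)
    (hb : vertex Z.obj (res Z.obj (m := σ.left.1) g (eltOf (mapElt f σ)))
      ((lastσ σ.left.1).toOrderHom i) = degen Z.obj y ((cohMap f).obj a))
    (hi : i ≠ Fin.last _) (hj : j = Fin.last _) :
    ((lanStInv f σ).app _).app (op y) ((univDatum (mapElt f σ)).val g q hb hi hj) =
      (((EPresheaf.lanAdj (cohMap f)).unit.app (stObj σ)).app a).app (op y)
        ((univDatum σ).val g q ha hi hj) :=
  (stDesc_univDatum (σ := mapElt f σ) _ g q hb hi hj).trans
    (ConeDatum.baseVal_eq f _ g q ha hb hi hj)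

/-- The isomorphism `(ℭ f)_! St_W(σ) ≅ St_Z(f σ)`. -/
def lanStIso : (EPresheaf.lan (cohMap f)).obj (stObj σ) ≅ stObj (mapElt f σ) where
  hom := lanStHom f σ
  inv := lanStInv f σ
  hom_inv_id := by
    apply ((EPresheaf.lanAdj (cohMap f)).homEquiv _ _).injective
    refine ((EPresheaf.lanAdj (cohMap f)).homEquiv_naturality_right _ _).trans ?_
    refine Eq.trans ?_ ((EPresheaf.lanAdj (cohMap f)).homEquiv_id _).symm
    refine (congrArg (· ≫ _) (Equiv.apply_symm_apply _ _)).trans ?_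
    apply stObj_hom_ext
    intro y g i j q a ha hi hj
    have hb := ConeDatum.vertex_res_app_of f g ha
    exact (congrArg (((lanStInv f σ).app _).app (op y))
      (stTrans_univDatum f σ g q ha hb hi hj)).trans (lanStInv_univDatum f σ g q ha hb hi hj)
  inv_hom_id := by
    apply stObj_hom_ext
    intro y g i j q b hb hi hj
    obtain ⟨a, rfl, ha⟩ := ConeDatum.exists_of_vertex f (σ := eltOf σ) g hb
    refine (congrArg (((lanStHom f σ).app _).app (op y))
      (lanStInv_univDatum f σ g q ha hb hi hj)).trans ?_
    refine Eq.trans ?_ (stTrans_univDatum f σ g q ha hb hi hj)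
    exact congrArg (fun α : stObj σ ⟶ (EPresheaf.pull (cohMap f)).obj (stObj (mapElt f σ)) =>
      (α.app a).app (op y) ((univDatum σ).val g q ha hi hj)) (unit_lanStHom f σ)

/-- The isomorphisms `(ℭ f)_! St_W(σ) ≅ St_Z(f σ)` are natural in `σ`. -/
def lanStEltsIso :
    stElts W ⋙ EPresheaf.lan (cohMap f) ≅ CostructuredArrow.map f.hom ⋙ stElts Z :=
  NatIso.ofComponents (lanStIso f) (by
    intro τ σ g
    apply ((EPresheaf.lanAdj (cohMap f)).homEquiv _ _).injective
    refine ((EPresheaf.lanAdj (cohMap f)).homEquiv_naturality_left _ _).trans ?_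
    refine Eq.trans ?_ ((EPresheaf.lanAdj (cohMap f)).homEquiv_naturality_right _ _).symm
    refine (congrArg (stMap g ≫ ·) (Equiv.apply_symm_apply _ _)).trans ?_
    refine (stMap_stTrans f g).trans ?_
    exact (congrArg (· ≫ _) (Equiv.apply_symm_apply _ _)).symm)

end BaseChange

/-! ### Slice categories and Kan extensions -/

section KanExtension

universe v₁ v₂ u₁ u₂

variable {D : Type u₁} [Category.{v₁} D] {T : Type u₂} [Category.{v₂} T] (F : D ⥤ T) {X Y : T}
  (f : X ⟶ Y)

/-- The square formed by the functors from the comma categories of `F` to the slice categories of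
`T`, and by postcomposition with `f`. It commutes up to equality on underlying objects. -/
def toOverSquare : TwoSquare (CostructuredArrow.map f) (CostructuredArrow.toOver F X)
    (CostructuredArrow.toOver F Y) (Over.map f) :=
  TwoSquare.mk _ _ _ _
    { app σ := Over.homMk (𝟙 (F.obj σ.left)) (Category.id_comp _)
      naturality σ τ g := by
        ext
        exact (Category.comp_id _).trans (Category.id_comp _).symm }

/-- For a morphism `g` over `Y` from `F σ` to an object `A` over `X`, the factorization of `g` with
middle object `F σ ⟶ A ⟶ X` maps to every other factorization of `g` through the square, so the
category of these factorizations is connected. -/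
instance guitartExact_toOverSquare : (toOverSquare F f).GuitartExact := by
  rw [TwoSquare.guitartExact_iff_isConnected_rightwards]
  intro σ A g
  have hg : g.left ≫ A.hom ≫ f = σ.hom := Over.w g
  let X₀ : (toOverSquare F f).StructuredArrowRightwards g :=
    TwoSquare.StructuredArrowRightwards.mk (toOverSquare F f) g
      (CostructuredArrow.mk (show F.obj σ.left ⟶ X from g.left ≫ A.hom))
      (CostructuredArrow.homMk (𝟙 σ.left)
        ((congrArg (· ≫ _) (F.map_id _)).trans ((Category.id_comp _).trans
          ((Category.assoc _ _ _).trans hg))))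
      (Over.homMk g.left rfl) (by
        ext
        refine (congrArg (· ≫ _) (F.map_id _)).trans ((Category.id_comp _).trans ?_)
        exact Category.id_comp _)
  have φ : ∀ P : (toOverSquare F f).StructuredArrowRightwards g, Nonempty (X₀ ⟶ P) := by
    intro P
    obtain ⟨τ, a, b, comm, rfl⟩ := TwoSquare.StructuredArrowRightwards.mk_surjective P
    have e : F.map a.left ≫ b.left = g.left :=
      (congrArg (F.map a.left ≫ ·) (Category.id_comp b.left).symm).trans
        (congrArg (fun h => h.left) comm)
    have hb : b.left ≫ A.hom = τ.hom := Over.w b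
    refine ⟨StructuredArrow.homMk (CostructuredArrow.homMk
      (CostructuredArrow.homMk a.left ?_) ?_) ?_⟩
    · exact (congrArg (F.map a.left ≫ ·) hb.symm).trans ((Category.assoc _ _ _).symm.trans
        (congrArg (· ≫ A.hom) e))
    · ext
      exact e
    · ext
      exact Category.id_comp _
  have : Nonempty ((toOverSquare F f).StructuredArrowRightwards g) := ⟨X₀⟩
  apply zigzag_isConnected
  intro P Q
  exact Zigzag.of_inv_hom (φ P).some (φ Q).some

end KanExtension

variable {W Z : Pcat.{u} d} (f : W ⟶ Z)

/-- Both composites are left Kan extensions from the category of elements of `W`: the left adjoint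
`(ℭ f)_!` preserves the left Kan extension `St W`, and restriction along a Guitart exact square
preserves the pointwise left Kan extension `St Z`. An isomorphism of the functors that they extend
is therefore enough. -/
theorem nonempty_iso_of_elts
    (e : stElts W ⋙ EPresheaf.lan (cohMap f) ≅ CostructuredArrow.map f.hom ⋙ stElts Z) :
    Nonempty (St W ⋙ EPresheaf.lan (cohMap f) ≅ Over.map f.hom ⋙ St Z) := by
  have : PreservesColimitsOfSize.{0, u} (EPresheaf.lan (cohMap f)) :=
    (EPresheaf.lanAdj (cohMap f)).leftAdjoint_preservesColimits
  let hZ := Functor.isPointwiseLeftKanExtensionOfIsLeftKanExtension _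
    ((CostructuredArrow.toOver (rep d) Z.obj).leftKanExtensionUnit (stElts Z))
  obtain ⟨β, hβ⟩ : ∃ β, (Over.map f.hom ⋙ St Z).IsLeftKanExtension
      (F := CostructuredArrow.map f.hom ⋙ stElts Z)
      (L := CostructuredArrow.toOver (rep d) W.obj) β :=
    ⟨_, (hZ.compTwoSquare (toOverSquare (rep d) f.hom)).isLeftKanExtension⟩
  obtain ⟨α, hα⟩ : ∃ α, (St W ⋙ EPresheaf.lan (cohMap f)).IsLeftKanExtension
      (F := stElts W ⋙ EPresheaf.lan (cohMap f))
      (L := CostructuredArrow.toOver (rep d) W.obj) α :=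
    ⟨_, Functor.PreservesLeftKanExtension.preserves (G := EPresheaf.lan (cohMap f))
      ((CostructuredArrow.toOver (rep d) W.obj).leftKanExtension (stElts W))
      ((CostructuredArrow.toOver (rep d) W.obj).leftKanExtensionUnit (stElts W))⟩
  exact ⟨Functor.leftKanExtensionUniqueOfIso _ α e _ β⟩

end ThetaSpaces

end

theorem proposition3p3 {d : ℕ} {W Z : ThetaSpaces.Pcat.{u} d} (f : W ⟶ Z) :
    Nonempty (ThetaSpaces.St W ⋙ ThetaSpaces.EPresheaf.lan (ThetaSpaces.cohMap f) ≅
      Over.map f.hom ⋙ ThetaSpaces.St Z) :=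
  ThetaSpaces.nonempty_iso_of_elts f (ThetaSpaces.lanStEltsIso f)
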